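/- **Setting.** Let $M$ be a smooth $d$-dimensional manifold (Hausdorff, second countable, without boundary) with a Weyl class $[g,a]$: the class of a pair of a smooth metric $g$ of signature $(p,q)$ and a smooth one-form $a$ under $(g,a)\sim(\mathcal B^{-2}g,\;a-d\ln\mathcal B)$, $\mathcal B>0$ smooth. Let $\pi:\mathcal P_W\to M$ be a smooth principal $\mathbb R_+$-bundle with dilatations $\delta_s$ (a Weyl structure), identified over $M$ with the metric bundle $\{(x,s^2g_x): s>0\}$ so that $\delta_s$ corresponds to $(x,h)\mapsto(x,s^2h)$. The tautological tensor on $\mathcal P_W$ is $\mathbf g_0(w_1,w_2)=h(\pi_*w_1,\pi_*w_2)$ at the point corresponding to $(x,h)$. Fix a representative $(g,a)$; it determines the fibre coordinate $t>0$ on $\mathcal P_W$ by $h=t^2g_x$, and the form $n=t^{-1}dt+\pi^*a$. Dilatations act on $\mathcal P_W\times\mathbb R$ through the first factor; their generator is $\mathcal T=t\partial_t$. Write $\rho$ for the coordinate on $\mathbb R$ and $\mathcal U=\partial_\rho$ for the tangent field of the curves $\rho\mapsto(z,\rho)$. A *Weyl pre-ambient space* is a pair $(\tilde M,\tilde g)$,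 where $\tilde M\subset\mathcal P_W\times\mathbb R$ is a dilatation-invariant open neighbourhood of $\mathcal P_W\times\{0\}$ and $\tilde g$ is a smooth metric of signature $(p+1,q+1)$ on $\tilde M$ with $\delta_s^*\tilde g=s^2\tilde g$ for all $s>0$, whose pullback along $z\mapsto(z,0)$ is $\mathbf g_0$. It is in *Weyl-normal form with acceleration $\mathcal A$* (relative to $(g,a)$) if (1) for each $z\in\mathcal P_W$ the set of $\rho$ with $(z,\rho)\in\tilde M$ is an open interval containing $0$; (2) $\mathcal A=\tilde\nabla_{\mathcal U}\,\mathcal U$, with $\tilde\nabla$ the Levi-Civita connection of $\tilde g$, and $\tilde g(\mathcal T,\mathcal A)=0$; (3) $\tilde g=\mathbf g_0+2t^2\,n\,d\rho$ at all points of $\mathcal P_W\times\{0\}$. A *law of acceleration* on $(\tilde M,\tilde g)$ prescribes for each $y\in\tilde M$ and $v\in T_y\tilde M$ a vector $\mathcal A_y(v)\in T_y\tilde M$, smoothly in $(y,v)$, with $\mathcal A_{\delta_sy}(\delta_{s*}v)=\delta_{s*}\mathcal A_y(v)$ for $s>0$ and $\tilde g(\mathcal T,\mathcal A_y(v))=0$.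 (A dilatation-invariant vector field orthogonal to $\mathcal T$, for example $0$, is the special case without dependence on $v$.) **Theorem.** Let $(\tilde M,\tilde g)$ be a Weyl pre-ambient space for $(M,[g,a])$, let $(g,a)$ be a representative of the Weyl class, and let $\mathcal A$ be a law of acceleration on $(\tilde M,\tilde g)$. Then there is a dilatation-invariant open set $\tilde M'\subset\mathcal P_W\times\mathbb R$ containing $\mathcal P_W\times\{0\}$ on which there is a unique map $\phi:\tilde M'\to\tilde M$ such that $\phi$ is a diffeomorphism onto an open subset of $\tilde M$, commutes with dilatations, is the identity on $\mathcal P_W\times\{0\}$, and $(\tilde M',\phi^*\tilde g)$ is a Weyl pre-ambient space in Weyl-normal form relative to $(g,a)$, with the acceleration $\mathcal A'$ given by $\phi_*\mathcal A'=\mathcal A(\phi_*\mathcal U)$ (that is, the curves $\rho\mapsto\phi(z,\rho)$ have the acceleration prescribed by $\mathcal A$). If moreover $\tilde g(\mathcal A_y(v),v)=0$ for all $y$ and $v$, then also $(\phi^*\tilde g)(\mathcal A',\mathcal U)=0$ on $\tilde M'$. -/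

import Mathlib

open Set Manifold Bundle
open scoped ContDiff Topology

noncomputable section

/-! ## Smooth manifolds: forms, pseudo-Riemannian metrics, the Levi-Civita connection -/

section Generic

variable {F : Type*} [NormedAddCommGroup F] [NormedSpace ℝ F]
  {H : Type*} [TopologicalSpace H] (I : ModelWithCorners ℝ F H)
  {X : Type*} [TopologicalSpace X] [ChartedSpace H X]
  {F' : Type*} [NormedAddCommGroup F'] [NormedSpace ℝ F']
  {H' : Type*} [TopologicalSpace H'] (I' : ModelWithCorners ℝ F' H')
  {X' : Type*} [TopologicalSpace X'] [ChartedSpace H' X']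

/-- (Not necessarily continuous) fields of bilinear forms on the tangent spaces of `X`. -/
abbrev BilinField (I : ModelWithCorners ℝ F H) (X : Type*) [TopologicalSpace X]
    [ChartedSpace H X] : Type _ :=
  ∀ x : X, TangentSpace I x →L[ℝ] TangentSpace I x →L[ℝ] ℝ

/-- (Not necessarily continuous) one-forms on `X`. -/
abbrev CovectorField (I : ModelWithCorners ℝ F H) (X : Type*) [TopologicalSpace X]
    [ChartedSpace H X] : Type _ :=
  ∀ x : X, TangentSpace I x →L[ℝ] ℝ

/-- A real-valued function `B` on `V × V` (in practice a bilinear form) has signature `(p, q)`: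
in some basis its matrix is `diag(1, …, 1, -1, …, -1)` with `p` entries `1` and `q` entries `-1`.
In particular `dim V = p + q` and the form is nondegenerate. -/
def HasSignature {V : Type*} [AddCommGroup V] [Module ℝ V] (B : V → V → ℝ) (p q : ℕ) : Prop :=
  ∃ b : Module.Basis (Fin p ⊕ Fin q) ℝ V,
    ∀ i j, B (b i) (b j) = if i = j then Sum.elim (fun _ => (1 : ℝ)) (fun _ => -1) i else 0

/-- `g` is a smooth pseudo-Riemannian metric of signature `(p, q)` on the (open) set `s`. -/
structure IsPseudoRiemannianOn [IsManifold I 1 X] (p q : ℕ) (g : BilinField I X) (s : Set X) :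
    Prop where
  smooth : ContMDiffOn I (I.prod 𝓘(ℝ, F →L[ℝ] F →L[ℝ] ℝ)) ∞
    (fun x ↦ TotalSpace.mk' (F →L[ℝ] F →L[ℝ] ℝ) x (g x)) s
  symm : ∀ x ∈ s, ∀ v w, g x v w = g x w v
  signature : ∀ x ∈ s, HasSignature (fun v w ↦ g x v w) p q

/-- The pullback `f^* g`. -/
def pullbackForm (f : X → X') (g : BilinField I' X') : BilinField I X :=
  fun x ↦ ContinuousLinearMap.bilinearComp (E := F') (F := F') (E' := F) (F' := F) (G := ℝ)
    (g (f x)) (mfderiv I I' f x) (mfderiv I I' f x)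

/-- `nabla` is the Levi-Civita connection of `g` on the open set `s`: it is a covariant derivative
on `TX` over `s`, it is torsion-free, and it preserves `g`. As in Mathlib, `nabla Y x (X x)` is
`(∇_X Y)(x)`. -/
structure IsLeviCivitaOn [IsManifold I 1 X] (g : BilinField I X) (s : Set X)
    (nabla : (∀ x : X, TangentSpace I x) → ∀ x : X, TangentSpace I x →L[ℝ] TangentSpace I x) :
    Prop where
  covariant : IsCovariantDerivativeOn F nabla s
  torsion_free : ∀ (Y Z : ∀ x : X, TangentSpace I x), ∀ x ∈ s,
    MDifferentiableAt I I.tangent (fun y ↦ (⟨y, Y y⟩ : TangentBundle I X)) x →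
    MDifferentiableAt I I.tangent (fun y ↦ (⟨y, Z y⟩ : TangentBundle I X)) x →
    nabla Z x (Y x) - nabla Y x (Z x) = VectorField.mlieBracket I Y Z x
  metric : ∀ (Y Z : ∀ x : X, TangentSpace I x), ∀ x ∈ s, ∀ v : TangentSpace I x,
    MDifferentiableAt I I.tangent (fun y ↦ (⟨y, Y y⟩ : TangentBundle I X)) x →
    MDifferentiableAt I I.tangent (fun y ↦ (⟨y, Z y⟩ : TangentBundle I X)) x →
    mvfderiv I (fun y ↦ g y (Y y) (Z y)) x v
      = g x (nabla Y x v) (Z x) + g x (Y x) (nabla Z x v)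

/-- `f` restricts to a diffeomorphism from the open set `s` onto the (then open) set `t`. -/
def IsDiffeoOn (f : X → X') (s : Set X) (t : Set X') : Prop :=
  IsOpen s ∧ BijOn f s t ∧ IsLocalDiffeomorphOn I I' ∞ f s

end Generic

/-! ## Weyl manifolds -/

section Weyl

variable (d p q : ℕ) (M : Type*) [TopologicalSpace M] [ChartedSpace (EuclideanSpace ℝ (Fin d)) M]
  [IsManifold (𝓡 d) ∞ M]

/-- A pair `(g, a)` of a smooth metric of signature `(p, q)` and a smooth one-form on `M`. -/
structure WeylPair where
  /-- the metric `g` -/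
  g : BilinField (𝓡 d) M
  /-- the one-form `a` -/
  a : CovectorField (𝓡 d) M
  isMetric : IsPseudoRiemannianOn (𝓡 d) p q g univ
  smooth_a : ContMDiff (𝓡 d) ((𝓡 d).prod 𝓘(ℝ, EuclideanSpace ℝ (Fin d) →L[ℝ] ℝ)) ∞
    (fun x ↦ TotalSpace.mk' (EuclideanSpace ℝ (Fin d) →L[ℝ] ℝ) x (a x))

variable {d p q M}

/-- `(g', a') = (B⁻² g, a - d ln B)` for a smooth positive function `B`. -/
def WeylPair.Rel (r r' : WeylPair d p q M) : Prop :=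
  ∃ B : M → ℝ, ContMDiff (𝓡 d) 𝓘(ℝ, ℝ) ∞ B ∧ (∀ x, 0 < B x) ∧
    (∀ x, r'.g x = (B x ^ 2)⁻¹ • r.g x) ∧
    ∀ x, r'.a x = r.a x - mvfderiv (𝓡 d) (fun y ↦ Real.log (B y)) x

theorem mdifferentiableAt_log_of_pos {B : M → ℝ} (hB : ContMDiff (𝓡 d) 𝓘(ℝ, ℝ) ∞ B)
    (hpos : ∀ x, 0 < B x) (x : M) :
    MDifferentiableAt (𝓡 d) 𝓘(ℝ, ℝ) (fun y ↦ Real.log (B y)) x := by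
  have h1 : MDifferentiableAt 𝓘(ℝ, ℝ) 𝓘(ℝ, ℝ) Real.log (B x) :=
    (Real.differentiableAt_log (hpos x).ne').mdifferentiableAt
  exact h1.comp x (hB.mdifferentiableAt (by simp))

variable (d p q M) in
/-- Weyl equivalence of pairs `(g, a)`. -/
instance WeylPair.setoid : Setoid (WeylPair d p q M) where
  r := WeylPair.Rel
  iseqv := by
    refine ⟨fun r ↦ ⟨fun _ ↦ 1, contMDiff_const, fun _ ↦ one_pos, by simp, ?_⟩, ?_, ?_⟩
    · intro x
      simp [mvfderiv_const]
    · rintro r r' ⟨B, hB, hpos, hg, ha⟩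
      refine ⟨fun x ↦ (B x)⁻¹, hB.inv₀ (fun x ↦ (hpos x).ne'), fun x ↦ inv_pos.2 (hpos x), ?_, ?_⟩
      · intro x
        have : B x ≠ 0 := (hpos x).ne'
        rw [hg x, smul_smul]
        field_simp
        simp
      · intro x
        have h : (fun y ↦ Real.log (B y)⁻¹) = -(fun y ↦ Real.log (B y)) := by
          funext y; simp
        rw [h, mvfderiv_neg, ha x]
        simp
    · rintro r r' r'' ⟨B, hB, hpos, hg, ha⟩ ⟨B', hB', hpos', hg', ha'⟩
      refine ⟨fun x ↦ B x * B' x, hB.mul hB', fun x ↦ mul_pos (hpos x) (hpos' x), ?_, ?_⟩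
      · intro x
        rw [hg' x, hg x, smul_smul, mul_pow, mul_inv, mul_comm]
      · intro x
        have h : (fun y ↦ Real.log (B y * B' y))
            = (fun y ↦ Real.log (B y)) + (fun y ↦ Real.log (B' y)) := by
          funext y
          exact Real.log_mul (hpos y).ne' (hpos' y).ne'
        rw [h, mvfderiv_add (mdifferentiableAt_log_of_pos hB hpos x)
          (mdifferentiableAt_log_of_pos hB' hpos' x), ha' x, ha x]
        abel

variable (d p q M) in
/-- A Weyl class `[g, a]` on `M`, of signature `(p, q)`. -/
def WeylClass : Type _ := Quotient (WeylPair.setoid d p q M)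

/-- The Weyl class represented by `(g, a)`. -/
def WeylPair.toClass (r : WeylPair d p q M) : WeylClass d p q M := Quotient.mk _ r

/-- The fibre over `x` of the metric bundle: all `s² g_x` with `s > 0` and `g` in the class. -/
def metricBundle (c : WeylClass d p q M) (x : M) :
    Set (TangentSpace (𝓡 d) x →L[ℝ] TangentSpace (𝓡 d) x →L[ℝ] ℝ) :=
  {h | ∃ r : WeylPair d p q M, r.toClass = c ∧ ∃ s : ℝ, 0 < s ∧ h = s ^ 2 • r.g x}

end Weyl

/-! ## Weyl structures -/

section WeylStructure

variable (d p q : ℕ) (M : Type*) [TopologicalSpace M] [ChartedSpace (EuclideanSpace ℝ (Fin d)) M]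
  [IsManifold (𝓡 d) ∞ M]
  (P : Type*) [TopologicalSpace P] [ChartedSpace (EuclideanSpace ℝ (Fin (d + 1))) P]
  [IsManifold (𝓡 (d + 1)) ∞ P]

/-- A Weyl structure: the structure on the `(d+1)`-manifold `P` of a smooth principal
`ℝ_+`-bundle over `M`. The action (the dilatations) is `δ s`, `s > 0`; its values for `s ≤ 0`
are irrelevant. -/
structure WeylStructure where
  /-- the dilatations -/
  δ : ℝ → P → P
  /-- the projection -/
  proj : P → M
  δ_one : ∀ z, δ 1 z = z
  δ_mul : ∀ s s' : ℝ, 0 < s → 0 < s' → ∀ z, δ (s * s') z = δ s' (δ s z)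
  δ_free : ∀ s : ℝ, 0 < s → ∀ z, δ s z = z → s = 1
  δ_smooth : ContMDiffOn (𝓘(ℝ, ℝ).prod (𝓡 (d + 1))) (𝓡 (d + 1)) ∞
    (fun w : ℝ × P ↦ δ w.1 w.2) (Ioi 0 ×ˢ univ)
  proj_smooth : ContMDiff (𝓡 (d + 1)) (𝓡 d) ∞ proj
  proj_δ : ∀ s : ℝ, 0 < s → ∀ z, proj (δ s z) = proj z
  local_trivialization : ∀ x : M, ∃ U : Set M, IsOpen U ∧ x ∈ U ∧ ∃ τ : P → ℝ,
    IsDiffeoOn (𝓡 (d + 1)) ((𝓡 d).prod 𝓘(ℝ, ℝ)) (fun z ↦ (proj z, τ z)) (proj ⁻¹' U) (U ×ˢ Ioi 0) ∧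
    ∀ z ∈ proj ⁻¹' U, ∀ s : ℝ, 0 < s → τ (δ s z) = τ z * s

variable {d p q M P}

/-- `t` is a fibre coordinate which identifies the point of `P` over `x` with coordinate `t` with
the element `(x, t² g_x)` of the metric bundle, where `h z` is the form assigned to `z ∈ P`. -/
structure IsFibreCoordinate (W : WeylStructure d M P)
    (h : ∀ z : P, TangentSpace (𝓡 d) (W.proj z) →L[ℝ] TangentSpace (𝓡 d) (W.proj z) →L[ℝ] ℝ)
    (g : BilinField (𝓡 d) M) (t : P → ℝ) : Prop where
  smooth : ContMDiff (𝓡 (d + 1)) 𝓘(ℝ, ℝ) ∞ t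
  pos : ∀ z, 0 < t z
  dilate : ∀ s : ℝ, 0 < s → ∀ z, t (W.δ s z) = t z * s
  form_eq : ∀ z, h z = t z ^ 2 • g (W.proj z)

/-- An isomorphism over `M` of the Weyl structure `P` with the metric bundle of the class `c`,
`z ↦ (proj z, form z)`, that intertwines the dilatations `δ_s` with `(x, h) ↦ (x, s² h)`. The smooth
structure of the metric bundle is the one given by its global trivializations
`(x, s² g_x) ↦ (x, s)`, for `g` in the class. -/
structure MetricBundleIso (W : WeylStructure d M P) (c : WeylClass d p q M) where
  /-- the element of the metric bundle that corresponds to a point of `P` -/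
  form : ∀ z : P, TangentSpace (𝓡 d) (W.proj z) →L[ℝ] TangentSpace (𝓡 d) (W.proj z) →L[ℝ] ℝ
  form_mem : ∀ z, form z ∈ metricBundle c (W.proj z)
  form_δ : ∀ s : ℝ, 0 < s → ∀ z, form (W.δ s z) = s ^ 2 • form z
  form_smooth : ∀ r : WeylPair d p q M, r.toClass = c → ∃ t, IsFibreCoordinate W form r.g t

/-- The tautological tensor `𝐠₀` on `P`: `𝐠₀(w₁, w₂) = h(π_* w₁, π_* w₂)`, where `h` is the form
corresponding to the base point. -/
def tautologicalTensor {W : WeylStructure d M P} {c : WeylClass d p q M}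
    (ι : MetricBundleIso W c) : BilinField (𝓡 (d + 1)) P :=
  fun z ↦ ContinuousLinearMap.bilinearComp
    (E := EuclideanSpace ℝ (Fin d)) (F := EuclideanSpace ℝ (Fin d))
    (E' := EuclideanSpace ℝ (Fin (d + 1))) (F' := EuclideanSpace ℝ (Fin (d + 1))) (G := ℝ)
    (ι.form z) (mfderiv (𝓡 (d + 1)) (𝓡 d) W.proj z) (mfderiv (𝓡 (d + 1)) (𝓡 d) W.proj z)

/-- The connection form `n = t⁻¹ dt + π^* a` on `P`, whose kernel is the horizontal bundle. -/
def connectionForm (W : WeylStructure d M P) (t : P → ℝ) (a : CovectorField (𝓡 d) M) :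
    CovectorField (𝓡 (d + 1)) P :=
  fun z ↦ (t z)⁻¹ • mvfderiv (𝓡 (d + 1)) t z
    + (a (W.proj z)).comp (mfderiv (𝓡 (d + 1)) (𝓡 d) W.proj z)

/-! ## Weyl pre-ambient spaces -/

/-- The model of the ambient space `P × ℝ`. -/
abbrev ambientModel (d : ℕ) := (𝓡 (d + 1)).prod 𝓘(ℝ, ℝ)

/-- Dilatations of `P × ℝ` act on the first factor only. -/
def ambientδ (W : WeylStructure d M P) (s : ℝ) : P × ℝ → P × ℝ :=
  fun y ↦ (W.δ s y.1, y.2)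

/-- The generator `𝒯 = t ∂_t` of the dilatations of `P × ℝ`: the velocity at `s = 1` of
`s ↦ δ_s y`, a curve that passes through `y` at `s = 1`. -/
def ambientT (W : WeylStructure d M P) (y : P × ℝ) : TangentSpace (ambientModel d) y :=
  mfderiv 𝓘(ℝ, ℝ) (ambientModel d) (fun s : ℝ ↦ ambientδ W s y) 1 (1 : ℝ)

/-- The tangent vector `𝒰 = ∂_ρ` of the curves `ρ ↦ (z, ρ)`. -/
def ambientU (y : P × ℝ) : TangentSpace (ambientModel d) y :=
  mfderiv 𝓘(ℝ, ℝ) (ambientModel d) (fun ρ : ℝ ↦ (y.1, ρ)) y.2 (1 : ℝ)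

/-- A subset of `P × ℝ` is dilatation-invariant. -/
def DilatationInvariant (W : WeylStructure d M P) (S : Set (P × ℝ)) : Prop :=
  ∀ s : ℝ, 0 < s → ∀ y ∈ S, ambientδ W s y ∈ S

/-- `(S, g)` is a Weyl pre-ambient space for `(M, c)`. -/
structure IsWeylPreAmbient {W : WeylStructure d M P} {c : WeylClass d p q M}
    (ι : MetricBundleIso W c) (S : Set (P × ℝ)) (g : BilinField (ambientModel d) (P × ℝ)) :
    Prop where
  isOpen : IsOpen S
  invariant : DilatationInvariant W S
  zero_mem : ∀ z : P, (z, (0 : ℝ)) ∈ S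
  tautological : pullbackForm (𝓡 (d + 1)) (ambientModel d) (fun z : P ↦ (z, (0 : ℝ))) g
    = tautologicalTensor ι
  metric : IsPseudoRiemannianOn (ambientModel d) (p + 1) (q + 1) g S
  homogeneous : ∀ s : ℝ, 0 < s → ∀ y ∈ S,
    pullbackForm (ambientModel d) (ambientModel d) (ambientδ W s) g y = s ^ 2 • g y

/-- The Weyl pre-ambient space `(S, g)` is in Weyl-normal form with acceleration `A`, relative to
the representative `r = (g₀, a)` of the Weyl class, with induced fibre coordinate `t`. The vector
field `A` matters only on `S`. -/
structure IsWeylNormalForm {W : WeylStructure d M P} {c : WeylClass d p q M}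
    (ι : MetricBundleIso W c) (r : WeylPair d p q M) (t : P → ℝ)
    (S : Set (P × ℝ)) (g : BilinField (ambientModel d) (P × ℝ))
    (A : ∀ y : P × ℝ, TangentSpace (ambientModel d) y) : Prop where
  preAmbient : IsWeylPreAmbient ι S g
  interval : ∀ z : P, IsOpen {ρ : ℝ | (z, ρ) ∈ S} ∧ OrdConnected {ρ : ℝ | (z, ρ) ∈ S} ∧
    (0 : ℝ) ∈ {ρ : ℝ | (z, ρ) ∈ S}
  acceleration : ∃ nabla, IsLeviCivitaOn (ambientModel d) g S nabla ∧
    ∀ y ∈ S, nabla ambientU y (ambientU y) = A y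
  acceleration_orth : ∀ y ∈ S, g y (ambientT W y) (A y) = 0
  /-- `g = 𝐠₀ + 2 t² (t⁻¹ dt + a) dρ` along `ρ = 0`. -/
  initial : ∀ (z : P) (v w : TangentSpace (ambientModel d) (z, (0 : ℝ))),
    let dz := mfderiv (ambientModel d) (𝓡 (d + 1)) (Prod.fst : P × ℝ → P) (z, 0)
    let dρ := mvfderiv (ambientModel d) (Prod.snd : P × ℝ → ℝ) (z, 0)
    let n := connectionForm W t r.a z
    g (z, 0) v w = tautologicalTensor ι z (dz v) (dz w)
      + t z ^ 2 * (n (dz v) * dρ w + n (dz w) * dρ v)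

/-- A law of acceleration `𝒜` on the pre-ambient space `(S, g)`: it prescribes, for a curve through
`y` with velocity `v`, the acceleration `𝒜 y v`. It is smooth, dilatation-invariant, and
`g`-orthogonal to `𝒯`. A vector field is the special case where `𝒜 y v` does not depend on `v`. -/
structure IsAccelerationLaw (W : WeylStructure d M P)
    (S : Set (P × ℝ)) (g : BilinField (ambientModel d) (P × ℝ))
    (𝒜 : ∀ y : P × ℝ, TangentSpace (ambientModel d) y → TangentSpace (ambientModel d) y) :
    Prop where
  smooth : ContMDiffOn (ambientModel d).tangent (ambientModel d).tangent ∞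
    (fun v : TangentBundle (ambientModel d) (P × ℝ) ↦
      (⟨v.proj, 𝒜 v.proj v.2⟩ : TangentBundle (ambientModel d) (P × ℝ)))
    {v | v.proj ∈ S}
  invariant : ∀ s : ℝ, 0 < s → ∀ y ∈ S, ∀ v,
    𝒜 (ambientδ W s y) (mfderiv (ambientModel d) (ambientModel d) (ambientδ W s) y v)
      = mfderiv (ambientModel d) (ambientModel d) (ambientδ W s) y (𝒜 y v)
  orth : ∀ y ∈ S, ∀ v, g y (ambientT W y) (𝒜 y v) = 0

/-- `φ : S' → S` brings the pre-ambient space `(S, g)` into Weyl-normal form with acceleration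
`A'`, where `A'` is the acceleration that the law `𝒜` prescribes: `φ` is a diffeomorphism of `S'`
onto an open subset of `S`, commutes with dilatations, is the identity on `P × {0}`, and
`(S', φ^* g)` is in Weyl-normal form with acceleration `A'`, with
`φ_* A' = 𝒜(φ_* 𝒰)`. -/
structure BringsToWeylNormalForm {W : WeylStructure d M P} {c : WeylClass d p q M}
    (ι : MetricBundleIso W c) (r : WeylPair d p q M) (t : P → ℝ)
    (S : Set (P × ℝ)) (g : BilinField (ambientModel d) (P × ℝ))
    (𝒜 : ∀ y : P × ℝ, TangentSpace (ambientModel d) y → TangentSpace (ambientModel d) y)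
    (S' : Set (P × ℝ)) (φ : P × ℝ → P × ℝ)
    (A' : ∀ y : P × ℝ, TangentSpace (ambientModel d) y) : Prop where
  diffeo : IsDiffeoOn (ambientModel d) (ambientModel d) φ S' (φ '' S')
  mapsTo : MapsTo φ S' S
  commutes : ∀ s : ℝ, 0 < s → ∀ y ∈ S', φ (ambientδ W s y) = ambientδ W s (φ y)
  id_zero : ∀ z : P, φ (z, 0) = (z, 0)
  normalForm : IsWeylNormalForm ι r t S' (pullbackForm (ambientModel d) (ambientModel d) φ g) A'
  acceleration : ∀ y ∈ S', mfderiv (ambientModel d) (ambientModel d) φ y (A' y)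
    = 𝒜 (φ y) (mfderiv (ambientModel d) (ambientModel d) φ y (ambientU y))

end WeylStructure

end

/-! The conditions on `φ` are an initial value problem for each of the curves `ρ ↦ φ(z, ρ)`. In a
chart, prescribing the acceleration is a second order equation `x'' = 𝒜(x, x') - Γ(x)(x', x')`, and
the position at `ρ = 0` is `(z, 0)`. The normal form of the metric along `P × {0}` amounts to two
conditions on the initial velocity `V`: `g(V, w) = t² n(w)` for `w` tangent to `P × {0}`, and `g(V,
V) = 0`. Along `P × {0}` the generator `𝒯` is null and orthogonal to the slice, so by nondegeneracy
the first condition determines `V` up to a multiple of `𝒯`; since `g(V, 𝒯) = t² ≠ 0`, the second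
fixes this multiple (`IsInitialVelocity.unique`, `isInitialVelocity_chartInitialVelocity`).

Existence near a point of `P × {0}` follows from the smooth local flow (`exists_smooth_local_flow`)
and the inverse function theorem, because `V` is transverse to the slice
(`exists_isNormalizing_nhds`). Uniqueness for the ordinary differential equation propagates along
segments that start at `ρ = 0` (`IsNormalizing.eq_of_segment`). It allows the local solutions to be
glued (`exists_isNormalizing`), gives the uniqueness of `φ`, and yields equivariance: a dilatation
multiplies `g` by a constant, hence preserves the Levi-Civita connection, so conjugating a solution
by it gives a solution again (`IsNormalizing.dilate`).

It remains to shrink the domain until `φ` is injective, while keeping it dilatation-invariant. By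
equivariance, injectivity near one point of a fibre of `P → M` spreads to the whole fibre
(`exists_injOn_fibre`). A radius function on the metrizable base `M` then cuts out a suitable
neighbourhood in terms of dilatation-invariant quantities only (`exists_isOpen_injOn`).

The predicate `IsNormalizing` collects the local part of the requirements. It mentions no
connection: `IsLeviCivitaOn.acceleration_iff_solvesAt` translates between `∇_𝒰 𝒰` and the equation
in a chart. -/

noncomputable section

/-! ### Smooth dependence of solutions of ordinary differential equations on initial values. -/

section Flow

set_option synthInstance.maxHeartbeats 200000
set_option linter.unusedSectionVars false

universe u

variable {K : Type*} [TopologicalSpace K] [CompactSpace K]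

/-- Composition with a continuous map `f`, as a map between spaces of continuous functions. -/
def nemytskii {E F : Type*} [TopologicalSpace E] [TopologicalSpace F] (f : C(E, F)) :
    C(K, E) → C(K, F) := fun α ↦ f.comp α

/-- Pointwise application of a family of continuous linear maps. -/
def pointwiseApply {E F : Type*} [NormedAddCommGroup E] [NormedSpace ℝ E]
    [NormedAddCommGroup F] [NormedSpace ℝ F] : C(K, E →L[ℝ] F) →L[ℝ] C(K, E) →L[ℝ] C(K, F) :=
  LinearMap.mkContinuous₂
    (LinearMap.mk₂ ℝ (fun (A : C(K, E →L[ℝ] F)) (h : C(K, E)) ↦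
        (⟨fun k ↦ A k (h k), by fun_prop⟩ : C(K, F)))
      (by intros; ext; simp) (by intros; ext; simp) (by intros; ext; simp) (by intros; ext; simp))
    1 (by
      intro A h
      rw [ContinuousMap.norm_le _ (by positivity)]
      intro k
      simp only [LinearMap.mk₂_apply, ContinuousMap.coe_mk, one_mul]
      exact (A k).le_of_opNorm_le_of_le (A.norm_coe_le_norm k) (h.norm_coe_le_norm k))

@[simp]
theorem pointwiseApply_apply {E F : Type*} [NormedAddCommGroup E] [NormedSpace ℝ E]
    [NormedAddCommGroup F] [NormedSpace ℝ F] (A : C(K, E →L[ℝ] F)) (h : C(K, E)) (k : K) :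
    pointwiseApply A h k = A k (h k) := rfl

theorem continuous_nemytskii {E F : Type*} [TopologicalSpace E] [TopologicalSpace F]
    (f : C(E, F)) : Continuous (nemytskii (K := K) f) :=
  ContinuousMap.continuous_postcomp f

/-- Compactness of `K` makes the compact-open topology that of the sup norm, so continuity of
composition is an estimate uniform in `k`. It replaces uniform continuity of `f` near the image of
`α`, and so needs no local compactness of `E`. -/
theorem eventually_norm_sub_comp_lt {E F : Type*} [NormedAddCommGroup E]
    [NormedAddCommGroup F] (f : C(E, F)) (α : C(K, E)) {c : ℝ} (hc : 0 < c) :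
    ∀ᶠ γ in 𝓝 α, ∀ k, ‖f (γ k) - f (α k)‖ < c := by
  filter_upwards [(continuous_nemytskii (K := K) f).continuousAt.eventually
    (Metric.ball_mem_nhds _ hc)] with γ hγ k
  rw [← dist_eq_norm]
  exact (ContinuousMap.dist_apply_le_dist (f := nemytskii f γ) (g := nemytskii f α) k).trans_lt hγ

/-- The mean value inequality is applied for each `k` on the segment from `α k` to `β k`; the
oscillation of `f'` there is bounded uniformly in `k`. -/
theorem hasFDerivAt_nemytskii {E F : Type*} [NormedAddCommGroup E] [NormedSpace ℝ E]
    [NormedAddCommGroup F] [NormedSpace ℝ F] (f : C(E, F)) (f' : C(E, E →L[ℝ] F))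
    (h : ∀ x, HasFDerivAt f (f' x) x) (α : C(K, E)) :
    HasFDerivAt (nemytskii (K := K) f) (pointwiseApply (nemytskii f' α)) α := by
  rw [hasFDerivAt_iff_isLittleO, Asymptotics.isLittleO_iff]
  intro c hc
  obtain ⟨δ, hδ, hball⟩ := Metric.eventually_nhds_iff.1 (eventually_norm_sub_comp_lt f' α hc)
  filter_upwards [Metric.ball_mem_nhds α hδ] with β hβ
  rw [ContinuousMap.norm_le _ (by positivity)]
  intro k
  have hseg : ∀ x ∈ segment ℝ (α k) (β k), ‖f' x - f' (α k)‖ ≤ c := by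
    intro x hx
    obtain ⟨a, b, ha, hb, hab, rfl⟩ := hx
    -- The point of the segment is the value at `k` of a whole function close to `α`, so the uniform
    -- estimate applies to it.
    let γ : C(K, E) := a • α + b • β
    have hγ : dist γ α < δ := by
      have : γ - α = b • (β - α) := by
        have : a = 1 - b := by linarith
        simp only [γ, this]; module
      rw [dist_eq_norm, this, norm_smul, Real.norm_of_nonneg hb]
      have h2 : ‖β - α‖ < δ := by simpa [dist_eq_norm] using hβ
      nlinarith [norm_nonneg (β - α)]
    exact (hball hγ k).le
  have := (convex_segment (𝕜 := ℝ) (α k) (β k)).norm_image_sub_le_of_norm_hasFDerivWithin_le'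
    (fun x _ ↦ (h x).hasFDerivWithinAt) hseg (left_mem_segment ℝ _ _) (right_mem_segment ℝ _ _)
  refine this.trans ?_
  gcongr
  exact ContinuousMap.norm_coe_le_norm (β - α) k

/-- The derivative is composition with `f'` followed by a continuous linear map, so the induction
passes from `f` to `f'`. It has to range over all target spaces, as `f'` takes values in `E →L[ℝ]
F`. -/
theorem contDiff_nemytskii_nat (n : ℕ) : ∀ {E F : Type u} [NormedAddCommGroup E] [NormedSpace ℝ E]
    [NormedAddCommGroup F] [NormedSpace ℝ F] (f : C(E, F)), ContDiff ℝ n f →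
    ContDiff ℝ n (nemytskii (K := K) f) := by
  induction n with
  | zero =>
    intro E F _ _ _ _ f _
    exact contDiff_zero.2 (continuous_nemytskii f)
  | succ n ih =>
    intro E F _ _ _ _ f hf
    push_cast at hf ⊢
    obtain ⟨f', hf', hder⟩ := contDiff_succ_iff_hasFDerivAt.1 hf
    let g : C(E, E →L[ℝ] F) := ⟨f', hf'.continuous⟩
    rw [contDiff_succ_iff_hasFDerivAt]
    have hp : ContDiff ℝ n (pointwiseApply (K := K) (E := E) (F := F)) :=
      ContinuousLinearMap.contDiff _
    exact ⟨fun α ↦ pointwiseApply (nemytskii g α), hp.comp (ih g hf'), fun α ↦ hasFDerivAt_nemytskii f g hder α⟩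

theorem contDiff_nemytskii {E F : Type u} [NormedAddCommGroup E] [NormedSpace ℝ E]
    [NormedAddCommGroup F] [NormedSpace ℝ F] (f : C(E, F)) (hf : ContDiff ℝ ∞ f) :
    ContDiff ℝ ∞ (nemytskii (K := K) f) :=
  contDiff_infty.2 fun n ↦ contDiff_nemytskii_nat n f (contDiff_infty.1 hf n)

variable {E : Type u} [NormedAddCommGroup E] [NormedSpace ℝ E] [CompleteSpace E]

/-- The primitive that vanishes at `0`, on `C([0, 1], E)`. -/
def primitiveL : C(unitInterval, E) →L[ℝ] C(unitInterval, E) :=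
  LinearMap.mkContinuous
    { toFun := fun β ↦ ⟨fun τ ↦ ∫ s in (0 : ℝ)..τ, IccExtend zero_le_one β s, by
        have : Continuous fun x : ℝ ↦ ∫ s in (0 : ℝ)..x, IccExtend zero_le_one β s :=
          intervalIntegral.continuous_primitive
            (fun _ _ ↦ (β.continuous.Icc_extend' (h := zero_le_one)).intervalIntegrable _ _) 0
        exact this.comp continuous_subtype_val⟩
      map_add' := by
        intro β γ
        ext τ
        simp only [ContinuousMap.coe_mk, ContinuousMap.add_apply]
        rw [← intervalIntegral.integral_add
          ((β.continuous.Icc_extend' (h := zero_le_one)).intervalIntegrable _ _)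
          ((γ.continuous.Icc_extend' (h := zero_le_one)).intervalIntegrable _ _)]
        rfl
      map_smul' := by
        intro c β
        ext τ
        simp only [ContinuousMap.coe_mk, ContinuousMap.smul_apply, RingHom.id_apply]
        rw [← intervalIntegral.integral_smul]
        rfl }
    1 (by
      intro β
      rw [ContinuousMap.norm_le _ (by positivity)]
      intro τ
      have h : ∀ s ∈ Set.uIoc (0 : ℝ) τ, ‖IccExtend zero_le_one β s‖ ≤ ‖β‖ :=
        fun s _ ↦ ContinuousMap.norm_coe_le_norm β _
      have := intervalIntegral.norm_integral_le_of_norm_le_const h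
      refine this.trans ?_
      rw [mul_comm, sub_zero, abs_of_nonneg τ.2.1]
      gcongr
      exact τ.2.2)

theorem primitiveL_apply (β : C(unitInterval, E)) (τ : unitInterval) :
    primitiveL β τ = ∫ s in (0 : ℝ)..τ, IccExtend zero_le_one β s := rfl

/-- A fixed point of the scaled Picard operator solves the initial value problem
`y' = ρ f(y)`, `y(0) = x` on `[0, 1]`. -/
theorem hasDerivWithinAt_of_eq_picard (f : C(E, E)) {x : E} {ρ : ℝ} {α : C(unitInterval, E)}
    (h : α = ContinuousMap.const _ x + ρ • primitiveL (nemytskii f α)) :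
    IccExtend zero_le_one α 0 = x ∧
    ∀ τ ∈ Icc (0 : ℝ) 1, HasDerivWithinAt (IccExtend zero_le_one α)
      (ρ • f (IccExtend zero_le_one α τ)) (Icc 0 1) τ := by
  have hval : ∀ τ ∈ Icc (0 : ℝ) 1, IccExtend zero_le_one α τ
      = x + ρ • ∫ s in (0 : ℝ)..τ, IccExtend zero_le_one (nemytskii f α) s := by
    intro τ hτ
    rw [IccExtend_of_mem _ _ hτ]
    conv_lhs => rw [h]
    simp [primitiveL_apply]
  refine ⟨by rw [hval 0 (by simp)]; simp, fun τ hτ ↦ ?_⟩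
  have hcont : Continuous (IccExtend zero_le_one (nemytskii f α) : ℝ → E) :=
    (nemytskii f α).continuous.Icc_extend' (h := zero_le_one)
  have h1 : HasDerivAt (fun τ : ℝ ↦ x + ρ • ∫ s in (0 : ℝ)..τ,
      IccExtend zero_le_one (nemytskii f α) s) (ρ • IccExtend zero_le_one (nemytskii f α) τ) τ :=
    ((intervalIntegral.integral_hasDerivAt_right (hcont.intervalIntegrable _ _)
      (hcont.stronglyMeasurableAtFilter _ _) hcont.continuousAt).const_smul ρ).const_add x
  exact h1.hasDerivWithinAt.congr hval (hval τ hτ)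

/-- The map `(x, ρ, α) ↦ (x, ρ, α - x - ρ ∫ f ∘ α)`. -/
def picardDefect (f : C(E, E)) : E × ℝ × C(unitInterval, E) → E × ℝ × C(unitInterval, E) :=
  fun w ↦ (w.1, w.2.1, w.2.2 - (ContinuousMap.const _ w.1 + w.2.1 • primitiveL (nemytskii f w.2.2)))

theorem contDiff_picardDefect (f : C(E, E)) (hf : ContDiff ℝ ∞ f) :
    ContDiff ℝ ∞ (picardDefect f) := by
  have h1 : ContDiff ℝ ∞ (fun x : E ↦ (ContinuousMap.const unitInterval x)) :=
    (ContinuousLinearMap.const ℝ unitInterval (M := E)).contDiff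
  have h2 := contDiff_nemytskii (K := unitInterval) f hf
  unfold picardDefect
  fun_prop

/-- At `ρ = 0` the integral term contributes to the derivative only through the variation of `ρ`.
The derivative is therefore unipotent triangular, with an explicit inverse, and no contraction
estimate is needed. -/
theorem hasFDerivAt_picardDefect (f : C(E, E)) (hf : ContDiff ℝ ∞ f) (x : E) :
    ∃ A : (E × ℝ × C(unitInterval, E)) ≃L[ℝ] (E × ℝ × C(unitInterval, E)),
      HasFDerivAt (picardDefect f) (A : _ →L[ℝ] _) (x, 0, ContinuousMap.const _ x) := by
  set c : C(unitInterval, E) := primitiveL (nemytskii f (ContinuousMap.const _ x)) with hc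
  let cst : E →L[ℝ] C(unitInterval, E) := ContinuousLinearMap.const ℝ unitInterval (M := E)
  let W := E × ℝ × C(unitInterval, E)
  let p1 : W →L[ℝ] E := ContinuousLinearMap.fst ℝ _ _
  let p2 : W →L[ℝ] ℝ := (ContinuousLinearMap.fst ℝ _ _).comp (ContinuousLinearMap.snd ℝ _ _)
  let p3 : W →L[ℝ] C(unitInterval, E) :=
    (ContinuousLinearMap.snd ℝ _ _).comp (ContinuousLinearMap.snd ℝ _ _)
  let L : W →L[ℝ] C(unitInterval, E) := cst.comp p1 + p2.smulRight c
  let A : W ≃L[ℝ] W := ContinuousLinearEquiv.equivOfInverse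
    (p1.prod (p2.prod (p3 - L))) (p1.prod (p2.prod (p3 + L)))
    (fun w ↦ Prod.ext rfl (Prod.ext rfl (sub_add_cancel w.2.2 (cst w.1 + w.2.1 • c))))
    (fun w ↦ Prod.ext rfl (Prod.ext rfl (add_sub_cancel_right w.2.2 (cst w.1 + w.2.1 • c))))
  refine ⟨A, ?_⟩
  have hN := ((contDiff_nemytskii (K := unitInterval) f hf).differentiable (by simp)
    (ContinuousMap.const _ x)).hasFDerivAt
  have e3 : HasFDerivAt (fun w : W ↦ w.2.2) p3 (x, 0, ContinuousMap.const _ x) := p3.hasFDerivAt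
  have e2 : HasFDerivAt (fun w : W ↦ w.2.1) p2 (x, 0, ContinuousMap.const _ x) := p2.hasFDerivAt
  have e1 : HasFDerivAt (fun w : W ↦ w.1) p1 (x, 0, ContinuousMap.const _ x) := p1.hasFDerivAt
  have hN' : HasFDerivAt (fun w : W ↦ primitiveL (nemytskii f w.2.2)) _
      (x, 0, ContinuousMap.const _ x) :=
    (primitiveL (E := E)).hasFDerivAt.comp _ (HasFDerivAt.comp _ hN e3)
  have hL : HasFDerivAt (fun w : W ↦ ContinuousMap.const unitInterval w.1
      + w.2.1 • primitiveL (nemytskii f w.2.2)) L (x, 0, ContinuousMap.const _ x) := by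
    have := (cst.hasFDerivAt.comp (x, (0 : ℝ), ContinuousMap.const _ x) e1).add (e2.smul hN')
    refine this.congr_fderiv ?_
    ext w <;> simp [L, c]
  exact e1.prodMk (e2.prodMk (e3.sub hL))

/-- Solutions of the scaled problem with different scales are reparametrizations of each other. -/
theorem eq_of_eq_picard (f : C(E, E)) {K : NNReal} (hK : LipschitzWith K f) {x : E} {ρ θ : ℝ}
    (hθ : θ ∈ Icc (0 : ℝ) 1) {α β : C(unitInterval, E)}
    (hα : α = ContinuousMap.const _ x + ρ • primitiveL (nemytskii f α))
    (hβ : β = ContinuousMap.const _ x + (ρ * θ) • primitiveL (nemytskii f β)) :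
    IccExtend zero_le_one α θ = IccExtend zero_le_one β 1 := by
  obtain ⟨hα0, hα'⟩ := hasDerivWithinAt_of_eq_picard f hα
  obtain ⟨hβ0, hβ'⟩ := hasDerivWithinAt_of_eq_picard f hβ
  have hmaps : MapsTo (fun τ ↦ θ * τ) (Icc (0 : ℝ) 1) (Icc 0 1) := fun τ hτ ↦
    ⟨mul_nonneg hθ.1 hτ.1, mul_le_one₀ hθ.2 hτ.1 hτ.2⟩
  -- The slowed-down curve `τ ↦ α (θ τ)` solves the problem with scale `ρ θ`, as `β` does.
  have hγ : ∀ τ ∈ Icc (0 : ℝ) 1, HasDerivWithinAt (fun τ ↦ IccExtend zero_le_one α (θ * τ))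
      ((ρ * θ) • f (IccExtend zero_le_one α (θ * τ))) (Icc 0 1) τ := by
    intro τ hτ
    have h1 : HasDerivWithinAt (fun τ ↦ θ * τ) θ (Icc 0 1) τ := by
      simpa using ((hasDerivAt_id τ).const_mul θ).hasDerivWithinAt
    have := (hα' _ (hmaps hτ)).scomp τ h1 hmaps
    rw [smul_smul, mul_comm θ] at this
    exact this
  have hnhds : ∀ τ ∈ Ico (0 : ℝ) 1, Icc (0 : ℝ) 1 ∈ 𝓝[Ici τ] τ := fun τ hτ ↦
    Icc_mem_nhdsGE_of_mem hτ
  have key := ODE_solution_unique_of_mem_Icc_right (v := fun _ y ↦ (ρ * θ) • f y)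
    (s := fun _ ↦ univ) (K := ‖ρ * θ‖₊ * K)
    (f := fun τ ↦ IccExtend zero_le_one α (θ * τ)) (g := IccExtend zero_le_one β) (a := 0) (b := 1)
    (fun τ _ ↦ (by
      have := (lipschitzWith_smul (β := E) (ρ * θ)).comp hK
      exact this.lipschitzOnWith))
    (fun τ hτ ↦ (hγ τ hτ).continuousWithinAt)
    (fun τ hτ ↦ (hγ τ (Ico_subset_Icc_self hτ)).mono_of_mem_nhdsWithin (hnhds τ hτ))
    (fun _ _ ↦ mem_univ _)
    (fun τ hτ ↦ (hβ' τ hτ).continuousWithinAt)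
    (fun τ hτ ↦ (hβ' τ (Ico_subset_Icc_self hτ)).mono_of_mem_nhdsWithin (hnhds τ hτ))
    (fun _ _ ↦ mem_univ _) (by rw [hβ0]; simpa using hα0)
  have := key (right_mem_Icc.2 zero_le_one)
  simpa using this

/-- The inverse function theorem is applied to the Picard defect, which carries the parameters `(x,
ρ)` along unchanged: the last component of its local inverse at `(x, ρ, 0)` is the solution, as a
smooth function of the parameters. -/
theorem exists_picard_solution (f : C(E, E)) (hf : ContDiff ℝ ∞ f) (x₀ : E) :
    ∃ ε > 0, ∃ α : E × ℝ → C(unitInterval, E),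
      ContDiffOn ℝ ∞ α (Metric.ball x₀ ε ×ˢ Metric.ball 0 ε) ∧
      ∀ w ∈ Metric.ball x₀ ε ×ˢ Metric.ball (0 : ℝ) ε,
        α w = ContinuousMap.const _ w.1 + w.2 • primitiveL (nemytskii f (α w)) := by
  obtain ⟨A, hA⟩ := hasFDerivAt_picardDefect f hf x₀
  set p₀ : E × ℝ × C(unitInterval, E) := (x₀, 0, ContinuousMap.const _ x₀) with hp₀
  have hsm := contDiff_picardDefect f hf
  set e := hsm.contDiffAt.toOpenPartialHomeomorph (picardDefect f) hA (by simp) with he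
  have hecoe : (e : _ → _) = picardDefect f := rfl
  have hp₀s : p₀ ∈ e.source := hsm.contDiffAt.mem_toOpenPartialHomeomorph_source hA (by simp)
  have hFp₀ : picardDefect f p₀ = (x₀, 0, 0) := by simp [picardDefect, hp₀]
  have hmem : (x₀, (0 : ℝ), (0 : C(unitInterval, E))) ∈ e.target := by
    rw [← hFp₀, ← hecoe]; exact e.map_source hp₀s
  have hsymm : e.symm (x₀, (0 : ℝ), (0 : C(unitInterval, E))) = p₀ := by
    rw [← hFp₀, ← hecoe]; exact e.left_inv hp₀s
  -- Smoothness of the inverse is wanted on a neighbourhood, not only at one point. Invertible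
  -- operators form an open set, so the derivative stays invertible nearby.
  have hinv : ∀ᶠ w in 𝓝 (x₀, (0 : ℝ), (0 : C(unitInterval, E))), w ∈ e.target ∧
      fderiv ℝ (picardDefect f) (e.symm w) ∈ range (ContinuousLinearEquiv.toContinuousLinearMap :
        ((E × ℝ × C(unitInterval, E)) ≃L[ℝ] (E × ℝ × C(unitInterval, E))) → _) := by
    have htgt : ∀ᶠ w in 𝓝 (x₀, (0 : ℝ), (0 : C(unitInterval, E))), w ∈ e.target :=
      e.open_target.mem_nhds hmem
    refine htgt.and ?_
    have hc : ContinuousAt (fun w ↦ fderiv ℝ (picardDefect f) (e.symm w))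
        (x₀, (0 : ℝ), (0 : C(unitInterval, E))) :=
      ((hsm.continuous_fderiv (by simp)).continuousAt).comp (e.continuousAt_symm hmem)
    refine hc.eventually ?_
    change _ ∈ 𝓝 (fderiv ℝ (picardDefect f) (e.symm (x₀, 0, 0)))
    rw [hsymm, hA.fderiv]
    exact A.nhds
  have hι : ContinuousAt (fun w : E × ℝ ↦ (w.1, w.2, (0 : C(unitInterval, E)))) (x₀, 0) := by
    fun_prop
  have hev := hι.eventually hinv
  obtain ⟨ε, hε, hball⟩ := Metric.eventually_nhds_iff_ball.1 hev
  refine ⟨ε, hε, fun w ↦ (e.symm (w.1, w.2, 0)).2.2, ?_, ?_⟩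
  · intro w hw
    rw [ball_prod_same] at hw
    obtain ⟨h1, B, hB⟩ := hball w hw
    have hd : HasFDerivAt e (B : _ →L[ℝ] _) (e.symm (w.1, w.2, 0)) := by
      have hB' : (B : _ →L[ℝ] _) = fderiv ℝ (picardDefect f) (e.symm (w.1, w.2, 0)) := hB
      rw [hB']
      exact (hsm.differentiable (by simp) _).hasFDerivAt
    have h2 := e.contDiffAt_symm h1 hd hsm.contDiffAt
    have h3 : ContDiffAt ℝ ∞ (fun w : E × ℝ ↦ (w.1, w.2, (0 : C(unitInterval, E)))) w := by
      fun_prop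
    exact ((h2.comp w h3).snd.snd).contDiffWithinAt
  · intro w hw
    rw [ball_prod_same] at hw
    have h1 : picardDefect f (e.symm (w.1, w.2, 0)) = (w.1, w.2, 0) := by
      rw [← hecoe]; exact e.right_inv (hball w hw).1
    simp only [picardDefect, Prod.mk.injEq] at h1
    obtain ⟨ha, hb, hcc⟩ := h1
    rw [ha, hb, sub_eq_zero] at hcc
    exact hcc

/-- The flow at time `ρ` is the value at `1` of the solution with scale `ρ`. Smoothness in `(x, ρ)`
is already known; the flow equation follows from the scaling relation `eq_of_eq_picard`. -/
theorem exists_smooth_flow_of_lipschitz (f : C(E, E)) (hf : ContDiff ℝ ∞ f) {K : NNReal}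
    (hK : LipschitzWith K f) (x₀ : E) :
    ∃ ε > 0, ∃ Φ : E × ℝ → E, ContDiffOn ℝ ∞ Φ (Metric.ball x₀ ε ×ˢ Metric.ball 0 ε) ∧
      (∀ x ∈ Metric.ball x₀ ε, Φ (x, 0) = x) ∧
      ∀ x ∈ Metric.ball x₀ ε, ∀ ρ ∈ Metric.ball (0 : ℝ) ε,
        HasDerivAt (fun σ ↦ Φ (x, σ)) (f (Φ (x, ρ))) ρ := by
  obtain ⟨ε, hε, α, hαs, hα⟩ := exists_picard_solution f hf x₀
  let ev : C(unitInterval, E) →L[ℝ] E := ContinuousMap.evalCLM ℝ 1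
  set Φ : E × ℝ → E := fun w ↦ ev (α w) with hΦ
  have hΦs : ContDiffOn ℝ ∞ Φ (Metric.ball x₀ ε ×ˢ Metric.ball 0 ε) := ev.contDiff.comp_contDiffOn hαs
  have hΦe : ∀ w, Φ w = IccExtend zero_le_one (α w) 1 := by
    intro w
    rw [IccExtend_of_mem _ _ (right_mem_Icc.2 zero_le_one)]; rfl
  have hO : IsOpen (Metric.ball x₀ ε ×ˢ Metric.ball (0 : ℝ) ε) :=
    Metric.isOpen_ball.prod Metric.isOpen_ball
  have hcd : ∀ x ∈ Metric.ball x₀ ε, ContDiffOn ℝ ∞ (fun σ ↦ Φ (x, σ)) (Metric.ball 0 ε) :=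
    fun x hx ↦ hΦs.comp (by fun_prop) (fun σ hσ ↦ ⟨hx, hσ⟩)
  have hne : ∀ x ∈ Metric.ball x₀ ε, ∀ σ ∈ Metric.ball (0 : ℝ) ε, σ ≠ 0 →
      HasDerivAt (fun σ ↦ Φ (x, σ)) (f (Φ (x, σ))) σ := by
    intro x hx σ hσ h0
    have hσ' : |σ| < ε := by simpa using hσ
    obtain ⟨r, hr1, hr2⟩ := exists_between hσ'
    have hσp : 0 < |σ| := abs_pos.2 h0
    have hrp : 0 < r := hσp.trans hr1
    -- A scale of the same sign as `σ` and of slightly larger modulus: then `σ / ρ` is interior to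
    -- `[0, 1]`, where the one-sided derivative of the solution is a genuine one.
    set ρ := σ * (r / |σ|) with hρ
    have hρabs : |ρ| = r := by
      rw [hρ, abs_mul, abs_div, abs_abs, abs_of_pos hrp]; field_simp
    have hρ0 : ρ ≠ 0 := by rw [← abs_pos, hρabs]; exact hrp
    have hρb : ρ ∈ Metric.ball (0 : ℝ) ε := by simpa [hρabs] using hr2
    have hscale : ∀ θ ∈ Icc (0 : ℝ) 1, IccExtend zero_le_one (α (x, ρ)) θ = Φ (x, ρ * θ) := by
      intro θ hθ
      have hm : ρ * θ ∈ Metric.ball (0 : ℝ) ε := by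
        have : |ρ * θ| ≤ r := by
          rw [abs_mul, hρabs, abs_of_nonneg hθ.1]
          exact mul_le_of_le_one_right hrp.le hθ.2
        simpa using this.trans_lt hr2
      rw [hΦe]
      exact eq_of_eq_picard f hK hθ (hα (x, ρ) ⟨hx, hρb⟩) (hα (x, ρ * θ) ⟨hx, hm⟩)
    have hratio : σ / ρ = |σ| / r := by
      rw [hρ]; field_simp
    have hθ0 : σ / ρ ∈ Ioo (0 : ℝ) 1 := by
      rw [hratio]
      exact ⟨by positivity, (div_lt_one hrp).2 hr1⟩
    have h1 := (hasDerivWithinAt_of_eq_picard f (hα (x, ρ) ⟨hx, hρb⟩)).2 _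
      (Ioo_subset_Icc_self hθ0)
    have h2 : HasDerivAt (IccExtend zero_le_one (α (x, ρ)))
        (ρ • f (IccExtend zero_le_one (α (x, ρ)) (σ / ρ))) (σ / ρ) :=
      h1.hasDerivAt (Icc_mem_nhds hθ0.1 hθ0.2)
    have h3 : HasDerivAt (fun s : ℝ ↦ s / ρ) (1 / ρ) σ := (hasDerivAt_id σ).div_const ρ
    have h4 := h2.scomp σ h3
    rw [smul_smul, one_div, inv_mul_cancel₀ hρ0, one_smul,
      hscale _ (Ioo_subset_Icc_self hθ0), mul_div_cancel₀ _ hρ0] at h4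
    refine h4.congr_of_eventuallyEq ?_
    have hopen : ∀ᶠ s in 𝓝 σ, s / ρ ∈ Ioo (0 : ℝ) 1 :=
      h3.continuousAt.eventually (isOpen_Ioo.mem_nhds hθ0)
    filter_upwards [hopen] with s hs
    have := hscale _ (Ioo_subset_Icc_self hs)
    rw [mul_div_cancel₀ _ hρ0] at this
    exact this.symm
  refine ⟨ε, hε, Φ, hΦs, ?_, ?_⟩
  · intro x hx
    have h := hα (x, 0) ⟨hx, by simpa using hε⟩
    have h' := congrArg ev h
    change ev (α (x, 0)) = x
    simpa [ev] using h'
  · intro x hx ρ hρ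
    rcases eq_or_ne ρ 0 with rfl | h0
    swap
    · exact hne x hx ρ hρ h0
    have hc1 : ContDiffOn ℝ ∞ (fun σ ↦ Φ (x, σ)) (Metric.ball 0 ε) := hcd x hx
    have hda : DifferentiableAt ℝ (fun σ ↦ Φ (x, σ)) 0 :=
      (hc1.contDiffAt (Metric.isOpen_ball.mem_nhds hρ)).differentiableAt (by simp)
    have hdc : ContinuousAt (deriv (fun σ ↦ Φ (x, σ))) 0 :=
      ((hc1.continuousOn_deriv_of_isOpen Metric.isOpen_ball (by simp)).continuousAt
        (Metric.isOpen_ball.mem_nhds hρ))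
    have hfc : ContinuousAt (fun σ ↦ f (Φ (x, σ))) 0 :=
      f.continuous.continuousAt.comp hda.continuousAt
    -- At time `0` the rescaling degenerates; there both sides are continuous and agree on a
    -- punctured neighbourhood.
    have heq : deriv (fun σ ↦ Φ (x, σ)) =ᶠ[𝓝[≠] 0] fun σ ↦ f (Φ (x, σ)) := by
      filter_upwards [nhdsWithin_le_nhds (Metric.isOpen_ball.mem_nhds hρ), self_mem_nhdsWithin]
        with s hs hs0
      exact (hne x hx s hs hs0).deriv
    have := (hdc.eventuallyEq_nhds_iff_eventuallyEq_nhdsNE hfc).1 heq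
    have h0 : deriv (fun σ ↦ Φ (x, σ)) 0 = f (Φ (x, 0)) := this.self_of_nhds
    exact h0 ▸ hda.hasDerivAt

/-- **Smooth dependence on initial conditions**: the local flow of a smooth vector field. -/
theorem exists_smooth_local_flow [FiniteDimensional ℝ E] {f : E → E} {U : Set E} (hU : IsOpen U)
    (hf : ContDiffOn ℝ ∞ f U) {x₀ : E} (hx₀ : x₀ ∈ U) :
    ∃ ε > 0, ∃ Φ : E × ℝ → E, ContDiffOn ℝ ∞ Φ (Metric.ball x₀ ε ×ˢ Metric.ball 0 ε) ∧
      (∀ x ∈ Metric.ball x₀ ε, Φ (x, 0) = x) ∧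
      ∀ x ∈ Metric.ball x₀ ε, ∀ ρ ∈ Metric.ball (0 : ℝ) ε,
        Φ (x, ρ) ∈ U ∧ HasDerivAt (fun σ ↦ Φ (x, σ)) (f (Φ (x, ρ))) ρ := by
  obtain ⟨r, hr, hrU⟩ := Metric.isOpen_iff.1 hU x₀ hx₀
  -- Cutting off makes the field globally smooth with compact support, hence Lipschitz. It is
  -- unchanged on the ball of radius `r / 4`, to which the flow is then confined.
  let b : ContDiffBump x₀ := ⟨r / 4, r / 2, by positivity, by linarith⟩
  have hbts : tsupport b ⊆ U := by
    rw [b.tsupport_eq]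
    exact (Metric.closedBall_subset_ball (by change r / 2 < r; linarith)).trans hrU
  have hgs : ContDiff ℝ ∞ (fun x ↦ b x • f x) := by
    rw [contDiff_iff_contDiffAt]
    intro x
    by_cases hx : x ∈ tsupport b
    · exact b.contDiffAt.smul (hf.contDiffAt (hU.mem_nhds (hbts hx)))
    · have : (fun x ↦ b x • f x) =ᶠ[𝓝 x] fun _ ↦ 0 := by
        filter_upwards [(isClosed_tsupport _).isOpen_compl.mem_nhds hx] with y hy
        rw [image_eq_zero_of_notMem_tsupport hy, zero_smul]
      exact contDiffAt_const.congr_of_eventuallyEq this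
  have hcs : HasCompactSupport (fun x ↦ b x • f x) := b.hasCompactSupport.smul_right
  obtain ⟨K, hK⟩ := hgs.lipschitzWith_of_hasCompactSupport hcs (by simp)
  obtain ⟨ε, hε, Φ, hΦs, hΦ0, hΦ⟩ := exists_smooth_flow_of_lipschitz
    ⟨fun x ↦ b x • f x, hgs.continuous⟩ hgs hK x₀
  have hO : IsOpen (Metric.ball x₀ ε ×ˢ Metric.ball (0 : ℝ) ε) :=
    Metric.isOpen_ball.prod Metric.isOpen_ball
  have hmem : (x₀, (0 : ℝ)) ∈ Metric.ball x₀ ε ×ˢ Metric.ball (0 : ℝ) ε := by simp [hε]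
  have hc : ContinuousAt Φ (x₀, 0) := (hΦs.continuousOn).continuousAt (hO.mem_nhds hmem)
  have hev : ∀ᶠ w in 𝓝 (x₀, (0 : ℝ)), Φ w ∈ Metric.ball x₀ (r / 4) := by
    refine hc.eventually (Metric.isOpen_ball.mem_nhds ?_)
    rw [hΦ0 _ (Metric.mem_ball_self hε)]
    exact Metric.mem_ball_self (by positivity)
  obtain ⟨ε', hε', hball⟩ := Metric.eventually_nhds_iff_ball.1 hev
  have hm1 : min ε ε' ≤ ε := min_le_left _ _
  have hm2 : min ε ε' ≤ ε' := min_le_right _ _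
  refine ⟨min ε ε', lt_min hε hε', Φ, hΦs.mono (prod_mono (Metric.ball_subset_ball hm1)
    (Metric.ball_subset_ball hm1)), fun x hx ↦ hΦ0 x (Metric.ball_subset_ball hm1 hx), ?_⟩
  intro x hx ρ hρ
  have h1 : Φ (x, ρ) ∈ Metric.ball x₀ (r / 4) := by
    refine hball _ ?_
    rw [← ball_prod_same]
    exact ⟨Metric.ball_subset_ball hm2 hx, Metric.ball_subset_ball hm2 hρ⟩
  have h2 : b (Φ (x, ρ)) = 1 := b.one_of_mem_closedBall (Metric.ball_subset_closedBall h1)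
  have h3 := hΦ x (Metric.ball_subset_ball hm1 hx) ρ (Metric.ball_subset_ball hm1 hρ)
  refine ⟨hrU (Metric.ball_subset_ball (by linarith) h1), ?_⟩
  simpa [h2] using h3

end Flow

set_option linter.unusedSectionVars false

theorem two_le_infty : (2 : WithTop ℕ∞) ≤ ∞ :=
  WithTop.coe_le_coe.2 (le_top : (2 : ℕ∞) ≤ ⊤)

/-! ### Local diffeomorphisms between manifolds. -/

section LocalDiffeomorphisms

variable {F : Type*} [NormedAddCommGroup F] [NormedSpace ℝ F]
  {H : Type*} [TopologicalSpace H] {I : ModelWithCorners ℝ F H}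
  {X : Type*} [TopologicalSpace X] [ChartedSpace H X]
  {F' : Type*} [NormedAddCommGroup F'] [NormedSpace ℝ F']
  {H' : Type*} [TopologicalSpace H'] {I' : ModelWithCorners ℝ F' H'}
  {X' : Type*} [TopologicalSpace X'] [ChartedSpace H' X'] {χ : X → X'} {y : X}

theorem IsLocalDiffeomorphAt.eventually {n : WithTop ℕ∞} (h : IsLocalDiffeomorphAt I I' n χ y) :
    ∀ᶠ x in 𝓝 y, IsLocalDiffeomorphAt I I' n χ x := by
  obtain ⟨Φ, hy, hΦ⟩ := h
  filter_upwards [Φ.open_source.mem_nhds hy] with x hx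
  exact ⟨Φ, hx, hΦ⟩

theorem IsLocalDiffeomorphAt.congr {n : WithTop ℕ∞} (h : IsLocalDiffeomorphAt I I' n χ y)
    {χ' : X → X'} (he : χ' =ᶠ[𝓝 y] χ) : IsLocalDiffeomorphAt I I' n χ' y := by
  obtain ⟨Φ, hy, hΦ⟩ := h
  obtain ⟨U, hU, hUo, hyU⟩ := eventually_nhds_iff.1 he
  refine ⟨⟨(Φ.toOpenPartialHomeomorph.restrOpen U hUo).toPartialEquiv,
    (Φ.toOpenPartialHomeomorph.restrOpen U hUo).open_source,
    (Φ.toOpenPartialHomeomorph.restrOpen U hUo).open_target,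
    Φ.contMDiffOn_toFun.mono (fun x hx ↦ hx.1), Φ.contMDiffOn_invFun.mono (fun x hx ↦ hx.1)⟩,
    ⟨hy, hyU⟩, fun x hx ↦ ?_⟩
  rw [hU x hx.2]
  exact hΦ hx.1

theorem IsLocalDiffeomorphAt.isInvertible_mfderiv (h : IsLocalDiffeomorphAt I I' ∞ χ y) :
    (mfderiv I I' χ y).IsInvertible :=
  ⟨h.mfderivToContinuousLinearEquiv (by simp), rfl⟩

theorem IsLocalDiffeomorphAt.mfderiv_injective (h : IsLocalDiffeomorphAt I I' ∞ χ y) :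
    Function.Injective (mfderiv I I' χ y) :=
  (h.mfderivToContinuousLinearEquiv (by simp)).injective

theorem IsLocalDiffeomorphAt.mfderiv_surjective (h : IsLocalDiffeomorphAt I I' ∞ χ y) :
    Function.Surjective (mfderiv I I' χ y) :=
  (h.mfderivToContinuousLinearEquiv (by simp)).surjective

theorem IsLocalDiffeomorphAt.continuousAt {n : WithTop ℕ∞} (h : IsLocalDiffeomorphAt I I' n χ y) :
    ContinuousAt χ y := h.contMDiffAt.continuousAt

end LocalDiffeomorphisms

/-! ### Vector fields, brackets and bilinear forms in coordinates given by a local diffeomorphism.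
-/

section Coordinates

variable {F : Type*} [NormedAddCommGroup F] [NormedSpace ℝ F] [CompleteSpace F]
  {H : Type*} [TopologicalSpace H] {I : ModelWithCorners ℝ F H}
  {X : Type*} [TopologicalSpace X] [ChartedSpace H X] [IsManifold I ∞ X] {χ : X → F} {y : X}

/-- The components of a vector field in the coordinates given by `χ`. -/
def components (I : ModelWithCorners ℝ F H) (χ : X → F) (Y : ∀ x : X, TangentSpace I x) : X → F :=
  fun x ↦ mvfderiv I χ x (Y x)

/-- The vector field with constant components `w` in the coordinates given by `χ`. -/
def constantField (I : ModelWithCorners ℝ F H) (χ : X → F) (w : F) : ∀ x : X, TangentSpace I x :=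
  VectorField.mpullback I 𝓘(ℝ, F) χ (fun _ ↦ w)

theorem mdifferentiableAt_vectorSpace_iff {V : F → F} {e : F} :
    MDifferentiableAt 𝓘(ℝ, F) 𝓘(ℝ, F).tangent
      (fun x ↦ (⟨x, V x⟩ : TangentBundle 𝓘(ℝ, F) F)) e ↔ DifferentiableAt ℝ V e := by
  rw [← mdifferentiableAt_iff_differentiableAt]
  refine (mdifferentiableAt_section (E := TangentSpace 𝓘(ℝ, F)) 𝓘(ℝ, F) V).trans ?_
  refine Iff.of_eq (congrArg (fun f ↦ MDifferentiableAt 𝓘(ℝ, F) 𝓘(ℝ, F) f e) ?_)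
  funext b
  simp

theorem IsLocalDiffeomorphAt.mfderiv_localInverse_mfderiv
    (h : IsLocalDiffeomorphAt I 𝓘(ℝ, F) ∞ χ y) : ∀ᶠ x in 𝓝 y, ∀ v : TangentSpace I x,
      mfderiv 𝓘(ℝ, F) I h.localInverse (χ x) (mfderiv I 𝓘(ℝ, F) χ x v) = (v : F) := by
  filter_upwards [h.localInverse.open_target.mem_nhds h.localInverse_mem_target, h.eventually]
    with x hx hx' v
  have hs : χ x ∈ h.localInverse.source := by
    have h1 := h.localInverse.map_target hx
    rw [← h.localInverse_right_inv h1, h.localInverse.right_inv hx] at h1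
    exact h1
  have hi : IsLocalDiffeomorphAt 𝓘(ℝ, F) I ∞ h.localInverse (χ x) :=
    h.localInverse.isLocalDiffeomorphAt _ _ _ hs
  have h1 := (hi.mdifferentiableAt (by simp)).hasMFDerivAt.comp x
    (hx'.mdifferentiableAt (by simp)).hasMFDerivAt
  have h2 : HasMFDerivAt I I (h.localInverse ∘ χ) x (ContinuousLinearMap.id ℝ (TangentSpace I x)) := by
    refine (hasMFDerivAt_id x).congr_of_eventuallyEq ?_
    filter_upwards [h.localInverse.open_target.mem_nhds hx] with x' hx'
    exact h.localInverse_left_inv hx'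
  exact congrArg (fun (f : F →L[ℝ] F) ↦ f v) (hasMFDerivAt_unique h1 h2)

/-- A differentiable vector field is, near `y`, the pullback by `χ` of a differentiable field. -/
theorem IsLocalDiffeomorphAt.exists_eq_mpullback (h : IsLocalDiffeomorphAt I 𝓘(ℝ, F) ∞ χ y)
    {Y : ∀ x : X, TangentSpace I x}
    (hY : MDifferentiableAt I I.tangent (fun y ↦ (⟨y, Y y⟩ : TangentBundle I X)) y) :
    ∃ V : F → F, DifferentiableAt ℝ V (χ y) ∧ components I χ Y =ᶠ[𝓝 y] V ∘ χ ∧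
      Y =ᶠ[𝓝 y] VectorField.mpullback I 𝓘(ℝ, F) χ V := by
  set i := h.localInverse with hi
  have hiy : i (χ y) = y := h.localInverse_left_inv h.localInverse_mem_target
  have hcomp : components I χ Y =ᶠ[𝓝 y] (fun e ↦ components I χ Y (i e)) ∘ χ := by
    filter_upwards [h.localInverse.open_target.mem_nhds h.localInverse_mem_target] with x hx
    change _ = components I χ Y (i (χ x))
    rw [h.localInverse_left_inv hx]
  let V : F → F := fun e ↦ components I χ Y (i e)
  have hY' : Y =ᶠ[𝓝 y] VectorField.mpullback I 𝓘(ℝ, F) χ V := by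
    filter_upwards [hcomp, h.eventually] with x hx hx'
    exact (hx'.isInvertible_mfderiv.inverse_apply_eq.2 hx.symm).symm
  refine ⟨V, ?_, hcomp, hY'⟩
  have hinv : (mfderiv 𝓘(ℝ, F) I i (χ y)).IsInvertible :=
    h.localInverse_isLocalDiffeomorphAt.isInvertible_mfderiv
  have hd := MDifferentiableAt.mpullback_vectorField (V := Y) (f := i) (x₀ := χ y) (n := ∞)
    (by rw [hiy]; exact hY) h.localInverse_contMDiffAt hinv two_le_infty
  refine (mdifferentiableAt_vectorSpace_iff.1 hd).congr_of_eventuallyEq ?_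
  -- Pushing forward by `χ` is pulling back by its local inverse; the differentiability of the
  -- pulled back field is thereby inherited by `V`.
  have hx : ∀ᶠ x in 𝓝 y, components I χ Y x = VectorField.mpullback 𝓘(ℝ, F) I i Y (χ x) := by
    filter_upwards [h.mfderiv_localInverse_mfderiv, h.continuousAt.eventually
      h.localInverse_isLocalDiffeomorphAt.eventually,
      h.localInverse.open_target.mem_nhds h.localInverse_mem_target] with x hx hx' hx''
    have h1 : (Y (i (χ x)) : F) = Y x :=
      congrArg (fun z ↦ (Y z : F)) (h.localInverse_left_inv hx'')
    exact (hx'.isInvertible_mfderiv.inverse_apply_eq.2 (h1.trans (hx (Y x)).symm)).symm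
  have hit : Filter.Tendsto i (𝓝 (χ y)) (𝓝 y) := by
    have := h.localInverse_contMDiffAt.continuousAt.tendsto
    rwa [hiy] at this
  filter_upwards [hit.eventually hx, h.localInverse.open_source.mem_nhds h.localInverse_mem_source]
    with e he he'
  exact he.trans (congrArg (fun e ↦ (VectorField.mpullback 𝓘(ℝ, F) I i Y e : F))
    (h.localInverse_right_inv he'))

theorem IsLocalDiffeomorphAt.mdifferentiableAt_components (h : IsLocalDiffeomorphAt I 𝓘(ℝ, F) ∞ χ y)
    {Y : ∀ x : X, TangentSpace I x}
    (hY : MDifferentiableAt I I.tangent (fun y ↦ (⟨y, Y y⟩ : TangentBundle I X)) y) :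
    MDifferentiableAt I 𝓘(ℝ, F) (components I χ Y) y := by
  obtain ⟨V, hV, h1, -⟩ := h.exists_eq_mpullback hY
  exact (hV.mdifferentiableAt.comp y (h.mdifferentiableAt (by simp))).congr_of_eventuallyEq h1

theorem mvfderiv_of_eventuallyEq_comp {F₁ : Type*} [NormedAddCommGroup F₁] [NormedSpace ℝ F₁]
    (hχ : MDifferentiableAt I 𝓘(ℝ, F) χ y) {V : F → F₁} {V' : F →L[ℝ] F₁} {u : X → F₁}
    (hV : HasFDerivAt V V' (χ y)) (hu : u =ᶠ[𝓝 y] V ∘ χ) (v : TangentSpace I y) :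
    mvfderiv I u y v = V' (mvfderiv I χ y v) := by
  have h1 := ((hV.hasMFDerivAt).comp y hχ.hasMFDerivAt).congr_of_eventuallyEq hu
  exact congrArg (fun f : F →L[ℝ] F₁ ↦ f v) h1.mfderiv

theorem mlieBracket_vectorSpace {V W : F → F} (e : F) :
    (VectorField.mlieBracket 𝓘(ℝ, F) V W e : F) = fderiv ℝ W e (V e) - fderiv ℝ V e (W e) := by
  have h := congrFun (VectorField.mlieBracketWithin_eq_lieBracketWithin (𝕜 := ℝ) (V := V) (W := W)
    (s := univ)) e
  exact h.trans (congrFun (VectorField.lieBracketWithin_univ (𝕜 := ℝ) (V := V) (W := W)) e)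

/-- The Lie bracket in coordinates. -/
theorem IsLocalDiffeomorphAt.mvfderiv_mlieBracket (h : IsLocalDiffeomorphAt I 𝓘(ℝ, F) ∞ χ y)
    {Y Z : ∀ x : X, TangentSpace I x}
    (hY : MDifferentiableAt I I.tangent (fun y ↦ (⟨y, Y y⟩ : TangentBundle I X)) y)
    (hZ : MDifferentiableAt I I.tangent (fun y ↦ (⟨y, Z y⟩ : TangentBundle I X)) y) :
    mvfderiv I χ y (VectorField.mlieBracket I Y Z y)
      = mvfderiv I (components I χ Z) y (Y y) - mvfderiv I (components I χ Y) y (Z y) := by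
  obtain ⟨V, hV, hV1, hV2⟩ := h.exists_eq_mpullback hY
  obtain ⟨W, hW, hW1, hW2⟩ := h.exists_eq_mpullback hZ
  have hχ := h.mdifferentiableAt (n := ∞) (by simp)
  have : IsManifold I (minSmoothness ℝ 2) X := by
    rw [minSmoothness_of_isRCLikeNormedField]; exact IsManifold.of_le two_le_infty
  have hb := VectorField.mpullback_mlieBracket (f := χ) (x₀ := y) (n := ∞)
    (mdifferentiableAt_vectorSpace_iff.2 hV) (mdifferentiableAt_vectorSpace_iff.2 hW)
    h.contMDiffAt (by rw [minSmoothness_of_isRCLikeNormedField]; exact two_le_infty)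
  rw [hV2.mlieBracket_vectorField_eq hW2, ← hb, mvfderiv_of_eventuallyEq_comp hχ hV.hasFDerivAt hV1,
    mvfderiv_of_eventuallyEq_comp hχ hW.hasFDerivAt hW1]
  have h3 := h.isInvertible_mfderiv.self_apply_inverse
    (VectorField.mlieBracket 𝓘(ℝ, F) V W (χ y))
  refine Eq.trans h3 ((mlieBracket_vectorSpace (χ y)).trans ?_)
  have e1 : mvfderiv I χ y (Y y) = V (χ y) := hV1.self_of_nhds
  have e2 : mvfderiv I χ y (Z y) = W (χ y) := hW1.self_of_nhds
  rw [e1, e2]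

theorem IsLocalDiffeomorphAt.mdifferentiableAt_constantField
    (h : IsLocalDiffeomorphAt I 𝓘(ℝ, F) ∞ χ y) (w : F) :
    MDifferentiableAt I I.tangent
      (fun y ↦ (⟨y, constantField I χ w y⟩ : TangentBundle I X)) y :=
  MDifferentiableAt.mpullback_vectorField (n := ∞)
    (mdifferentiableAt_vectorSpace_iff.2 (differentiableAt_const w))
    h.contMDiffAt h.isInvertible_mfderiv two_le_infty

theorem IsLocalDiffeomorphAt.components_constantField
    (h : IsLocalDiffeomorphAt I 𝓘(ℝ, F) ∞ χ y) (w : F) :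
    components I χ (constantField I χ w) =ᶠ[𝓝 y] fun _ ↦ w := by
  filter_upwards [h.eventually] with x hx
  exact hx.isInvertible_mfderiv.self_apply_inverse _

/-- `G` represents the field `g` of bilinear forms at `y` in the coordinates given by `χ`. -/
structure IsCoordRep (g : BilinField I X) (χ : X → F) (G : F → F →L[ℝ] F →L[ℝ] ℝ) (y : X) :
    Prop where
  localDiffeo : IsLocalDiffeomorphAt I 𝓘(ℝ, F) ∞ χ y
  differentiable : DifferentiableAt ℝ G (χ y)
  eq : ∀ᶠ x in 𝓝 y, ∀ v w : TangentSpace I x, g x v w = G (χ x) (mvfderiv I χ x v) (mvfderiv I χ x w)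

/-- The derivative of `g(Y, Z)` in coordinates. -/
theorem IsCoordRep.mvfderiv_apply {g : BilinField I X} {G : F → F →L[ℝ] F →L[ℝ] ℝ}
    (h : IsCoordRep g χ G y) {Y Z : ∀ x : X, TangentSpace I x}
    (hY : MDifferentiableAt I I.tangent (fun y ↦ (⟨y, Y y⟩ : TangentBundle I X)) y)
    (hZ : MDifferentiableAt I I.tangent (fun y ↦ (⟨y, Z y⟩ : TangentBundle I X)) y)
    (v : TangentSpace I y) :
    mvfderiv I (fun y ↦ g y (Y y) (Z y)) y v
      = fderiv ℝ G (χ y) (mvfderiv I χ y v) (components I χ Y y) (components I χ Z y)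
        + G (χ y) (mvfderiv I (components I χ Y) y v) (components I χ Z y)
        + G (χ y) (components I χ Y y) (mvfderiv I (components I χ Z) y v) := by
  obtain ⟨V, hV, hV1, hV2⟩ := h.localDiffeo.exists_eq_mpullback hY
  obtain ⟨W, hW, hW1, hW2⟩ := h.localDiffeo.exists_eq_mpullback hZ
  have hχ := h.localDiffeo.mdifferentiableAt (n := ∞) (by simp)
  have hprod : HasFDerivAt (fun e ↦ G e (V e) (W e)) _ (χ y) :=
    (h.differentiable.hasFDerivAt.clm_apply hV.hasFDerivAt).clm_apply hW.hasFDerivAt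
  have hfun : (fun y ↦ g y (Y y) (Z y)) =ᶠ[𝓝 y] (fun e ↦ G e (V e) (W e)) ∘ χ := by
    filter_upwards [h.eq, hV1, hW1] with x hx hx1 hx2
    rw [hx]
    change G (χ x) (components I χ Y x) (components I χ Z x) = G (χ x) (V (χ x)) (W (χ x))
    rw [hx1, hx2]; rfl
  rw [mvfderiv_of_eventuallyEq_comp hχ hprod hfun,
    mvfderiv_of_eventuallyEq_comp hχ hV.hasFDerivAt hV1,
    mvfderiv_of_eventuallyEq_comp hχ hW.hasFDerivAt hW1, hV1.self_of_nhds, hW1.self_of_nhds]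
  simp
  ring

end Coordinates

/-! ### The Levi-Civita connection: Koszul formula and existence. -/

section LeviCivita

set_option synthInstance.maxHeartbeats 200000
set_option linter.unusedSectionVars false

/-- `½ (A + A' - A'')` for bilinear maps. -/
def halfAddSub {F B : Type*} [NormedAddCommGroup F] [NormedSpace ℝ F] [NormedAddCommGroup B]
    [NormedSpace ℝ B] (A A' A'' : F →L[ℝ] F →L[ℝ] B) : F →L[ℝ] F →L[ℝ] B :=
  (1 / 2 : ℝ) • (A + A' - A'')

/-- The first Christoffel symbols: `½ (D u v w + D v u w - D w u v)`. -/
def koszulForm {F : Type*} [NormedAddCommGroup F] [NormedSpace ℝ F]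
    (D : F →L[ℝ] F →L[ℝ] F →L[ℝ] ℝ) : F →L[ℝ] F →L[ℝ] F →L[ℝ] ℝ :=
  halfAddSub D D.flip
    ((ContinuousLinearMap.flipₗᵢ ℝ F F ℝ : (F →L[ℝ] F →L[ℝ] ℝ) →L[ℝ] F →L[ℝ] F →L[ℝ] ℝ).comp D.flip)

theorem koszulForm_apply {F : Type*} [NormedAddCommGroup F] [NormedSpace ℝ F]
    (D : F →L[ℝ] F →L[ℝ] F →L[ℝ] ℝ) (u v w : F) :
    koszulForm D u v w = (1 / 2 : ℝ) * (D u v w + D v u w - D w u v) := rfl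

variable {F : Type*} [NormedAddCommGroup F] [NormedSpace ℝ F] [CompleteSpace F]
  {H : Type*} [TopologicalSpace H] {I : ModelWithCorners ℝ F H}
  {X : Type*} [TopologicalSpace X] [ChartedSpace H X] [IsManifold I ∞ X] {χ : X → F} {y : X}
  {g : BilinField I X} {G : F → F →L[ℝ] F →L[ℝ] ℝ} {s : Set X}

/-- Every point near `χ y` is the image under `χ` of a point near `y`, namely of its image under the
local inverse. -/
theorem IsLocalDiffeomorphAt.eventually_of_comp (h : IsLocalDiffeomorphAt I 𝓘(ℝ, F) ∞ χ y)
    {p : F → Prop} (hp : ∀ᶠ x in 𝓝 y, p (χ x)) : ∀ᶠ e in 𝓝 (χ y), p e := by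
  have hit : Filter.Tendsto h.localInverse (𝓝 (χ y)) (𝓝 y) := by
    have := h.localInverse_contMDiffAt.continuousAt.tendsto
    rwa [h.localInverse_left_inv h.localInverse_mem_target] at this
  filter_upwards [hit.eventually hp, h.localInverse.open_source.mem_nhds h.localInverse_mem_source]
    with e he he'
  rwa [h.localInverse_right_inv he'] at he

theorem IsCoordRep.eq_self (h : IsCoordRep g χ G y) (v w : TangentSpace I y) :
    g y v w = G (χ y) (mvfderiv I χ y v) (mvfderiv I χ y w) := h.eq.self_of_nhds v w

theorem IsCoordRep.symm (h : IsCoordRep g χ G y)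
    (hsymm : ∀ᶠ x in 𝓝 y, ∀ v w, g x v w = g x w v) :
    ∀ᶠ e in 𝓝 (χ y), ∀ v w, G e v w = G e w v := by
  refine h.localDiffeo.eventually_of_comp ?_
  filter_upwards [h.eq, hsymm, h.localDiffeo.eventually] with x hx hx' hx'' v w
  obtain ⟨v', hv'⟩ := hx''.mfderiv_surjective v
  obtain ⟨w', hw'⟩ := hx''.mfderiv_surjective w
  have h1 : mvfderiv I χ x v' = v := hv'
  have h2 : mvfderiv I χ x w' = w := hw'
  rw [← h1, ← h2, ← hx, ← hx, hx']

theorem IsCoordRep.fderiv_symm (h : IsCoordRep g χ G y)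
    (hsymm : ∀ᶠ x in 𝓝 y, ∀ v w, g x v w = g x w v) (u v w : F) :
    fderiv ℝ G (χ y) u v w = fderiv ℝ G (χ y) u w v := by
  have key : ∀ v w : F, HasFDerivAt (fun e ↦ G e v w)
      (((fderiv ℝ G (χ y)).flip v).flip w) (χ y) := by
    intro v w
    have := (h.differentiable.hasFDerivAt.clm_apply (hasFDerivAt_const v (χ y))).clm_apply
      (hasFDerivAt_const w (χ y))
    simpa using this
  have h2 : (fun e ↦ G e v w) =ᶠ[𝓝 (χ y)] fun e ↦ G e w v := by
    filter_upwards [h.symm hsymm] with e he using he v w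
  exact congrArg (fun f : F →L[ℝ] ℝ ↦ f u) (((key w v).congr_of_eventuallyEq h2).unique (key v w)).symm

theorem IsCoordRep.mvfderiv_components_constantField (h : IsCoordRep g χ G y) (w : F)
    (v : TangentSpace I y) : mvfderiv I (components I χ (constantField I χ w)) y v = 0 := by
  rw [mvfderiv_of_eventuallyEq_comp (h.localDiffeo.mdifferentiableAt (by simp))
    (hasFDerivAt_const w (χ y)) (h.localDiffeo.components_constantField w)]
  rfl

/-- **Koszul formula**: the acceleration `∇_U U` in coordinates, for any Levi-Civita connection. -/
theorem IsLeviCivitaOn.apply_self_eq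
    {nabla : (∀ x : X, TangentSpace I x) → ∀ x : X, TangentSpace I x →L[ℝ] TangentSpace I x}
    (hn : IsLeviCivitaOn I g s nabla) (hy : y ∈ s) (h : IsCoordRep g χ G y)
    (hsymm : ∀ᶠ x in 𝓝 y, ∀ v w, g x v w = g x w v) {U : ∀ x : X, TangentSpace I x}
    (hU : MDifferentiableAt I I.tangent (fun y ↦ (⟨y, U y⟩ : TangentBundle I X)) y) (w : F) :
    G (χ y) (mvfderiv I χ y (nabla U y (U y))) w
      = G (χ y) (mvfderiv I (components I χ U) y (U y)) w
        + koszulForm (fderiv ℝ G (χ y)) (components I χ U y) (components I χ U y) w := by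
  have hZ := h.localDiffeo.mdifferentiableAt_constantField w
  have hw : mvfderiv I χ y (constantField I χ w y) = w :=
    (h.localDiffeo.components_constantField w).self_of_nhds
  have hw' : components I χ (constantField I χ w) y = w := hw
  have hu : mvfderiv I χ y (U y) = components I χ U y := rfl
  -- For the field `Z` with constant components `w`, three identities suffice: the derivative of
  -- `g(U, Z)` along `U`, that of `g(U, U)` along `Z`, and the torsion identity for `U` and `Z`,
  -- which eliminates `∇_Z U`.
  have e1 := hn.metric U (constantField I χ w) y hy (U y) hU hZ
  have e2 := hn.metric U U y hy (constantField I χ w y) hU hU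
  have e3 := congrArg (mvfderiv I χ y) (hn.torsion_free U (constantField I χ w) y hy hU hZ)
  rw [h.localDiffeo.mvfderiv_mlieBracket hU hZ, h.mvfderiv_components_constantField, map_sub,
    zero_sub] at e3
  rw [h.mvfderiv_apply hU hZ, h.mvfderiv_components_constantField, h.eq_self, h.eq_self,
    hw, hw', hu] at e1
  rw [h.mvfderiv_apply hU hU, h.eq_self, h.eq_self, hw, hu,
    (h.symm hsymm).self_of_nhds _ (components I χ U y),
    (h.symm hsymm).self_of_nhds _ (components I χ U y)] at e2
  have e4 := congrArg (G (χ y) (components I χ U y)) e3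
  rw [map_sub, map_neg] at e4
  rw [koszulForm_apply]
  simp only [map_zero] at e1
  linarith

/-- Every clause of `IsLeviCivitaOn` is an identity at a single point. So the connection is defined
at each point by the Christoffel symbols of coordinates chosen for that point alone, and different
coordinates need not be compared. -/
theorem exists_isLeviCivitaOn (hs : IsOpen s) (hsymm : ∀ x ∈ s, ∀ v w, g x v w = g x w v)
    (hrep : ∀ x ∈ s, ∃ (χ : X → F) (G : F → F →L[ℝ] F →L[ℝ] ℝ), IsCoordRep g χ G x ∧
      (G (χ x)).IsInvertible) :
    ∃ nabla, IsLeviCivitaOn I g s nabla := by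
  classical
  have hex : ∀ x, ∃ (χ : X → F) (G : F → F →L[ℝ] F →L[ℝ] ℝ), x ∈ s → IsCoordRep g χ G x ∧
      (G (χ x)).IsInvertible := by
    intro x
    by_cases hx : x ∈ s
    · obtain ⟨χ, G, h⟩ := hrep x hx
      exact ⟨χ, G, fun _ ↦ h⟩
    · exact ⟨fun _ ↦ 0, fun _ ↦ 0, fun h ↦ absurd h hx⟩
  choose χ G hG using hex
  -- The second Christoffel symbols: the first ones with an index raised by `G⁻¹`.
  let Γ : X → F →L[ℝ] F →L[ℝ] F := fun x ↦
    (ContinuousLinearMap.compL ℝ F (F →L[ℝ] ℝ) F (G x (χ x x)).inverse).comp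
      (koszulForm (fderiv ℝ (G x) (χ x x)))
  have hΓ : ∀ x ∈ s, ∀ u v w : F, G x (χ x x) (Γ x u v) w
      = koszulForm (fderiv ℝ (G x) (χ x x)) u v w := by
    intro x hx u v w
    have := (hG x hx).2.self_apply_inverse (koszulForm (fderiv ℝ (G x) (χ x x)) u v)
    exact congrArg (fun f : F →L[ℝ] ℝ ↦ f w) this
  have hsy : ∀ x ∈ s, ∀ᶠ x' in 𝓝 x, ∀ v w, g x' v w = g x' w v := fun x hx ↦
    Filter.eventually_of_mem (hs.mem_nhds hx) hsymm
  have hΓs : ∀ x ∈ s, ∀ u v : F, Γ x u v = Γ x v u := by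
    intro x hx u v
    have : koszulForm (fderiv ℝ (G x) (χ x x)) u v = koszulForm (fderiv ℝ (G x) (χ x x)) v u := by
      ext w
      rw [koszulForm_apply, koszulForm_apply, (hG x hx).1.fderiv_symm (hsy x hx) w u v]
      ring
    exact congrArg (G x (χ x x)).inverse this
  let N : (∀ x : X, TangentSpace I x) → ∀ x : X, TangentSpace I x →L[ℝ] F := fun Y x ↦
    mvfderiv I (components I (χ x) Y) x
      + ((Γ x).flip (components I (χ x) Y x)).comp (mvfderiv I (χ x) x)
  let nabla : (∀ x : X, TangentSpace I x) → ∀ x : X, TangentSpace I x →L[ℝ] TangentSpace I x :=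
    fun Y x ↦ ((mfderiv I 𝓘(ℝ, F) (χ x) x).inverse).comp (N Y x)
  have hN : ∀ x ∈ s, ∀ Y, ∀ v : TangentSpace I x, mvfderiv I (χ x) x (nabla Y x v) = N Y x v := by
    intro x hx Y v
    exact (hG x hx).1.localDiffeo.isInvertible_mfderiv.self_apply_inverse (N Y x v)
  have hinj : ∀ x ∈ s, ∀ v w : TangentSpace I x, mvfderiv I (χ x) x v = mvfderiv I (χ x) x w →
      v = w := fun x hx v w h ↦ (hG x hx).1.localDiffeo.mfderiv_injective h
  have hNv : ∀ x, ∀ Y, ∀ v : TangentSpace I x, N Y x v = mvfderiv I (components I (χ x) Y) x v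
      + Γ x (mvfderiv I (χ x) x v) (components I (χ x) Y x) := fun x Y v ↦ rfl
  refine ⟨nabla, ⟨⟨?_, ?_⟩, ?_, ?_⟩⟩
  · intro Y Z x hY hZ hx
    ext v
    refine hinj x hx _ _ ?_
    have e1 : components I (χ x) (Y + Z) = components I (χ x) Y + components I (χ x) Z := by
      funext x'
      simp [components]
    rw [hN x hx, hNv, e1, mvfderiv_add ((hG x hx).1.localDiffeo.mdifferentiableAt_components hY)
      ((hG x hx).1.localDiffeo.mdifferentiableAt_components hZ)]
    change mvfderiv I (components I (χ x) Y) x v + mvfderiv I (components I (χ x) Z) x v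
      + Γ x (mvfderiv I (χ x) x v) (components I (χ x) Y x + components I (χ x) Z x)
      = mvfderiv I (χ x) x (nabla Y x v + nabla Z x v)
    rw [map_add, map_add, hN x hx, hN x hx, hNv, hNv]
    abel
  · intro Y f x hY hf hx
    ext v
    refine hinj x hx _ _ ?_
    have e1 : components I (χ x) (f • Y) = f • components I (χ x) Y := by
      funext x'
      simp [components]
    rw [hN x hx, hNv, e1, mvfderiv_smul hf ((hG x hx).1.localDiffeo.mdifferentiableAt_components hY)]
    simp only [add_apply, smul_apply, map_add, map_smul,
      ContinuousLinearMap.smulRight_apply, hN x hx, hNv, Pi.smul_apply', smul_add]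
    change _ = _ + _ • components I (χ x) Y x
    abel
  · intro Y Z x hx hY hZ
    refine hinj x hx _ _ ?_
    rw [map_sub, hN x hx, hN x hx, hNv, hNv, (hG x hx).1.localDiffeo.mvfderiv_mlieBracket hY hZ]
    change _ + Γ x (components I (χ x) Y x) _ - (_ + Γ x (components I (χ x) Z x) _) = _
    rw [hΓs x hx (components I (χ x) Y x)]
    abel
  · intro Y Z x hx v hY hZ
    have hr := (hG x hx).1
    have hsym := (hr.symm (hsy x hx)).self_of_nhds
    rw [hr.mvfderiv_apply hY hZ, hr.eq_self, hr.eq_self, hN x hx, hN x hx, hNv, hNv, map_add,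
      map_add, add_apply, hΓ x hx, hsym (mvfderiv I (χ x) x (Y x)) (Γ x _ _),
      hΓ x hx, koszulForm_apply, koszulForm_apply]
    set D := fderiv ℝ (G x) (χ x x)
    set a := mvfderiv I (χ x) x v
    change D a (components I (χ x) Y x) (components I (χ x) Z x) + _ + _ = _ +
      1 / 2 * (D a (components I (χ x) Y x) (components I (χ x) Z x)
        + D (components I (χ x) Y x) a (components I (χ x) Z x)
        - D (components I (χ x) Z x) a (components I (χ x) Y x)) +
      (_ + 1 / 2 * (D a (components I (χ x) Z x) (components I (χ x) Y x)
        + D (components I (χ x) Z x) a (components I (χ x) Y x)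
        - D (components I (χ x) Y x) a (components I (χ x) Z x)))
    rw [show D a (components I (χ x) Z x) (components I (χ x) Y x)
      = D a (components I (χ x) Y x) (components I (χ x) Z x) from hr.fderiv_symm (hsy x hx) _ _ _]
    change _ + G x (χ x x) _ (components I (χ x) Z x) + G x (χ x x) (components I (χ x) Y x) _
      = G x (χ x x) _ (components I (χ x) Z x) + _ + (G x (χ x x) (components I (χ x) Y x) _ + _)
    ring

end LeviCivita

/-! ### Nondegeneracy and invariance of the signature. -/

section BilinearAlgebra

theorem HasSignature.eq_zero {V : Type*} [AddCommGroup V] [Module ℝ V] {B : V →ₗ[ℝ] V →ₗ[ℝ] ℝ}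
    {p q : ℕ} (h : HasSignature (fun v w ↦ B v w) p q) {v : V} (hv : ∀ w, B v w = 0) : v = 0 := by
  obtain ⟨b, hb⟩ := h
  have hb' : ∀ i j, B (b i) (b j)
      = if i = j then Sum.elim (fun _ ↦ (1 : ℝ)) (fun _ ↦ -1) i else 0 := hb
  refine b.ext_elem fun j ↦ ?_
  have h1 := hv (b j)
  rw [← b.sum_repr v, map_sum, LinearMap.sum_apply, Finset.sum_eq_single j] at h1
  · rw [map_smul, LinearMap.smul_apply, hb' j j, if_pos rfl, smul_eq_mul] at h1
    rcases j with j | j <;> simpa using h1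
  · intro i _ hij
    rw [map_smul, LinearMap.smul_apply, hb' i j, if_neg hij, smul_zero]
  · simp

theorem HasSignature.comp_linearEquiv {V V' : Type*} [AddCommGroup V] [Module ℝ V]
    [AddCommGroup V'] [Module ℝ V'] {B : V → V → ℝ} {p q : ℕ} (h : HasSignature B p q)
    (L : V' ≃ₗ[ℝ] V) : HasSignature (fun v w ↦ B (L v) (L w)) p q := by
  obtain ⟨b, hb⟩ := h
  exact ⟨b.map L.symm, fun i j ↦ by simpa using hb i j⟩

theorem ContinuousLinearMap.isInvertible_of_nondegenerate {F : Type*} [NormedAddCommGroup F]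
    [NormedSpace ℝ F] [FiniteDimensional ℝ F] (A : F →L[ℝ] F →L[ℝ] ℝ)
    (h : ∀ v, (∀ w, A v w = 0) → v = 0) : A.IsInvertible := by
  have hinj : Function.Injective (A : F →ₗ[ℝ] F →L[ℝ] ℝ) := by
    rw [← LinearMap.ker_eq_bot, LinearMap.ker_eq_bot']
    intro v hv
    refine h v fun w ↦ ?_
    have : A v = 0 := hv
    rw [this]; rfl
  have hdim : Module.finrank ℝ F = Module.finrank ℝ (F →L[ℝ] ℝ) := by
    rw [← Subspace.dual_finrank_eq (K := ℝ) (V := F)]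
    exact (LinearMap.toContinuousLinearMap (𝕜 := ℝ) (E := F) (F' := ℝ)).finrank_eq
  exact ⟨(LinearEquiv.ofInjectiveOfFinrankEq (A : F →ₗ[ℝ] F →L[ℝ] ℝ) hinj hdim).toContinuousLinearEquiv,
    rfl⟩

end BilinearAlgebra

/-! ### Smoothness of the metric in charts. -/

section Charts

set_option synthInstance.maxHeartbeats 200000
set_option linter.unusedSectionVars false

variable {F : Type*} [NormedAddCommGroup F] [NormedSpace ℝ F] [FiniteDimensional ℝ F]
  {H : Type*} [TopologicalSpace H] {I : ModelWithCorners ℝ F H} [I.Boundaryless]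
  {X : Type*} [TopologicalSpace X] [ChartedSpace H X] [IsManifold I ∞ X]
  {E' : Type*} [NormedAddCommGroup E'] [NormedSpace ℝ E']
  {H' : Type*} [TopologicalSpace H'] {J : ModelWithCorners ℝ E' H'}
  {N : Type*} [TopologicalSpace N] [ChartedSpace H' N] [IsManifold J ∞ N]

/-- The chart at `x₀`, as a partial diffeomorphism to the model vector space. -/
def extChartDiffeo (I : ModelWithCorners ℝ F H) [I.Boundaryless] [IsManifold I ∞ X] (x₀ : X) :
    PartialDiffeomorph I 𝓘(ℝ, F) X F ∞ where
  toPartialEquiv := extChartAt I x₀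
  open_source := isOpen_extChartAt_source x₀
  open_target := isOpen_extChartAt_target x₀
  contMDiffOn_toFun := contMDiffOn_extChartAt.mono (by rw [extChartAt_source])
  contMDiffOn_invFun := contMDiffOn_extChartAt_symm x₀

theorem isLocalDiffeomorphAt_extChartAt {x₀ x : X} (hx : x ∈ (extChartAt I x₀).source) :
    IsLocalDiffeomorphAt I 𝓘(ℝ, F) ∞ (extChartAt I x₀) x :=
  (extChartDiffeo I x₀).isLocalDiffeomorphAt _ _ _ hx

theorem isLocalDiffeomorphAt_extChartAt_symm {x₀ : X} {e : F} (he : e ∈ (extChartAt I x₀).target) :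
    IsLocalDiffeomorphAt 𝓘(ℝ, F) I ∞ (extChartAt I x₀).symm e :=
  (extChartDiffeo I x₀).symm.isLocalDiffeomorphAt _ _ _ he

theorem mfderiv_extChartAt_symm_mvfderiv {x₀ x : X} (hx : x ∈ (extChartAt I x₀).source)
    (v : TangentSpace I x) :
    mfderiv 𝓘(ℝ, F) I (extChartAt I x₀).symm (extChartAt I x₀ x) (mvfderiv I (extChartAt I x₀) x v)
      = (v : F) := by
  have h1 := ((isLocalDiffeomorphAt_extChartAt_symm
    ((extChartAt I x₀).map_source hx)).mdifferentiableAt (by simp)).hasMFDerivAt.comp x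
    ((isLocalDiffeomorphAt_extChartAt hx).mdifferentiableAt (by simp)).hasMFDerivAt
  have h2 : HasMFDerivAt I I ((extChartAt I x₀).symm ∘ extChartAt I x₀) x
      (ContinuousLinearMap.id ℝ (TangentSpace I x)) := by
    refine (hasMFDerivAt_id x).congr_of_eventuallyEq ?_
    filter_upwards [(isOpen_extChartAt_source x₀).mem_nhds hx] with x' hx'
    exact (extChartAt I x₀).left_inv hx'
  exact congrArg (fun (f : F →L[ℝ] F) ↦ f v) (hasMFDerivAt_unique h1 h2)

theorem ContMDiffOn.contMDiffOn_tangentMap {f : N → X} {O : Set N} (hf : ContMDiffOn J I ∞ f O)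
    (hO : IsOpen O) : ContMDiffOn J.tangent I.tangent ∞ (tangentMap J I f) (TotalSpace.proj ⁻¹' O) := by
  refine (hf.contMDiffOn_tangentMapWithin (m := ∞) (by simp) hO.uniqueMDiffOn).congr ?_
  intro p hp
  exact (tangentMapWithin_eq_tangentMap (hO.uniqueMDiffOn p.1 hp)
    (((hf p.1 hp).contMDiffAt (hO.mem_nhds hp)).mdifferentiableAt (by simp))).symm

/-- The image of a smooth vector field under a smooth map is smooth as a field along the map. -/
theorem ContMDiffOn.mfderiv_apply {f : N → X} {O : Set N} (hf : ContMDiffOn J I ∞ f O)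
    (hO : IsOpen O) {V : ∀ x : N, TangentSpace J x} {x : N} (hx : x ∈ O)
    (hV : ContMDiffAt J J.tangent ∞ (fun x ↦ (⟨x, V x⟩ : TangentBundle J N)) x) :
    ContMDiffAt J I.tangent ∞ (fun x ↦ (⟨f x, mfderiv J I f x (V x)⟩ : TangentBundle I X)) x :=
  (ContMDiffOn.contMDiffAt (hf.contMDiffOn_tangentMap hO)
    ((hO.preimage (FiberBundle.continuous_proj _ _)).mem_nhds hx)).comp x hV

theorem contMDiffAt_constField (v : F) (e : F) :
    ContMDiffAt 𝓘(ℝ, F) 𝓘(ℝ, F).tangent ∞ (fun x ↦ (⟨x, v⟩ : TangentBundle 𝓘(ℝ, F) F)) e :=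
  contMDiffAt_vectorSpace_iff_contDiffAt.2 contDiffAt_const

/-- The metric in the chart at `x₀`. -/
def chartMetric (g : BilinField I X) (x₀ : X) : F → F →L[ℝ] F →L[ℝ] ℝ :=
  pullbackForm 𝓘(ℝ, F) I (extChartAt I x₀).symm g

/-- The part of the chart at `x₀` over `S`. -/
def chartDomain (I : ModelWithCorners ℝ F H) (x₀ : X) (S : Set X) : Set F :=
  (extChartAt I x₀).target ∩ (extChartAt I x₀).symm ⁻¹' S

theorem isOpen_chartDomain (x₀ : X) {S : Set X} (hS : IsOpen S) : IsOpen (chartDomain I x₀ S) :=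
  (continuousOn_extChartAt_symm x₀).isOpen_inter_preimage (isOpen_extChartAt_target x₀) hS

theorem mem_chartDomain {x₀ x : X} {S : Set X} (hx : x ∈ (extChartAt I x₀).source) (hxS : x ∈ S) :
    extChartAt I x₀ x ∈ chartDomain I x₀ S :=
  ⟨(extChartAt I x₀).map_source hx, by
    change (extChartAt I x₀).symm (extChartAt I x₀ x) ∈ S
    rwa [(extChartAt I x₀).left_inv hx]⟩

theorem contDiffOn_chartMetric {p q : ℕ} {g : BilinField I X} {S : Set X} (hS : IsOpen S)
    (hg : IsPseudoRiemannianOn I p q g S) (x₀ : X) :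
    ContDiffOn ℝ ∞ (chartMetric g x₀) (chartDomain I x₀ S) := by
  rw [contDiffOn_clm_apply]
  intro v
  rw [contDiffOn_clm_apply]
  intro w e he
  have hsymm := contMDiffOn_extChartAt_symm (I := I) (n := ∞) x₀
  have h1 : ContMDiffAt 𝓘(ℝ, F) (I.prod 𝓘(ℝ, F →L[ℝ] F →L[ℝ] ℝ)) ∞
      (fun e ↦ TotalSpace.mk' (F →L[ℝ] F →L[ℝ] ℝ)
        (E := fun x : X ↦ TangentSpace I x →L[ℝ] TangentSpace I x →L[ℝ] ℝ)
        ((extChartAt I x₀).symm e) (g ((extChartAt I x₀).symm e))) e :=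
    (hg.smooth.contMDiffAt (hS.mem_nhds he.2)).comp e
      (hsymm.contMDiffAt ((isOpen_extChartAt_target x₀).mem_nhds he.1))
  have h2 := ContMDiffAt.clm_bundle_apply₂ (F₁ := F) (F₂ := F) (F₃ := ℝ)
    (E₃ := Bundle.Trivial X ℝ) h1
    (hsymm.mfderiv_apply (isOpen_extChartAt_target x₀) he.1 (contMDiffAt_constField v e))
    (hsymm.mfderiv_apply (isOpen_extChartAt_target x₀) he.1 (contMDiffAt_constField w e))
  rw [contMDiffAt_totalSpace] at h2
  exact (contMDiffAt_iff_contDiffAt.1 h2.2).contDiffWithinAt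

end Charts

/-! ### Pullback of a metric by a local diffeomorphism. -/

section Pullback

set_option synthInstance.maxHeartbeats 200000
set_option linter.unusedSectionVars false

/-- A basis of the finite-dimensional `F` identifies linear maps with finite tuples of their values
on it. -/
theorem contMDiffAt_clm_of_apply {E' : Type*} [NormedAddCommGroup E'] [NormedSpace ℝ E']
    {H' : Type*} [TopologicalSpace H'] {J : ModelWithCorners ℝ E' H'}
    {N : Type*} [TopologicalSpace N] [ChartedSpace H' N]
    {F G : Type*} [NormedAddCommGroup F] [NormedSpace ℝ F] [FiniteDimensional ℝ F]
    [NormedAddCommGroup G] [NormedSpace ℝ G] {f : N → F →L[ℝ] G} {x : N}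
    (h : ∀ v, ContMDiffAt J 𝓘(ℝ, G) ∞ (fun x ↦ f x v) x) :
    ContMDiffAt J 𝓘(ℝ, F →L[ℝ] G) ∞ f x := by
  let n := Module.finrank ℝ F
  have hn : n = Module.finrank ℝ (Fin n → ℝ) := (Module.finrank_fin_fun ℝ).symm
  let e₁ := ContinuousLinearEquiv.ofFinrankEq hn
  let e₂ := (e₁.arrowCongr (1 : G ≃L[ℝ] G)).trans (ContinuousLinearEquiv.piRing (Fin n))
  have h1 : ContMDiffAt J 𝓘(ℝ, Fin n → G) ∞ (fun x ↦ e₂ (f x)) x :=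
    contMDiffAt_pi_space.2 fun i ↦ h _
  have h2 : f = fun x ↦ e₂.symm (e₂ (f x)) := by
    funext x
    exact (e₂.symm_apply_apply (f x)).symm
  rw [h2]
  exact (e₂.symm.contDiff.contMDiff.contMDiffAt).comp x h1

variable {F : Type*} [NormedAddCommGroup F] [NormedSpace ℝ F] [FiniteDimensional ℝ F]
  {H : Type*} [TopologicalSpace H] {I : ModelWithCorners ℝ F H} [I.Boundaryless]
  {X : Type*} [TopologicalSpace X] [ChartedSpace H X] [IsManifold I ∞ X]
  {p q : ℕ} {g : BilinField I X} {S : Set X}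

theorem eq_zero_of_forall_apply_eq_zero (hg : IsPseudoRiemannianOn I p q g S) {x : X} (hx : x ∈ S)
    {v : TangentSpace I x} (hv : ∀ w, g x v w = 0) : v = 0 := by
  let B : TangentSpace I x →ₗ[ℝ] TangentSpace I x →ₗ[ℝ] ℝ :=
    LinearMap.mk₂ ℝ (fun v w ↦ g x v w) (fun v v' w ↦ by rw [map_add]; rfl)
      (fun c v w ↦ by rw [map_smul]; rfl) (fun v w w' ↦ map_add _ _ _) (fun c v w ↦ map_smul _ _ _)
  exact HasSignature.eq_zero (B := B) (hg.signature x hx) hv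

theorem chartMetric_isInvertible (hg : IsPseudoRiemannianOn I p q g S) {x₀ : X} {e : F}
    (he : e ∈ chartDomain I x₀ S) : (chartMetric g x₀ e).IsInvertible := by
  refine ContinuousLinearMap.isInvertible_of_nondegenerate _ fun v hv ↦ ?_
  have h1 : mfderiv 𝓘(ℝ, F) I (extChartAt I x₀).symm e v = 0 := by
    refine eq_zero_of_forall_apply_eq_zero hg he.2 fun w ↦ ?_
    obtain ⟨w', rfl⟩ := (isLocalDiffeomorphAt_extChartAt_symm he.1).mfderiv_surjective w
    exact hv w'
  exact (isLocalDiffeomorphAt_extChartAt_symm he.1).mfderiv_injective (h1.trans (map_zero _).symm)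

theorem mvfderiv_extChartAt_comp {φ : X → X} {x₀ y : X}
    (hφ : MDifferentiableAt I I φ y) (hy : φ y ∈ (extChartAt I x₀).source) (v : TangentSpace I y) :
    mvfderiv I (extChartAt I x₀ ∘ φ) y v = mvfderiv I (extChartAt I x₀) (φ y) (mfderiv I I φ y v) :=
  congrArg (fun f : F →L[ℝ] F ↦ f v)
    (mfderiv_comp y ((isLocalDiffeomorphAt_extChartAt hy).mdifferentiableAt (by simp)) hφ)

/-- In the coordinates `κ ∘ φ`, with `κ` a chart of the target, `φ^* g` has the same components as
`g` has in `κ`. Thus Christoffel symbols of the pullback are those of `g`, and the curves `ρ ↦ φ(z,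
ρ)` obey an equation that does not involve `φ` otherwise. -/
theorem isCoordRep_pullbackForm (hS : IsOpen S) (hg : IsPseudoRiemannianOn I p q g S) {x₀ y : X}
    {φ : X → X} (hφ : IsLocalDiffeomorphAt I I ∞ φ y) (h1 : φ y ∈ (extChartAt I x₀).source)
    (h2 : φ y ∈ S) : IsCoordRep (pullbackForm I I φ g) (extChartAt I x₀ ∘ φ) (chartMetric g x₀) y where
  localDiffeo := IsLocalDiffeomorphAt.comp (hf := hφ) (hg := isLocalDiffeomorphAt_extChartAt h1)
  differentiable := ((contDiffOn_chartMetric hS hg x₀).contDiffAt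
    ((isOpen_chartDomain x₀ hS).mem_nhds (mem_chartDomain h1 h2))).differentiableAt (by simp)
  eq := by
    filter_upwards [hφ.eventually, hφ.continuousAt.preimage_mem_nhds
      ((isOpen_extChartAt_source x₀).mem_nhds h1)] with x hx hx' v w
    have e := mvfderiv_extChartAt_comp (hx.mdifferentiableAt (by simp)) hx'
    have e' : ∀ v, mfderiv 𝓘(ℝ, F) I (extChartAt I x₀).symm (extChartAt I x₀ (φ x))
        (mvfderiv I (extChartAt I x₀ ∘ φ) x v) = (mfderiv I I φ x v : F) := fun v ↦ by
      rw [e v]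
      exact mfderiv_extChartAt_symm_mvfderiv hx' _
    have e0 : (extChartAt I x₀).symm (extChartAt I x₀ (φ x)) = φ x :=
      (extChartAt I x₀).left_inv hx'
    -- Tangent spaces at different points all have the underlying space `F`; an equality of base
    -- points is used by letting the point vary and substituting.
    have key : ∀ (x' : X) (_ : x' = φ x) (a b : F), a = (mfderiv I I φ x v : F) →
        b = (mfderiv I I φ x w : F) → g (φ x) (mfderiv I I φ x v) (mfderiv I I φ x w)
          = (g x' : F →L[ℝ] F →L[ℝ] ℝ) a b := by
      rintro _ rfl _ _ rfl rfl; rfl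
    exact key _ e0 _ _ (e' v) (e' w)

theorem contMDiffAt_bilinField_of_apply {B : BilinField I X} {x₀ : X}
    (h : ∀ V W : ∀ x : X, TangentSpace I x,
      ContMDiffAt I I.tangent ∞ (fun x ↦ (⟨x, V x⟩ : TangentBundle I X)) x₀ →
      ContMDiffAt I I.tangent ∞ (fun x ↦ (⟨x, W x⟩ : TangentBundle I X)) x₀ →
      ContMDiffAt I 𝓘(ℝ, ℝ) ∞ (fun x ↦ B x (V x) (W x)) x₀) :
    ContMDiffAt I (I.prod 𝓘(ℝ, F →L[ℝ] F →L[ℝ] ℝ)) ∞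
      (fun x ↦ TotalSpace.mk' (F →L[ℝ] F →L[ℝ] ℝ)
        (E := fun x : X ↦ TangentSpace I x →L[ℝ] TangentSpace I x →L[ℝ] ℝ) x (B x)) x₀ := by
  rw [contMDiffAt_section]
  refine contMDiffAt_clm_of_apply fun v ↦ contMDiffAt_clm_of_apply fun w ↦ ?_
  let e := trivializationAt F (TangentSpace I : X → Type _) x₀
  have hx₀ : x₀ ∈ e.baseSet := mem_baseSet_trivializationAt F (TangentSpace I) x₀
  -- The fields that are constant in the trivialization around `x₀` are smooth, and pairing them
  -- gives the matrix coefficients of `B`.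
  have hfield : ∀ v : F, ContMDiffAt I I.tangent ∞
      (fun x ↦ (⟨x, e.symm x v⟩ : TangentBundle I X)) x₀ := by
    intro v
    have h1 := (e.contMDiffOn_symm (IB := I) (n := ∞)).contMDiffAt
      (e.open_target.mem_nhds (e.mem_target.2 hx₀ : (x₀, v) ∈ e.target))
    have h2 : ContMDiffAt I (I.prod 𝓘(ℝ, F)) ∞ (fun x : X ↦ (x, v)) x₀ :=
      contMDiffAt_id.prodMk contMDiffAt_const
    refine (h1.comp x₀ h2).congr_of_eventuallyEq ?_
    filter_upwards [e.open_baseSet.mem_nhds hx₀] with x hx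
    exact e.mk_symm hx v
  refine (h _ _ (hfield v) (hfield w)).congr_of_eventuallyEq ?_
  filter_upwards [e.open_baseSet.mem_nhds hx₀] with x hx
  refine (inCoordinates_apply_eq₂ (E₃ := Bundle.Trivial X ℝ) (F₃ := ℝ) (ϕ := B x) (v := v) (w := w)
    hx hx (mem_univ _)).trans ?_
  simp only [Trivial.fiberBundle_trivializationAt', Trivial.linearMapAt_trivialization,
    LinearMap.id_coe, id_eq]
  rfl

theorem IsPseudoRiemannianOn.pullbackForm (hS : IsOpen S) (hg : IsPseudoRiemannianOn I p q g S)
    {φ : X → X} {O : Set X} (hO : IsOpen O) (hφ : IsLocalDiffeomorphOn I I ∞ φ O)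
    (hm : MapsTo φ O S) : IsPseudoRiemannianOn I p q (pullbackForm I I φ g) O where
  smooth := by
    intro x hx
    refine (contMDiffAt_bilinField_of_apply fun V W hV hW ↦ ?_).contMDiffWithinAt
    have h1 : ContMDiffAt I (I.prod 𝓘(ℝ, F →L[ℝ] F →L[ℝ] ℝ)) ∞
        (fun x ↦ TotalSpace.mk' (F →L[ℝ] F →L[ℝ] ℝ)
          (E := fun x : X ↦ TangentSpace I x →L[ℝ] TangentSpace I x →L[ℝ] ℝ)
          (φ x) (g (φ x))) x :=
      (hg.smooth.contMDiffAt (hS.mem_nhds (hm hx))).comp x (hφ ⟨x, hx⟩).contMDiffAt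
    have h2 := ContMDiffAt.clm_bundle_apply₂ (F₁ := F) (F₂ := F) (F₃ := ℝ)
      (E₃ := Bundle.Trivial X ℝ) h1
      (hφ.contMDiffOn.mfderiv_apply hO hx hV) (hφ.contMDiffOn.mfderiv_apply hO hx hW)
    rw [contMDiffAt_totalSpace] at h2
    exact h2.2
  symm := fun x hx v w ↦ hg.symm _ (hm hx) _ _
  signature := fun x hx ↦ (hg.signature _ (hm hx)).comp_linearEquiv
    ((hφ ⟨x, hx⟩).mfderivToContinuousLinearEquiv (by simp)).toLinearEquiv

end Pullback

/-! ### The second order equation of prescribed acceleration in a chart. -/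

section Acceleration

set_option synthInstance.maxHeartbeats 200000
set_option linter.unusedSectionVars false

variable {F : Type*} [NormedAddCommGroup F] [NormedSpace ℝ F] [FiniteDimensional ℝ F]
  {H : Type*} [TopologicalSpace H] {I : ModelWithCorners ℝ F H} [I.Boundaryless]
  {X : Type*} [TopologicalSpace X] [ChartedSpace H X] [IsManifold I ∞ X]
  {p q : ℕ} {g : BilinField I X} {S : Set X} {𝒜 : ∀ y : X, TangentSpace I y → TangentSpace I y}

/-- A velocity-dependent vector field in the chart at `x₀`. -/
def chartLaw (𝒜 : ∀ y : X, TangentSpace I y → TangentSpace I y) (x₀ : X) (y : F × F) : F :=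
  mvfderiv I (extChartAt I x₀) ((extChartAt I x₀).symm y.1)
    (𝒜 ((extChartAt I x₀).symm y.1) (mfderiv 𝓘(ℝ, F) I (extChartAt I x₀).symm y.1 y.2))

theorem contDiffOn_chartLaw (hS : IsOpen S)
    (h𝒜 : ContMDiffOn I.tangent I.tangent ∞
      (fun v : TangentBundle I X ↦ (⟨v.proj, 𝒜 v.proj v.2⟩ : TangentBundle I X)) {v | v.proj ∈ S})
    (x₀ : X) : ContDiffOn ℝ ∞ (chartLaw 𝒜 x₀) (chartDomain I x₀ S ×ˢ univ) := by
  rintro ⟨e, u⟩ ⟨he, -⟩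
  have h0 : ContMDiffAt (𝓘(ℝ, F).prod 𝓘(ℝ, F)) 𝓘(ℝ, F).tangent ∞
      (fun y : F × F ↦ (⟨y.1, y.2⟩ : TangentBundle 𝓘(ℝ, F) F)) (e, u) := by
    rw [contMDiffAt_totalSpace]
    refine ⟨contMDiffAt_fst, ?_⟩
    refine contMDiffAt_snd.congr_of_eventuallyEq (Filter.Eventually.of_forall fun y ↦ ?_)
    simp
  have h1 := ContMDiffOn.contMDiffAt ((contMDiffOn_extChartAt_symm (I := I) (n := ∞) x₀).contMDiffOn_tangentMap
      (isOpen_extChartAt_target x₀)) (((isOpen_extChartAt_target x₀).preimage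
        (FiberBundle.continuous_proj F (TangentSpace 𝓘(ℝ, F)))).mem_nhds
        (show (⟨e, u⟩ : TangentBundle 𝓘(ℝ, F) F) ∈ _ from he.1))
  have h2 := ContMDiffOn.contMDiffAt h𝒜 ((hS.preimage
        (FiberBundle.continuous_proj F (TangentSpace I))).mem_nhds
        (show tangentMap 𝓘(ℝ, F) I (extChartAt I x₀).symm (⟨e, u⟩ : TangentBundle 𝓘(ℝ, F) F) ∈ _
          from he.2))
  have h3 := ContMDiffOn.contMDiffAt (ContMDiffOn.contMDiffOn_tangentMap (extChartDiffeo I x₀).contMDiffOn_toFun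
      (isOpen_extChartAt_source x₀)) (((isOpen_extChartAt_source x₀).preimage
        (FiberBundle.continuous_proj F (TangentSpace I))).mem_nhds
        (show (⟨(extChartAt I x₀).symm e, 𝒜 _ (mfderiv 𝓘(ℝ, F) I (extChartAt I x₀).symm e u)⟩ :
          TangentBundle I X) ∈ _ from (extChartAt I x₀).map_target he.1))
  have h4 := (contMDiff_snd_tangentBundle_modelSpace F 𝓘(ℝ, F) (n := ∞)).contMDiffAt.comp (e, u)
    (h3.comp (e, u) (h2.comp (e, u) (h1.comp (e, u) h0)))
  rw [← modelWithCornersSelf_prod, chartedSpaceSelf_prod] at h4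
  exact (contMDiffAt_iff_contDiffAt.1 h4).contDiffWithinAt

/-- The second derivative, in the chart at `x₀`, of a curve whose acceleration is prescribed by
`𝒜`, as a function of position and velocity. -/
def chartAcceleration (g : BilinField I X) (𝒜 : ∀ y : X, TangentSpace I y → TangentSpace I y)
    (x₀ : X) (y : F × F) : F :=
  chartLaw 𝒜 x₀ y - (chartMetric g x₀ y.1).inverse
    (koszulForm (fderiv ℝ (chartMetric g x₀) y.1) y.2 y.2)

set_option maxSynthPendingDepth 3 in
theorem contDiffOn_chartAcceleration (hS : IsOpen S) (hg : IsPseudoRiemannianOn I p q g S)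
    (h𝒜 : ContMDiffOn I.tangent I.tangent ∞
      (fun v : TangentBundle I X ↦ (⟨v.proj, 𝒜 v.proj v.2⟩ : TangentBundle I X)) {v | v.proj ∈ S})
    (x₀ : X) : ContDiffOn ℝ ∞ (chartAcceleration g 𝒜 x₀) (chartDomain I x₀ S ×ˢ univ) := by
  refine (contDiffOn_chartLaw hS h𝒜 x₀).sub ?_
  have hG := contDiffOn_chartMetric hS hg x₀
  have hfst : MapsTo (Prod.fst : F × F → F) (chartDomain I x₀ S ×ˢ univ) (chartDomain I x₀ S) :=
    fun y hy ↦ hy.1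
  have hD : ContDiffOn ℝ ∞ (fun y : F × F ↦ fderiv ℝ (chartMetric g x₀) y.1)
      (chartDomain I x₀ S ×ˢ univ) :=
    (hG.fderiv_of_isOpen (isOpen_chartDomain x₀ hS) (by simp)).comp contDiffOn_fst hfst
  have hinv : ContDiffOn ℝ ∞ (fun y : F × F ↦ (chartMetric g x₀ y.1).inverse)
      (chartDomain I x₀ S ×ˢ univ) := by
    intro y hy
    obtain ⟨L, hL⟩ := chartMetric_isInvertible hg hy.1
    change ContDiffWithinAt ℝ ∞ (ContinuousLinearMap.inverse ∘ (chartMetric g x₀ ∘ Prod.fst)) _ y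
    refine ContDiffAt.comp_contDiffWithinAt y ?_ ((hG.comp contDiffOn_fst hfst) y hy)
    change ContDiffAt ℝ ∞ ContinuousLinearMap.inverse (chartMetric g x₀ y.1)
    rw [← hL]
    exact contDiffAt_map_inverse L
  refine hinv.clm_apply ?_
  rw [contDiffOn_clm_apply]
  intro w
  have hs : ContDiffOn ℝ ∞ (fun y : F × F ↦ y.2) (chartDomain I x₀ S ×ˢ univ) := contDiffOn_snd
  have := (((hD.clm_apply hs).clm_apply hs).clm_apply (contDiffOn_const (c := w))).add
    (((hD.clm_apply hs).clm_apply hs).clm_apply (contDiffOn_const (c := w))) |>.sub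
    (((hD.clm_apply (contDiffOn_const (c := w))).clm_apply hs).clm_apply hs)
  exact contDiffOn_const.mul this

end Acceleration

/-! ### Equivalence of the covariant acceleration condition with the equation in a chart. -/

section Acceleration

set_option synthInstance.maxHeartbeats 200000
set_option linter.unusedSectionVars false

variable {F : Type*} [NormedAddCommGroup F] [NormedSpace ℝ F] [FiniteDimensional ℝ F]
  {H : Type*} [TopologicalSpace H] {I : ModelWithCorners ℝ F H} [I.Boundaryless]
  {X : Type*} [TopologicalSpace X] [ChartedSpace H X] [IsManifold I ∞ X]
  {E' : Type*} [NormedAddCommGroup E'] [NormedSpace ℝ E']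
  {H' : Type*} [TopologicalSpace H'] {J : ModelWithCorners ℝ E' H'}
  {N : Type*} [TopologicalSpace N] [ChartedSpace H' N] [IsManifold J ∞ N]
  {p q : ℕ} {g : BilinField I X} {S : Set X} {𝒜 : ∀ y : X, TangentSpace I y → TangentSpace I y}

/-- The velocity at a fixed time of a smooth family of curves depends smoothly on the parameter. -/
theorem ContMDiffOn.contMDiffAt_mfderiv_fst {Ψ : ℝ × N → X} {O : Set (ℝ × N)}
    (hΨ : ContMDiffOn (𝓘(ℝ, ℝ).prod J) I ∞ Ψ O) (hO : IsOpen O) {s : ℝ} {x : N}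
    (hx : (s, x) ∈ O) :
    ContMDiffAt J I.tangent ∞ (fun x ↦ (⟨Ψ (s, x),
      mfderiv 𝓘(ℝ, ℝ) I (fun s ↦ Ψ (s, x)) s (1 : ℝ)⟩ : TangentBundle I X)) x := by
  have h1 : ContMDiffAt J (𝓘(ℝ, ℝ).tangent.prod J.tangent) ∞
      (fun x ↦ ((⟨s, (1 : ℝ)⟩ : TangentBundle 𝓘(ℝ, ℝ) ℝ), (⟨x, 0⟩ : TangentBundle J N))) x :=
    contMDiffAt_const.prodMk (contMDiff_zeroSection ℝ (TangentSpace J : N → Type _) x)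
  have h2 := ContMDiffAt.comp x (contMDiff_equivTangentBundleProd_symm (I := 𝓘(ℝ, ℝ)) (M := ℝ)
    (I' := J) (M' := N) (n := ∞) (⟨s, (1 : ℝ)⟩, ⟨x, 0⟩)) h1
  have h3 := ContMDiffOn.contMDiffAt (hΨ.contMDiffOn_tangentMap hO)
    ((hO.preimage (FiberBundle.continuous_proj _ _)).mem_nhds
      (show (⟨(s, x), ((1 : ℝ), (0 : E'))⟩ : TangentBundle (𝓘(ℝ, ℝ).prod J) (ℝ × N)) ∈ _ from hx))
  refine (ContMDiffAt.comp x h3 h2).congr_of_eventuallyEq ?_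
  have h4 : ∀ᶠ x' in 𝓝 x, (s, x') ∈ O :=
    (Continuous.prodMk_right s).continuousAt.preimage_mem_nhds (hO.mem_nhds hx)
  filter_upwards [h4] with x' hx'
  have h5 := mfderiv_prod_eq_add_apply (p := (s, x')) (v := ((1 : ℝ), (0 : E')))
    ((hΨ.contMDiffAt (hO.mem_nhds hx')).mdifferentiableAt (by simp))
  have h6 : (mfderiv 𝓘(ℝ, ℝ) I (fun s ↦ Ψ (s, x')) s (1 : ℝ) : F)
      = mfderiv (𝓘(ℝ, ℝ).prod J) I Ψ (s, x') ((1 : ℝ), (0 : E')) := by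
    let A : F := mfderiv 𝓘(ℝ, ℝ) I (fun s ↦ Ψ (s, x')) s (1 : ℝ)
    refine (Eq.trans h5 ?_).symm
    exact (congrArg (fun a : F ↦ A + a) (map_zero (mfderiv J I (fun z ↦ Ψ (s, z)) x'))).trans (add_zero _)
  exact congrArg (fun a : F ↦ (⟨Ψ (s, x'), a⟩ : TangentBundle I X)) h6

theorem chartLaw_mvfderiv {x₀ x : X} (hx : x ∈ (extChartAt I x₀).source) (v : TangentSpace I x) :
    chartLaw 𝒜 x₀ (extChartAt I x₀ x, mvfderiv I (extChartAt I x₀) x v)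
      = mvfderiv I (extChartAt I x₀) x (𝒜 x v) := by
  have key : ∀ (x' : X) (_ : x' = x) (a : F), a = (v : F) →
      (mvfderiv I (extChartAt I x₀) x' (𝒜 x' a) : F) = mvfderiv I (extChartAt I x₀) x (𝒜 x v) := by
    rintro _ rfl _ rfl; rfl
  exact key _ ((extChartAt I x₀).left_inv hx) _ (mfderiv_extChartAt_symm_mvfderiv hx v)

theorem eventually_pullbackForm_symm (hS : IsOpen S) (hg : IsPseudoRiemannianOn I p q g S)
    {ψ : X → X} {y : X} (hψ : IsLocalDiffeomorphAt I I ∞ ψ y) (hy : ψ y ∈ S) :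
    ∀ᶠ x in 𝓝 y, ∀ v w, pullbackForm I I ψ g x v w = pullbackForm I I ψ g x w v := by
  filter_upwards [hψ.continuousAt.preimage_mem_nhds (hS.mem_nhds hy)] with x hx v w
  exact hg.symm _ hx _ _

/-- The acceleration of the curves tangent to `U` is the prescribed one iff these curves satisfy
the corresponding second order equation in a chart. -/
theorem IsLeviCivitaOn.acceleration_iff (hS : IsOpen S) (hg : IsPseudoRiemannianOn I p q g S)
    {ψ : X → X} {O : Set X}
    {nabla : (∀ x : X, TangentSpace I x) → ∀ x : X, TangentSpace I x →L[ℝ] TangentSpace I x}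
    (hn : IsLeviCivitaOn I (pullbackForm I I ψ g) O nabla) {y x₀ : X} (hyO : y ∈ O)
    (hψ : IsLocalDiffeomorphAt I I ∞ ψ y) (h1 : ψ y ∈ (extChartAt I x₀).source) (h2 : ψ y ∈ S)
    {U : ∀ x : X, TangentSpace I x}
    (hU : MDifferentiableAt I I.tangent (fun y ↦ (⟨y, U y⟩ : TangentBundle I X)) y) :
    mfderiv I I ψ y (nabla U y (U y)) = 𝒜 (ψ y) (mfderiv I I ψ y (U y)) ↔
      mvfderiv I (components I (extChartAt I x₀ ∘ ψ) U) y (U y)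
        = chartAcceleration g 𝒜 x₀ (extChartAt I x₀ (ψ y), components I (extChartAt I x₀ ∘ ψ) U y) := by
  have hrep := isCoordRep_pullbackForm hS hg hψ h1 h2
  have hdψ := hψ.mdifferentiableAt (by simp)
  have hk := fun w ↦ hn.apply_self_eq hyO hrep (eventually_pullbackForm_symm hS hg hψ h2) hU w
  have hinv := chartMetric_isInvertible hg (mem_chartDomain h1 h2)
  set u : F := components I (extChartAt I x₀ ∘ ψ) U y with hu
  set c'' : F := mvfderiv I (components I (extChartAt I x₀ ∘ ψ) U) y (U y)
  set D := fderiv ℝ (chartMetric g x₀) (extChartAt I x₀ (ψ y))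
  set G := chartMetric g x₀ (extChartAt I x₀ (ψ y))
  have e1 : (mvfderiv I (extChartAt I x₀) (ψ y) (mfderiv I I ψ y (nabla U y (U y))) : F)
      = c'' + G.inverse (koszulForm D u u) := by
    refine (mvfderiv_extChartAt_comp hdψ h1 _).symm.trans ?_
    -- The Koszul formula holds against every `w`, and `G` is invertible, so the chart expression of
    -- `∇_U U` does not depend on which Levi-Civita connection is used.
    have h3 : G (mvfderiv I (extChartAt I x₀ ∘ ψ) y (nabla U y (U y)))
        = G c'' + koszulForm D u u := by
      ext w
      exact hk w
    have h4 := congrArg G.inverse h3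
    rw [map_add] at h4
    refine Eq.trans (Eq.symm ?_) (h4.trans ?_)
    · exact hinv.inverse_apply_self _
    · rw [hinv.inverse_apply_self]
  have e2 : (mvfderiv I (extChartAt I x₀) (ψ y) (𝒜 (ψ y) (mfderiv I I ψ y (U y))) : F)
      = chartLaw 𝒜 x₀ (extChartAt I x₀ (ψ y), u) := by
    refine (chartLaw_mvfderiv h1 _).symm.trans ?_
    exact congrArg (fun a : F ↦ chartLaw 𝒜 x₀ (extChartAt I x₀ (ψ y), a))
      (mvfderiv_extChartAt_comp hdψ h1 _).symm
  have e3 : chartAcceleration g 𝒜 x₀ (extChartAt I x₀ (ψ y), u)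
      = chartLaw 𝒜 x₀ (extChartAt I x₀ (ψ y), u) - G.inverse (koszulForm D u u) := rfl
  rw [e3, eq_sub_iff_add_eq, ← e1, ← e2]
  exact ((isLocalDiffeomorphAt_extChartAt h1).mfderiv_injective.eq_iff).symm

theorem exists_isLeviCivitaOn_pullbackForm (hS : IsOpen S) (hg : IsPseudoRiemannianOn I p q g S)
    {ψ : X → X} {O : Set X} (hO : IsOpen O) (hψ : IsLocalDiffeomorphOn I I ∞ ψ O)
    (hm : MapsTo ψ O S) : ∃ nabla, IsLeviCivitaOn I (pullbackForm I I ψ g) O nabla := by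
  refine exists_isLeviCivitaOn hO (fun x hx v w ↦ hg.symm _ (hm hx) _ _) fun x hx ↦ ?_
  exact ⟨_, _, isCoordRep_pullbackForm hS hg (x₀ := ψ x) (hψ ⟨x, hx⟩)
    (mem_extChartAt_source _) (hm hx), chartMetric_isInvertible hg
      (mem_chartDomain (mem_extChartAt_source _) (hm hx))⟩

theorem exists_isLeviCivitaOn_nhds (hS : IsOpen S) (hg : IsPseudoRiemannianOn I p q g S)
    {ψ : X → X} {y : X} (hψ : IsLocalDiffeomorphAt I I ∞ ψ y) (hy : ψ y ∈ S) :
    ∃ O nabla, IsOpen O ∧ y ∈ O ∧ IsLocalDiffeomorphOn I I ∞ ψ O ∧ MapsTo ψ O S ∧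
      IsLeviCivitaOn I (pullbackForm I I ψ g) O nabla := by
  obtain ⟨O, hO, hOo, hyO⟩ := eventually_nhds_iff.1
    (hψ.eventually.and (hψ.continuousAt.preimage_mem_nhds (hS.mem_nhds hy)))
  have h1 : IsLocalDiffeomorphOn I I ∞ ψ O := fun x ↦ (hO x x.2).1
  have h2 : MapsTo ψ O S := fun x hx ↦ (hO x hx).2
  obtain ⟨nabla, hn⟩ := exists_isLeviCivitaOn_pullbackForm hS hg hOo h1 h2
  exact ⟨O, nabla, hOo, hyO, h1, h2, hn⟩

/-- Two of the clauses do not mention the form, and the third is homogeneous in it. -/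
theorem IsLeviCivitaOn.of_eq_smul {B B' : BilinField I X} {O : Set X} (hO : IsOpen O)
    {nabla : (∀ x : X, TangentSpace I x) → ∀ x : X, TangentSpace I x →L[ℝ] TangentSpace I x}
    (hn : IsLeviCivitaOn I B O nabla) {c : ℝ} (hc : c ≠ 0)
    (h : ∀ x ∈ O, ∀ v w, B' x v w = c * B x v w) :
    IsLeviCivitaOn I B' O nabla where
  covariant := hn.covariant
  torsion_free := hn.torsion_free
  metric := by
    intro Y Z x hx v hY hZ
    have h1 : (fun y ↦ B' y (Y y) (Z y)) =ᶠ[𝓝 x] (fun r : ℝ ↦ c * r) ∘ fun y ↦ B y (Y y) (Z y) := by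
      filter_upwards [hO.mem_nhds hx] with y hy
      exact h y hy _ _
    have h2 : ∀ (c : ℝ) {f f' : X → ℝ}, MDifferentiableAt I 𝓘(ℝ, ℝ) f x →
        f' =ᶠ[𝓝 x] (fun r : ℝ ↦ c * r) ∘ f → MDifferentiableAt I 𝓘(ℝ, ℝ) f' x ∧
          mvfderiv I f' x v = c * mvfderiv I f x v := by
      intro c f f' hf hf'
      have h2 : HasFDerivAt (fun r : ℝ ↦ c * r) (c • ContinuousLinearMap.id ℝ ℝ) (f x) :=
        (hasFDerivAt_id _).const_mul c
      have h3 := (h2.hasMFDerivAt.comp x hf.hasMFDerivAt).congr_of_eventuallyEq hf'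
      exact ⟨h3.mdifferentiableAt, congrArg (fun f : F →L[ℝ] ℝ ↦ f v) h3.mfderiv⟩
    have h5 : mvfderiv I (fun y ↦ B' y (Y y) (Z y)) x v
        = c * mvfderiv I (fun y ↦ B y (Y y) (Z y)) x v := by
      by_cases hd : MDifferentiableAt I 𝓘(ℝ, ℝ) (fun y ↦ B y (Y y) (Z y)) x
      · exact (h2 c hd h1).2
      -- The form `B` is not assumed to be smooth. Since `c ≠ 0`, both functions fail to be
      -- differentiable together, and then both derivatives have the default value `0`.
      · have hd' : ¬ MDifferentiableAt I 𝓘(ℝ, ℝ) (fun y ↦ B' y (Y y) (Z y)) x := by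
          refine fun hd' ↦ hd (h2 c⁻¹ hd' ?_).1
          filter_upwards [h1] with y hy
          change _ = c⁻¹ * B' y (Y y) (Z y)
          rw [hy]
          change _ = c⁻¹ * (c * _)
          rw [inv_mul_cancel_left₀ hc]
        have e1 : mvfderiv I (fun y ↦ B' y (Y y) (Z y)) x v = 0 :=
          congrArg (fun f : F →L[ℝ] ℝ ↦ f v) (mfderiv_zero_of_not_mdifferentiableAt hd')
        have e2 : mvfderiv I (fun y ↦ B y (Y y) (Z y)) x v = 0 :=
          congrArg (fun f : F →L[ℝ] ℝ ↦ f v) (mfderiv_zero_of_not_mdifferentiableAt hd)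
        rw [e1, e2, mul_zero]
    rw [h5, hn.metric Y Z x hx v hY hZ, h x hx, h x hx, mul_add]

end Acceleration

/-! ### Curves `ρ ↦ ψ(z, ρ)` in `P × ℝ` with prescribed acceleration. -/

section AmbientCurves

set_option synthInstance.maxHeartbeats 200000
set_option linter.unusedSectionVars false

variable {d : ℕ} {P : Type*} [TopologicalSpace P]
  [ChartedSpace (EuclideanSpace ℝ (Fin (d + 1))) P] [IsManifold (𝓡 (d + 1)) ∞ P]
  {p q : ℕ} {g : BilinField (ambientModel d) (P × ℝ)} {S : Set (P × ℝ)}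
  {𝒜 : ∀ y : P × ℝ, TangentSpace (ambientModel d) y → TangentSpace (ambientModel d) y}

/-- The model vector space of `P × ℝ`. -/
abbrev AmbientSpace (d : ℕ) := EuclideanSpace ℝ (Fin (d + 1)) × ℝ

theorem ambientU_eq (y : P × ℝ) :
    (ambientU y : AmbientSpace d) = ((0 : EuclideanSpace ℝ (Fin (d + 1))), (1 : ℝ)) :=
  congrArg (fun f : ℝ →L[ℝ] AmbientSpace d ↦ f 1)
    (mfderiv_prod_right (I := 𝓡 (d + 1)) (I' := 𝓘(ℝ, ℝ)) (x₀ := y.1) (y₀ := y.2))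

theorem contMDiffAt_ambientU (y : P × ℝ) :
    ContMDiffAt (ambientModel d) (ambientModel d).tangent ∞
      (fun y ↦ (⟨y, ambientU y⟩ : TangentBundle (ambientModel d) (P × ℝ))) y := by
  have h1 : ContMDiffAt (ambientModel d) ((𝓡 (d + 1)).tangent.prod 𝓘(ℝ, ℝ).tangent) ∞
      (fun y : P × ℝ ↦ ((⟨y.1, 0⟩ : TangentBundle (𝓡 (d + 1)) P),
        (⟨y.2, (1 : ℝ)⟩ : TangentBundle 𝓘(ℝ, ℝ) ℝ))) y :=
    (ContMDiffAt.comp y (contMDiff_zeroSection ℝ (TangentSpace (𝓡 (d + 1)) : P → Type _) y.1)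
      contMDiffAt_fst).prodMk (ContMDiffAt.comp y (contMDiffAt_constField 1 y.2) contMDiffAt_snd)
  have h2 := ContMDiffAt.comp y (contMDiff_equivTangentBundleProd_symm (I := 𝓡 (d + 1)) (M := P)
    (I' := 𝓘(ℝ, ℝ)) (M' := ℝ) (n := ∞) (⟨y.1, 0⟩, ⟨y.2, (1 : ℝ)⟩)) h1
  refine h2.congr_of_eventuallyEq (Filter.Eventually.of_forall fun y ↦ ?_)
  exact congrArg (fun a : AmbientSpace d ↦ (⟨y, a⟩ : TangentBundle (ambientModel d) (P × ℝ)))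
    (ambientU_eq y)

theorem mdifferentiableAt_ambientU (y : P × ℝ) :
    MDifferentiableAt (ambientModel d) (ambientModel d).tangent
      (fun y ↦ (⟨y, ambientU y⟩ : TangentBundle (ambientModel d) (P × ℝ))) y :=
  (contMDiffAt_ambientU y).mdifferentiableAt (by simp)

theorem hasDerivAt_slice {G : Type*} [NormedAddCommGroup G] [NormedSpace ℝ G] {f : P × ℝ → G}
    {z : P} {ρ : ℝ} (hf : MDifferentiableAt (ambientModel d) 𝓘(ℝ, G) f (z, ρ)) :
    HasDerivAt (fun σ ↦ f (z, σ)) (mvfderiv (ambientModel d) f (z, ρ) (ambientU (z, ρ))) ρ := by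
  have h1 : MDifferentiableAt 𝓘(ℝ, ℝ) (ambientModel d) (fun σ : ℝ ↦ (z, σ)) ρ :=
    mdifferentiableAt_const.prodMk mdifferentiableAt_id
  let A : AmbientSpace d →L[ℝ] G := mvfderiv (ambientModel d) f (z, ρ)
  let B : ℝ →L[ℝ] AmbientSpace d := mfderiv 𝓘(ℝ, ℝ) (ambientModel d) (fun σ : ℝ ↦ (z, σ)) ρ
  have h2 : HasFDerivAt (fun σ ↦ f (z, σ)) (A ∘L B) ρ :=
    (hf.hasMFDerivAt.comp ρ h1.hasMFDerivAt).hasFDerivAt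
  exact h2.hasDerivAt

/-- The curve `γ` satisfies at `ρ`, in the chart at `x₀`, the second order equation which prescribes
its acceleration. -/
def SolvesAt (g : BilinField (ambientModel d) (P × ℝ))
    (𝒜 : ∀ y : P × ℝ, TangentSpace (ambientModel d) y → TangentSpace (ambientModel d) y)
    (x₀ : P × ℝ) (γ : ℝ → P × ℝ) (ρ : ℝ) : Prop :=
  deriv (deriv (extChartAt (ambientModel d) x₀ ∘ γ)) ρ = chartAcceleration g 𝒜 x₀
    (extChartAt (ambientModel d) x₀ (γ ρ), deriv (extChartAt (ambientModel d) x₀ ∘ γ) ρ)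

theorem deriv_slice {χ : P × ℝ → AmbientSpace d} {z : P} {ρ : ℝ}
    (hχ : IsLocalDiffeomorphAt (ambientModel d) 𝓘(ℝ, AmbientSpace d) ∞ χ (z, ρ)) :
    deriv (fun σ ↦ χ (z, σ)) =ᶠ[𝓝 ρ] fun σ ↦ components (ambientModel d) χ ambientU (z, σ) := by
  have h1 : ∀ᶠ σ in 𝓝 ρ, IsLocalDiffeomorphAt (ambientModel d) 𝓘(ℝ, AmbientSpace d) ∞ χ (z, σ) :=
    (Continuous.prodMk_right z).continuousAt.eventually hχ.eventually
  filter_upwards [h1] with σ hσ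
  exact (hasDerivAt_slice (hσ.mdifferentiableAt (by simp))).deriv

theorem IsLeviCivitaOn.acceleration_iff_solvesAt (hS : IsOpen S)
    (hg : IsPseudoRiemannianOn (ambientModel d) p q g S)
    {ψ : P × ℝ → P × ℝ} {O : Set (P × ℝ)}
    {nabla : (∀ x : P × ℝ, TangentSpace (ambientModel d) x) →
      ∀ x : P × ℝ, TangentSpace (ambientModel d) x →L[ℝ] TangentSpace (ambientModel d) x}
    (hn : IsLeviCivitaOn (ambientModel d) (pullbackForm (ambientModel d) (ambientModel d) ψ g) O nabla)
    {y x₀ : P × ℝ} (hyO : y ∈ O)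
    (hψ : IsLocalDiffeomorphAt (ambientModel d) (ambientModel d) ∞ ψ y)
    (h1 : ψ y ∈ (extChartAt (ambientModel d) x₀).source) (h2 : ψ y ∈ S) :
    mfderiv (ambientModel d) (ambientModel d) ψ y (nabla ambientU y (ambientU y))
        = 𝒜 (ψ y) (mfderiv (ambientModel d) (ambientModel d) ψ y (ambientU y)) ↔
      SolvesAt g 𝒜 x₀ (fun σ ↦ ψ (y.1, σ)) y.2 := by
  rw [hn.acceleration_iff hS hg hyO hψ h1 h2 (mdifferentiableAt_ambientU y)]
  have hχ := (isCoordRep_pullbackForm hS hg hψ h1 h2).localDiffeo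
  have e1 := deriv_slice (z := y.1) (ρ := y.2) hχ
  have e2 := (hasDerivAt_slice (z := y.1) (ρ := y.2)
    (hχ.mdifferentiableAt_components (mdifferentiableAt_ambientU y))).deriv
  have e3 := e1.deriv_eq.trans e2
  have e4 := e1.self_of_nhds
  unfold SolvesAt
  have e5 : (extChartAt (ambientModel d) x₀ ∘ fun σ ↦ ψ (y.1, σ))
    = fun σ ↦ (extChartAt (ambientModel d) x₀ ∘ ψ) (y.1, σ) := rfl
  rw [e5, e3, e4]

/-- In either chart the equation is equivalent to the same condition on `∇_𝒰 𝒰`, for a Levi-Civita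
connection of `ψ^* g` near `y`. No transformation law for Christoffel symbols is needed. -/
theorem SolvesAt.change_chart (hS : IsOpen S)
    (hg : IsPseudoRiemannianOn (ambientModel d) p q g S) {ψ : P × ℝ → P × ℝ} {y x₀ x₁ : P × ℝ}
    (hψ : IsLocalDiffeomorphAt (ambientModel d) (ambientModel d) ∞ ψ y)
    (h0 : ψ y ∈ (extChartAt (ambientModel d) x₀).source)
    (h1 : ψ y ∈ (extChartAt (ambientModel d) x₁).source) (h2 : ψ y ∈ S)
    (h : SolvesAt g 𝒜 x₀ (fun σ ↦ ψ (y.1, σ)) y.2) :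
    SolvesAt g 𝒜 x₁ (fun σ ↦ ψ (y.1, σ)) y.2 := by
  obtain ⟨O, nabla, hO, hyO, -, -, hn⟩ := exists_isLeviCivitaOn_nhds hS hg hψ h2
  exact (hn.acceleration_iff_solvesAt hS hg hyO hψ h1 h2).1
    ((hn.acceleration_iff_solvesAt hS hg hyO hψ h0 h2).2 h)

/-- The second order equation is invariant under maps that preserve `g` up to a constant factor and
preserve `𝒜`. -/
theorem SolvesAt.comp_homothety (hS : IsOpen S)
    (hg : IsPseudoRiemannianOn (ambientModel d) p q g S) {ψ D : P × ℝ → P × ℝ} {y x₀ x₁ : P × ℝ}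
    (hψ : IsLocalDiffeomorphAt (ambientModel d) (ambientModel d) ∞ ψ y)
    (hD : IsLocalDiffeomorphOn (ambientModel d) (ambientModel d) ∞ D S) (hDS : MapsTo D S S)
    {c : ℝ} (hc : c ≠ 0)
    (hDg : ∀ y ∈ S, pullbackForm (ambientModel d) (ambientModel d) D g y = c • g y)
    (hD𝒜 : ∀ y ∈ S, ∀ v, 𝒜 (D y) (mfderiv (ambientModel d) (ambientModel d) D y v)
      = mfderiv (ambientModel d) (ambientModel d) D y (𝒜 y v))
    (h0 : ψ y ∈ (extChartAt (ambientModel d) x₀).source)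
    (h1 : D (ψ y) ∈ (extChartAt (ambientModel d) x₁).source) (h2 : ψ y ∈ S)
    (h : SolvesAt g 𝒜 x₀ (fun σ ↦ ψ (y.1, σ)) y.2) :
    SolvesAt g 𝒜 x₁ (fun σ ↦ D (ψ (y.1, σ))) y.2 := by
  obtain ⟨O, nabla, hO, hyO, hψO, hmO, hn⟩ := exists_isLeviCivitaOn_nhds hS hg hψ h2
  have hcomp : ∀ x (hx : x ∈ O) (v : TangentSpace (ambientModel d) x),
      (mfderiv (ambientModel d) (ambientModel d) (D ∘ ψ) x v : AmbientSpace d)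
        = mfderiv (ambientModel d) (ambientModel d) D (ψ x)
          (mfderiv (ambientModel d) (ambientModel d) ψ x v) := fun x hx v ↦
    congrArg (fun f : AmbientSpace d →L[ℝ] AmbientSpace d ↦ f v)
      (mfderiv_comp x ((hD ⟨ψ x, hmO hx⟩).mdifferentiableAt (by simp))
        ((hψO ⟨x, hx⟩).mdifferentiableAt (by simp)))
  -- Near `y` the form `(D ∘ ψ)^* g` is `c` times `ψ^* g`, so the same connection serves for both.
  have hn' : IsLeviCivitaOn (ambientModel d)
      (pullbackForm (ambientModel d) (ambientModel d) (D ∘ ψ) g) O nabla := by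
    refine hn.of_eq_smul hO hc fun x hx v w ↦ ?_
    have e : ∀ a b : AmbientSpace d,
        (g (D (ψ x)) : AmbientSpace d →L[ℝ] AmbientSpace d →L[ℝ] ℝ)
          (mfderiv (ambientModel d) (ambientModel d) D (ψ x) a)
          (mfderiv (ambientModel d) (ambientModel d) D (ψ x) b)
        = c * (g (ψ x) : AmbientSpace d →L[ℝ] AmbientSpace d →L[ℝ] ℝ) a b := fun a b ↦
      congrArg (fun f : AmbientSpace d →L[ℝ] AmbientSpace d →L[ℝ] ℝ ↦ f a b) (hDg _ (hmO hx))
    refine Eq.trans ?_ (e _ _)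
    exact congrArg₂ (fun a b : AmbientSpace d ↦
      (g (D (ψ x)) : AmbientSpace d →L[ℝ] AmbientSpace d →L[ℝ] ℝ) a b) (hcomp x hx v) (hcomp x hx w)
  have hDψ : IsLocalDiffeomorphAt (ambientModel d) (ambientModel d) ∞ (D ∘ ψ) y :=
    IsLocalDiffeomorphAt.comp (hf := hψ) (hg := hD ⟨_, h2⟩)
  refine (hn'.acceleration_iff_solvesAt hS hg hyO hDψ h1 (hDS h2)).1 ?_
  have h3 := (hn.acceleration_iff_solvesAt hS hg hyO hψ h0 h2).2 h
  refine (hcomp y hyO _).trans ?_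
  refine (congrArg (fun a : AmbientSpace d ↦
    (mfderiv (ambientModel d) (ambientModel d) D (ψ y) a : AmbientSpace d)) h3).trans ?_
  refine (hD𝒜 _ h2 _).symm.trans ?_
  exact congrArg (fun a : AmbientSpace d ↦ (𝒜 (D (ψ y)) a : AmbientSpace d)) (hcomp y hyO _).symm

end AmbientCurves

/-! ### Tangent vectors of `P × ℝ` as vectors of the model space. -/

section AmbientDerivatives

set_option synthInstance.maxHeartbeats 200000
set_option linter.unusedSectionVars false

variable {d : ℕ} {P : Type*} [TopologicalSpace P]
  [ChartedSpace (EuclideanSpace ℝ (Fin (d + 1))) P] [IsManifold (𝓡 (d + 1)) ∞ P]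

/-- A field of bilinear forms on `P × ℝ`, with values in the forms on the model vector space. -/
def ambientForm (g : BilinField (ambientModel d) (P × ℝ)) (y : P × ℝ) :
    AmbientSpace d →L[ℝ] AmbientSpace d →L[ℝ] ℝ := g y

/-- The derivative of a map of `P × ℝ`, as a map of the model vector space. -/
def ambientDeriv (f : P × ℝ → P × ℝ) (y : P × ℝ) : AmbientSpace d →L[ℝ] AmbientSpace d :=
  mfderiv (ambientModel d) (ambientModel d) f y

/-- The vector of the model space that corresponds to `∂_ρ`. -/
def unitU (d : ℕ) : AmbientSpace d := (0, 1)

theorem ambientForm_pullbackForm (f : P × ℝ → P × ℝ) (g : BilinField (ambientModel d) (P × ℝ))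
    (y : P × ℝ) (v w : AmbientSpace d) :
    ambientForm (pullbackForm (ambientModel d) (ambientModel d) f g) y v w
      = ambientForm g (f y) (ambientDeriv f y v) (ambientDeriv f y w) := rfl

theorem ambientDeriv_comp {f h : P × ℝ → P × ℝ} {y : P × ℝ}
    (hf : MDifferentiableAt (ambientModel d) (ambientModel d) f (h y))
    (hh : MDifferentiableAt (ambientModel d) (ambientModel d) h y) (v : AmbientSpace d) :
    ambientDeriv (f ∘ h) y v = ambientDeriv f (h y) (ambientDeriv h y v) :=
  congrArg (fun f : AmbientSpace d →L[ℝ] AmbientSpace d ↦ f v) (mfderiv_comp y hf hh)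

theorem ambientDeriv_congr {f h : P × ℝ → P × ℝ} {y : P × ℝ} (he : f =ᶠ[𝓝 y] h) :
    (ambientDeriv f y : AmbientSpace d →L[ℝ] AmbientSpace d) = ambientDeriv h y :=
  he.mfderiv_eq

theorem mdifferentiableAt_zeroSlice (z : P) :
    MDifferentiableAt (𝓡 (d + 1)) (ambientModel d) (fun z : P ↦ (z, (0 : ℝ))) z :=
  mdifferentiableAt_id.prodMk mdifferentiableAt_const

theorem mfderiv_zeroSlice (z : P) (w : EuclideanSpace ℝ (Fin (d + 1))) :
    (mfderiv (𝓡 (d + 1)) (ambientModel d) (fun z : P ↦ (z, (0 : ℝ))) z w : AmbientSpace d)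
      = (w, 0) :=
  congrArg (fun f : EuclideanSpace ℝ (Fin (d + 1)) →L[ℝ] AmbientSpace d ↦ f w)
    (mfderiv_prod_left (I := 𝓡 (d + 1)) (I' := 𝓘(ℝ, ℝ)) (x₀ := z) (y₀ := (0 : ℝ)))

/-- A map which is the identity on `P × {0}` has the identity as derivative along `P × {0}`. -/
theorem ambientDeriv_of_eq_zeroSlice {f : P × ℝ → P × ℝ} {z : P}
    (hf : MDifferentiableAt (ambientModel d) (ambientModel d) f (z, 0))
    (h : ∀ᶠ z' in 𝓝 z, f (z', 0) = (z', 0)) (w : EuclideanSpace ℝ (Fin (d + 1))) :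
    ambientDeriv f (z, 0) ((w, 0) : AmbientSpace d) = (w, 0) := by
  have h1 := (mfderiv_comp z hf (mdifferentiableAt_zeroSlice z)).symm.trans
    (show mfderiv (𝓡 (d + 1)) (ambientModel d) (f ∘ fun z : P ↦ (z, (0 : ℝ))) z = _ from
      Filter.EventuallyEq.mfderiv_eq (f := fun z : P ↦ (z, (0 : ℝ))) h)
  have h2 := congrArg (fun f : EuclideanSpace ℝ (Fin (d + 1)) →L[ℝ] AmbientSpace d ↦ f w) h1
  have h3 := mfderiv_zeroSlice z w
  refine (congrArg (fun v : AmbientSpace d ↦ ambientDeriv f (z, 0) v) h3).symm.trans ?_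
  exact Eq.trans h2 h3

end AmbientDerivatives

/-! ### Dilatations, their generator and the connection form. -/

section Weyl

set_option synthInstance.maxHeartbeats 200000
set_option linter.unusedSectionVars false

variable {d p q : ℕ}
  {M : Type*} [TopologicalSpace M] [ChartedSpace (EuclideanSpace ℝ (Fin d)) M]
  [IsManifold (𝓡 d) ∞ M]
  {P : Type*} [TopologicalSpace P] [ChartedSpace (EuclideanSpace ℝ (Fin (d + 1))) P]
  [IsManifold (𝓡 (d + 1)) ∞ P] {W : WeylStructure d M P}

theorem WeylStructure.δ_inv_δ {s : ℝ} (hs : 0 < s) (z : P) : W.δ s⁻¹ (W.δ s z) = z := by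
  rw [← W.δ_mul s s⁻¹ hs (inv_pos.2 hs), mul_inv_cancel₀ hs.ne', W.δ_one]

theorem WeylStructure.δ_δ_inv {s : ℝ} (hs : 0 < s) (z : P) : W.δ s (W.δ s⁻¹ z) = z := by
  rw [← W.δ_mul s⁻¹ s (inv_pos.2 hs) hs, inv_mul_cancel₀ hs.ne', W.δ_one]

theorem contMDiff_δ {s : ℝ} (hs : 0 < s) : ContMDiff (𝓡 (d + 1)) (𝓡 (d + 1)) ∞ (W.δ s) := by
  intro z
  have h1 := W.δ_smooth.contMDiffAt ((isOpen_Ioi.prod isOpen_univ).mem_nhds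
    (show (s, z) ∈ Ioi (0 : ℝ) ×ˢ (univ : Set P) from ⟨hs, mem_univ z⟩))
  exact h1.comp z (contMDiffAt_const.prodMk contMDiffAt_id)

theorem contMDiffOn_uncurry_ambientδ :
    ContMDiffOn (𝓘(ℝ, ℝ).prod (ambientModel d)) (ambientModel d) ∞
      (fun w : ℝ × (P × ℝ) ↦ ambientδ W w.1 w.2) (Ioi 0 ×ˢ univ) := by
  have h1 : ContMDiff (𝓘(ℝ, ℝ).prod (ambientModel d)) (𝓘(ℝ, ℝ).prod (𝓡 (d + 1))) ∞
      (fun w : ℝ × (P × ℝ) ↦ (w.1, w.2.1)) :=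
    contMDiff_fst.prodMk (contMDiff_fst.comp contMDiff_snd)
  have h2 : ContMDiff (𝓘(ℝ, ℝ).prod (ambientModel d)) 𝓘(ℝ, ℝ) ∞
      (fun w : ℝ × (P × ℝ) ↦ w.2.2) := contMDiff_snd.comp contMDiff_snd
  exact (W.δ_smooth.comp h1.contMDiffOn fun w hw ↦ ⟨hw.1, mem_univ _⟩).prodMk h2.contMDiffOn

theorem contMDiff_ambientδ {s : ℝ} (hs : 0 < s) :
    ContMDiff (ambientModel d) (ambientModel d) ∞ (ambientδ W s) :=
  ((contMDiff_δ hs).comp contMDiff_fst).prodMk contMDiff_snd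

theorem ambientδ_inv_ambientδ {s : ℝ} (hs : 0 < s) (y : P × ℝ) :
    ambientδ W s⁻¹ (ambientδ W s y) = y :=
  Prod.ext (W.δ_inv_δ hs y.1) rfl

theorem ambientδ_ambientδ_inv {s : ℝ} (hs : 0 < s) (y : P × ℝ) :
    ambientδ W s (ambientδ W s⁻¹ y) = y :=
  Prod.ext (W.δ_δ_inv hs y.1) rfl

/-- The dilatation of `P × ℝ` by `s > 0` as a diffeomorphism. -/
def ambientδDiffeo (W : WeylStructure d M P) {s : ℝ} (hs : 0 < s) :
    Diffeomorph (ambientModel d) (ambientModel d) (P × ℝ) (P × ℝ) ∞ where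
  toFun := ambientδ W s
  invFun := ambientδ W s⁻¹
  left_inv := ambientδ_inv_ambientδ hs
  right_inv := ambientδ_ambientδ_inv hs
  contMDiff_toFun := contMDiff_ambientδ hs
  contMDiff_invFun := contMDiff_ambientδ (inv_pos.2 hs)

theorem isLocalDiffeomorph_ambientδ {s : ℝ} (hs : 0 < s) :
    IsLocalDiffeomorph (ambientModel d) (ambientModel d) ∞ (ambientδ W s) :=
  (ambientδDiffeo W hs).isLocalDiffeomorph

theorem mdifferentiableAt_ambientδ {s : ℝ} (hs : 0 < s) (y : P × ℝ) :
    MDifferentiableAt (ambientModel d) (ambientModel d) (ambientδ W s) y :=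
  (contMDiff_ambientδ hs y).mdifferentiableAt (by simp)

theorem ambientδ_one (y : P × ℝ) : ambientδ W 1 y = y := Prod.ext (W.δ_one y.1) rfl

theorem ambientDeriv_ambientδ_zeroSlice {s : ℝ} (hs : 0 < s) (z : P)
    (w : EuclideanSpace ℝ (Fin (d + 1))) :
    ambientDeriv (ambientδ W s) (z, 0) ((w, 0) : AmbientSpace d)
      = ((mfderiv (𝓡 (d + 1)) (𝓡 (d + 1)) (W.δ s) z w : EuclideanSpace ℝ (Fin (d + 1))), 0) := by
  have hδ := (contMDiff_δ (W := W) hs z).mdifferentiableAt (by simp)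
  have h1 := (mfderiv_comp z (mdifferentiableAt_ambientδ (W := W) hs (z, 0))
    (mdifferentiableAt_zeroSlice z)).symm.trans
    (mfderiv_comp (f := W.δ s) z (mdifferentiableAt_zeroSlice (d := d) (W.δ s z)) hδ)
  have h2 := congrArg (fun f : EuclideanSpace ℝ (Fin (d + 1)) →L[ℝ] AmbientSpace d ↦ f w) h1
  refine (congrArg (fun v : AmbientSpace d ↦ ambientDeriv (ambientδ W s) (z, 0) v)
    (mfderiv_zeroSlice z w)).symm.trans ?_
  exact Eq.trans h2 (mfderiv_zeroSlice _ _)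

/-- The generator of the dilatations of `P`. -/
def dilatationGenerator (W : WeylStructure d M P) (z : P) : EuclideanSpace ℝ (Fin (d + 1)) :=
  mfderiv 𝓘(ℝ, ℝ) (𝓡 (d + 1)) (fun s : ℝ ↦ W.δ s z) 1 (1 : ℝ)

theorem mdifferentiableAt_δ_apply (z : P) :
    MDifferentiableAt 𝓘(ℝ, ℝ) (𝓡 (d + 1)) (fun s : ℝ ↦ W.δ s z) 1 := by
  have h1 := W.δ_smooth.contMDiffAt ((isOpen_Ioi.prod isOpen_univ).mem_nhds
    (show ((1 : ℝ), z) ∈ Ioi (0 : ℝ) ×ˢ (univ : Set P) from ⟨one_pos (α := ℝ), mem_univ z⟩))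
  exact (h1.comp (1 : ℝ) (contMDiffAt_id.prodMk contMDiffAt_const)).mdifferentiableAt (by simp)

theorem ambientT_eq (y : P × ℝ) :
    (ambientT W y : AmbientSpace d) = (dilatationGenerator W y.1, 0) := by
  have h1 : mfderiv 𝓘(ℝ, ℝ) (ambientModel d) (fun s : ℝ ↦ ambientδ W s y) 1
    = (mfderiv 𝓘(ℝ, ℝ) (𝓡 (d + 1)) (fun s : ℝ ↦ W.δ s y.1) 1).prod
      (mfderiv 𝓘(ℝ, ℝ) 𝓘(ℝ, ℝ) (fun _ : ℝ ↦ y.2) 1) :=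
    (mdifferentiableAt_δ_apply y.1).mfderiv_prod mdifferentiableAt_const
  have h2 := congrArg (fun f : ℝ →L[ℝ] AmbientSpace d ↦ f 1) h1
  refine Eq.trans h2 ?_
  refine Prod.ext rfl ?_
  exact congrArg (fun f : ℝ →L[ℝ] ℝ ↦ f 1) (mfderiv_const (I := 𝓘(ℝ, ℝ)) (I' := 𝓘(ℝ, ℝ))
    (x := (1 : ℝ)) (c := y.2))

theorem contMDiffAt_ambientT (y : P × ℝ) :
    ContMDiffAt (ambientModel d) (ambientModel d).tangent ∞
      (fun y ↦ (⟨y, ambientT W y⟩ : TangentBundle (ambientModel d) (P × ℝ))) y := by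
  refine (contMDiffOn_uncurry_ambientδ (W := W)).contMDiffAt_mfderiv_fst
    (isOpen_Ioi.prod isOpen_univ) (s := 1) (x := y) ⟨one_pos (α := ℝ), mem_univ _⟩
    |>.congr_of_eventuallyEq (Filter.Eventually.of_forall fun y ↦ ?_)
  have key : ∀ (x : P × ℝ) (_ : x = y) (a : AmbientSpace d),
      (⟨y, a⟩ : TangentBundle (ambientModel d) (P × ℝ)) = ⟨x, a⟩ := by
    rintro _ rfl a; rfl
  exact key _ (ambientδ_one y) _

/-- The projection is constant along the orbits of the dilatations. -/
theorem mfderiv_proj_dilatationGenerator (z : P) :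
    (mfderiv (𝓡 (d + 1)) (𝓡 d) W.proj z (dilatationGenerator W z) : EuclideanSpace ℝ (Fin d))
      = 0 := by
  have key : ∀ z' : P, z' = z →
      (mfderiv (𝓡 (d + 1)) (𝓡 d) W.proj z' (dilatationGenerator W z) : EuclideanSpace ℝ (Fin d))
        = mfderiv (𝓡 (d + 1)) (𝓡 d) W.proj z (dilatationGenerator W z) := by
    rintro _ rfl; rfl
  have h1 := mfderiv_comp (1 : ℝ) ((W.proj_smooth (W.δ 1 z)).mdifferentiableAt (by simp))
    (mdifferentiableAt_δ_apply (W := W) z)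
  have h2 : mfderiv 𝓘(ℝ, ℝ) (𝓡 d) (W.proj ∘ fun s ↦ W.δ s z) (1 : ℝ)
      = mfderiv 𝓘(ℝ, ℝ) (𝓡 d) (fun _ : ℝ ↦ W.proj z) (1 : ℝ) := by
    refine Filter.EventuallyEq.mfderiv_eq ?_
    filter_upwards [lt_mem_nhds (one_pos : (0 : ℝ) < 1)] with s hs
    exact W.proj_δ s hs z
  have h3 := congrArg (fun f : ℝ →L[ℝ] EuclideanSpace ℝ (Fin d) ↦ f 1)
    ((h1.symm.trans h2).trans mfderiv_const)
  exact (key _ (W.δ_one z)).symm.trans h3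

variable {c : WeylClass d p q M} {ι : MetricBundleIso W c} {r : WeylPair d p q M} {t : P → ℝ}

theorem mvfderiv_fibreCoordinate_dilatationGenerator (ht : IsFibreCoordinate W ι.form r.g t) (z : P) :
    mvfderiv (𝓡 (d + 1)) t z (dilatationGenerator W z) = t z := by
  have key : ∀ z' : P, z' = z →
      mvfderiv (𝓡 (d + 1)) t z' (dilatationGenerator W z)
        = mvfderiv (𝓡 (d + 1)) t z (dilatationGenerator W z) := by
    rintro _ rfl; rfl
  have h1 := (((ht.smooth (W.δ 1 z)).mdifferentiableAt (by simp)).hasMFDerivAt.comp (1 : ℝ)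
    (mdifferentiableAt_δ_apply (W := W) z).hasMFDerivAt)
  have h2 : HasMFDerivAt 𝓘(ℝ, ℝ) 𝓘(ℝ, ℝ) (t ∘ fun s ↦ W.δ s z) (1 : ℝ)
      (t z • ContinuousLinearMap.id ℝ ℝ) := by
    refine HasMFDerivAt.congr_of_eventuallyEq
      ((hasFDerivAt_id (1 : ℝ)).const_mul (t z)).hasMFDerivAt ?_
    filter_upwards [lt_mem_nhds (one_pos : (0 : ℝ) < 1)] with s hs
    exact ht.dilate s hs z
  have h3 : _ = _ := congrArg (fun f : ℝ →L[ℝ] ℝ ↦ f 1) (hasMFDerivAt_unique h1 h2)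
  refine (key _ (W.δ_one z)).symm.trans (Eq.trans h3 ?_)
  change t z * 1 = t z
  rw [mul_one]

/-- The connection form, as a form on the model vector space. -/
def connForm (W : WeylStructure d M P) (t : P → ℝ) (a : CovectorField (𝓡 d) M) (z : P) :
    EuclideanSpace ℝ (Fin (d + 1)) →L[ℝ] ℝ := connectionForm W t a z

theorem connForm_apply (a : CovectorField (𝓡 d) M) (z : P) (w : EuclideanSpace ℝ (Fin (d + 1))) :
    connForm W t a z w = (t z)⁻¹ * mvfderiv (𝓡 (d + 1)) t z w
      + a (W.proj z) (mfderiv (𝓡 (d + 1)) (𝓡 d) W.proj z w) := rfl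

/-- The generator is vertical, so only `t⁻¹ dt` sees it, and `t` is homogeneous of degree one. -/
theorem connForm_dilatationGenerator (ht : IsFibreCoordinate W ι.form r.g t)
    (a : CovectorField (𝓡 d) M) (z : P) : connForm W t a z (dilatationGenerator W z) = 1 := by
  rw [connForm_apply, mvfderiv_fibreCoordinate_dilatationGenerator ht,
    inv_mul_cancel₀ (ht.pos z).ne']
  have h1 := congrArg (fun v : EuclideanSpace ℝ (Fin d) ↦ a (W.proj z) v)
    (mfderiv_proj_dilatationGenerator (W := W) z)
  have h2 : (a (W.proj z) : EuclideanSpace ℝ (Fin d) →L[ℝ] ℝ) 0 = 0 := map_zero _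
  exact (congrArg (fun b : ℝ ↦ 1 + b) (Eq.trans h1 h2)).trans (add_zero 1)

/-- A dilatation multiplies `t` by a constant, which leaves `t⁻¹ dt` unchanged, and it covers the
identity of `M`, which leaves `π^* a` unchanged. -/
theorem connForm_δ (ht : IsFibreCoordinate W ι.form r.g t)
    (a : CovectorField (𝓡 d) M) {s : ℝ} (hs : 0 < s) (z : P) (w : EuclideanSpace ℝ (Fin (d + 1))) :
    connForm W t a (W.δ s z) (mfderiv (𝓡 (d + 1)) (𝓡 (d + 1)) (W.δ s) z w) = connForm W t a z w := by
  have hδ := (contMDiff_δ (W := W) hs z).mdifferentiableAt (by simp)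
  have h1 : mvfderiv (𝓡 (d + 1)) t (W.δ s z) (mfderiv (𝓡 (d + 1)) (𝓡 (d + 1)) (W.δ s) z w)
      = mvfderiv (𝓡 (d + 1)) t z w * s := by
    have e1 := ((ht.smooth (W.δ s z)).mdifferentiableAt (by simp)).hasMFDerivAt.comp z
      hδ.hasMFDerivAt
    have e2 : HasMFDerivAt 𝓘(ℝ, ℝ) 𝓘(ℝ, ℝ) (fun r : ℝ ↦ s * r) (t z)
      (s • ContinuousLinearMap.id ℝ ℝ) := ((hasFDerivAt_id (t z)).const_mul s).hasMFDerivAt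
    have e3 := e2.comp z ((ht.smooth z).mdifferentiableAt (by simp)).hasMFDerivAt
    have e4 : t ∘ W.δ s = (fun r : ℝ ↦ s * r) ∘ t := by
      funext z; exact (ht.dilate s hs z).trans (mul_comm _ _)
    rw [e4] at e1
    have e5 : _ = _ := congrArg (fun f : EuclideanSpace ℝ (Fin (d + 1)) →L[ℝ] ℝ ↦ f w)
      (hasMFDerivAt_unique e1 e3)
    exact Eq.trans e5 (mul_comm s _)
  have h2 : (mfderiv (𝓡 (d + 1)) (𝓡 d) W.proj (W.δ s z)
      (mfderiv (𝓡 (d + 1)) (𝓡 (d + 1)) (W.δ s) z w) : EuclideanSpace ℝ (Fin d))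
      = mfderiv (𝓡 (d + 1)) (𝓡 d) W.proj z w := by
    have e1 := mfderiv_comp z ((W.proj_smooth (W.δ s z)).mdifferentiableAt (by simp)) hδ
    have e2 : W.proj ∘ W.δ s = W.proj := funext fun z ↦ W.proj_δ s hs z
    have e3 : ∀ f : P → M, f = W.proj →
        (mfderiv (𝓡 (d + 1)) (𝓡 d) f z w : EuclideanSpace ℝ (Fin d))
          = mfderiv (𝓡 (d + 1)) (𝓡 d) W.proj z w := by
      rintro _ rfl; rfl
    exact Eq.trans (congrArg (fun f : EuclideanSpace ℝ (Fin (d + 1)) →L[ℝ] EuclideanSpace ℝ (Fin d)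
      ↦ f w) e1).symm (e3 _ e2)
  have h3 : ∀ (x : M) (_ : x = W.proj z) (v : EuclideanSpace ℝ (Fin d)),
      v = mfderiv (𝓡 (d + 1)) (𝓡 d) W.proj z w →
      (a x : EuclideanSpace ℝ (Fin d) →L[ℝ] ℝ) v
        = a (W.proj z) (mfderiv (𝓡 (d + 1)) (𝓡 d) W.proj z w) := by
    rintro _ rfl _ rfl; rfl
  refine (connForm_apply _ _ _).trans (Eq.trans ?_ (connForm_apply _ _ _).symm)
  refine congrArg₂ (· + ·) ?_ (h3 _ (W.proj_δ s hs z) _ h2)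
  refine (congrArg (fun b ↦ (t (W.δ s z))⁻¹ * b) h1).trans ?_
  have := (ht.pos z).ne'
  have := hs.ne'
  rw [ht.dilate s hs]
  field_simp

end Weyl

/-! ### The initial velocity: uniqueness, homogeneity, and its meaning for the metric along `P ×
{0}`. -/

section InitialVelocity

set_option synthInstance.maxHeartbeats 200000
set_option linter.unusedSectionVars false

variable {d p q : ℕ}
  {M : Type*} [TopologicalSpace M] [ChartedSpace (EuclideanSpace ℝ (Fin d)) M]
  [IsManifold (𝓡 d) ∞ M]
  {P : Type*} [TopologicalSpace P] [ChartedSpace (EuclideanSpace ℝ (Fin (d + 1))) P]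
  [IsManifold (𝓡 (d + 1)) ∞ P] {W : WeylStructure d M P}
  {c : WeylClass d p q M} {ι : MetricBundleIso W c} {r : WeylPair d p q M} {t : P → ℝ}
  {S : Set (P × ℝ)} {g : BilinField (ambientModel d) (P × ℝ)}

theorem IsWeylPreAmbient.ambientForm_symm (hS : IsWeylPreAmbient ι S g) {y : P × ℝ} (hy : y ∈ S)
    (v w : AmbientSpace d) : ambientForm g y v w = ambientForm g y w v := hS.metric.symm y hy v w

theorem IsWeylPreAmbient.ambientForm_zeroSlice (hS : IsWeylPreAmbient ι S g) (z : P)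
    (w w' : EuclideanSpace ℝ (Fin (d + 1))) :
    ambientForm g (z, 0) (w, 0) (w', 0) = tautologicalTensor ι z w w' := by
  have h1 := congrArg (fun f : EuclideanSpace ℝ (Fin (d + 1)) →L[ℝ]
    EuclideanSpace ℝ (Fin (d + 1)) →L[ℝ] ℝ ↦ f w w') (congrFun hS.tautological z)
  refine Eq.trans (Eq.symm ?_) h1
  exact congrArg₂ (fun a b : AmbientSpace d ↦ ambientForm g (z, 0) a b)
    (mfderiv_zeroSlice z w) (mfderiv_zeroSlice z w')

theorem tautologicalTensor_dilatationGenerator (z : P) (w : EuclideanSpace ℝ (Fin (d + 1))) :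
    tautologicalTensor ι z (dilatationGenerator W z) w = 0 := by
  have h1 := congrArg (fun v : EuclideanSpace ℝ (Fin d) ↦
    (ι.form z : EuclideanSpace ℝ (Fin d) →L[ℝ] EuclideanSpace ℝ (Fin d) →L[ℝ] ℝ) v
      (mfderiv (𝓡 (d + 1)) (𝓡 d) W.proj z w)) (mfderiv_proj_dilatationGenerator (W := W) z)
  refine Eq.trans h1 ?_
  have h2 : (ι.form z : EuclideanSpace ℝ (Fin d) →L[ℝ] EuclideanSpace ℝ (Fin d) →L[ℝ] ℝ) 0 = 0 :=
    map_zero _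
  exact congrArg (fun f : EuclideanSpace ℝ (Fin d) →L[ℝ] ℝ ↦
    f (mfderiv (𝓡 (d + 1)) (𝓡 d) W.proj z w)) h2

theorem IsWeylPreAmbient.ambientForm_dilatationGenerator (hS : IsWeylPreAmbient ι S g) (z : P)
    (w : EuclideanSpace ℝ (Fin (d + 1))) :
    ambientForm g (z, 0) (dilatationGenerator W z, 0) (w, 0) = 0 :=
  (hS.ambientForm_zeroSlice z _ _).trans (tautologicalTensor_dilatationGenerator z w)

theorem IsWeylPreAmbient.ambientForm_ambientδ (hS : IsWeylPreAmbient ι S g) {s : ℝ} (hs : 0 < s)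
    {y : P × ℝ} (hy : y ∈ S) (v w : AmbientSpace d) :
    ambientForm g (ambientδ W s y) (ambientDeriv (ambientδ W s) y v)
      (ambientDeriv (ambientδ W s) y w) = s ^ 2 * ambientForm g y v w :=
  congrArg (fun f : AmbientSpace d →L[ℝ] AmbientSpace d →L[ℝ] ℝ ↦ f v w) (hS.homogeneous s hs y hy)

/-- `v` is a velocity at `(z, 0)` for which the metric has the Weyl-normal form along `P × {0}`. -/
def IsInitialVelocity (W : WeylStructure d M P) (t : P → ℝ) (a : CovectorField (𝓡 d) M)
    (g : BilinField (ambientModel d) (P × ℝ)) (z : P) (v : AmbientSpace d) : Prop :=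
  (∀ w : EuclideanSpace ℝ (Fin (d + 1)),
    ambientForm g (z, 0) v (w, 0) = t z ^ 2 * connForm W t a z w) ∧ ambientForm g (z, 0) v v = 0

section

variable {a : CovectorField (𝓡 d) M} {z : P} {v v' : AmbientSpace d}

theorem IsInitialVelocity.apply_dilatationGenerator (ht : IsFibreCoordinate W ι.form r.g t)
    (hv : IsInitialVelocity W t a g z v) :
    ambientForm g (z, 0) v (dilatationGenerator W z, 0) = t z ^ 2 := by
  rw [hv.1, connForm_dilatationGenerator ht, mul_one]

/-- Transversality: a vector tangent to `P × {0}` is orthogonal to `𝒯`, whereas `g(v, 𝒯) = t² ≠ 0`.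
-/
theorem IsInitialVelocity.snd_ne_zero (ht : IsFibreCoordinate W ι.form r.g t)
    (hS : IsWeylPreAmbient ι S g) (hv : IsInitialVelocity W t a g z v) : v.2 ≠ 0 := by
  intro h0
  have h1 := hv.apply_dilatationGenerator ht
  have h2 : v = (v.1, 0) := Prod.ext rfl h0
  rw [h2, hS.ambientForm_symm (hS.zero_mem z), hS.ambientForm_dilatationGenerator] at h1
  exact (pow_pos (ht.pos z) 2).ne h1

/-- The difference of two solutions is orthogonal to the slice, hence a multiple `l 𝒯`. Comparing
`g(v, v) = 0 = g(v', v')` gives `2 l t² = 0`. -/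
theorem IsInitialVelocity.unique (ht : IsFibreCoordinate W ι.form r.g t)
    (hS : IsWeylPreAmbient ι S g) (hv : IsInitialVelocity W t a g z v)
    (hv' : IsInitialVelocity W t a g z v') : v = v' := by
  have htz : t z ^ 2 ≠ 0 := (pow_pos (ht.pos z) 2).ne'
  have hsymm := hS.ambientForm_symm (hS.zero_mem z)
  have hT := hS.ambientForm_dilatationGenerator z
  have hvT := hv.apply_dilatationGenerator ht
  have hvT' := hv'.apply_dilatationGenerator ht
  set B := ambientForm g (z, 0) with hB
  set T : AmbientSpace d := (dilatationGenerator W z, 0) with hTdef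
  -- Chosen so that `v - v' - l T` is orthogonal to `v` as well. The slice and the transverse vector
  -- `v` span, so this vector vanishes by nondegeneracy.
  set l : ℝ := B (v - v') v / t z ^ 2 with hl
  have h1 : v - v' - l • T = 0 := by
    refine eq_zero_of_forall_apply_eq_zero hS.metric (hS.zero_mem z) fun w ↦ ?_
    change B (v - v' - l • T) w = 0
    let w₁ : AmbientSpace d := w
    have hw : (w : AmbientSpace d)
        = (w₁.1 - (w₁.2 / v.2) • v.1, (0 : ℝ)) + (w₁.2 / v.2) • v := by
      have := hv.snd_ne_zero ht hS
      refine Prod.ext ?_ ?_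
      · change w₁.1 = w₁.1 - (w₁.2 / v.2) • v.1 + (w₁.2 / v.2) • v.1
        abel
      · change w₁.2 = 0 + (w₁.2 / v.2) * v.2
        field_simp
        simp
    rw [hw, map_add, map_smul]
    have e1 : B (v - v' - l • T) (w₁.1 - (w₁.2 / v.2) • v.1, 0) = 0 := by
      rw [map_sub, map_sub, map_smul, sub_apply, sub_apply, smul_apply, hT, hv.1, hv'.1]
      simp
    have e2 : B (v - v' - l • T) v = 0 := by
      rw [map_sub, map_smul, sub_apply, smul_apply, hsymm T v, hvT, hl, smul_eq_mul,
        div_mul_cancel₀ _ htz, sub_self]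
    rw [e1, e2]
    simp
  have h2 : v = v' + l • T := by
    rw [sub_sub, sub_eq_zero] at h1
    exact h1
  have h3 := hv.2
  have hTT : B T T = 0 := hT _
  have hvv' : B v' v' = 0 := hv'.2
  change B v v = 0 at h3
  rw [h2] at h3
  simp only [map_add, map_smul, add_apply, smul_apply, smul_eq_mul, hTT, hvv', hsymm T v', hvT'] at h3
  have h4 : l = 0 := by
    have : 2 * l * t z ^ 2 = 0 := by linarith
    rcases mul_eq_zero.1 this with h | h
    · linarith
    · exact absurd h htz
  rw [h2, h4, zero_smul, add_zero]

/-- Under `δ_s` both `g` and `t²` acquire the factor `s²`, while `n` is invariant. Surjectivity of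
the differential lets every `w` at the new point be written as an image. -/
theorem IsInitialVelocity.dilate (ht : IsFibreCoordinate W ι.form r.g t)
    (hS : IsWeylPreAmbient ι S g) (hv : IsInitialVelocity W t a g z v) {s : ℝ} (hs : 0 < s) :
    IsInitialVelocity W t a g (W.δ s z) (ambientDeriv (ambientδ W s) (z, 0) v) := by
  have h1 := hS.ambientForm_ambientδ hs (hS.zero_mem z)
  refine ⟨fun w ↦ ?_, ?_⟩
  · obtain ⟨⟨w', ρ⟩, hw'⟩ := ((isLocalDiffeomorph_ambientδ (W := W) hs) (z, 0)).mfderiv_surjective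
      ((w, 0) : AmbientSpace d)
    change ambientDeriv (ambientδ W s) (z, 0) (w', ρ) = ((w, 0) : AmbientSpace d) at hw'
    -- Dilatations do not touch `ρ`, so a preimage of a vector tangent to the slice is itself
    -- tangent to the slice.
    have hsnd : ∀ v : AmbientSpace d, (ambientDeriv (ambientδ W s) (z, 0) v).2 = v.2 := by
      intro v
      have e1 := mfderiv_comp (z, 0) (mdifferentiableAt_snd (I := 𝓡 (d + 1)) (I' := 𝓘(ℝ, ℝ)))
        (mdifferentiableAt_ambientδ (W := W) hs (z, 0))
      have e2 : (Prod.snd : P × ℝ → ℝ) ∘ ambientδ W s = Prod.snd := rfl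
      rw [e2, mfderiv_snd, mfderiv_snd] at e1
      exact (congrArg (fun f : AmbientSpace d →L[ℝ] ℝ ↦ f v) e1).symm
    have hρ : ρ = 0 := (hsnd (w', ρ)).symm.trans (congrArg Prod.snd hw')
    subst hρ
    have hw := (ambientDeriv_ambientδ_zeroSlice hs z w').symm.trans hw'
    have hw1 : (mfderiv (𝓡 (d + 1)) (𝓡 (d + 1)) (W.δ s) z w' : EuclideanSpace ℝ (Fin (d + 1)))
      = w := congrArg Prod.fst hw
    have h2 := h1 v (w', 0)
    rw [hw', hv.1] at h2
    refine Eq.trans h2 ?_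
    rw [ht.dilate s hs, ← connForm_δ ht a hs z w']
    have h3 := congrArg (fun b : EuclideanSpace ℝ (Fin (d + 1)) ↦ connForm W t a (W.δ s z) b) hw1
    refine (congrArg (fun b ↦ s ^ 2 * (t z ^ 2 * b)) h3).trans ?_
    ring
  · exact (h1 v v).trans (by rw [hv.2, mul_zero])

/-- The metric has the Weyl-normal form along `P × {0}` iff the curves `ρ ↦ ψ (z, ρ)` have the right
initial velocities. -/
theorem initial_iff_isInitialVelocity (hS : IsWeylPreAmbient ι S g) {ψ : P × ℝ → P × ℝ}
    (hψ : MDifferentiableAt (ambientModel d) (ambientModel d) ψ (z, 0))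
    (h0 : ∀ z, ψ (z, 0) = (z, 0)) :
    (∀ v w : AmbientSpace d, ambientForm (pullbackForm (ambientModel d) (ambientModel d) ψ g) (z, 0) v w
      = tautologicalTensor ι z v.1 w.1
        + t z ^ 2 * (connForm W t a z v.1 * w.2 + connForm W t a z w.1 * v.2)) ↔
      IsInitialVelocity W t a g z (ambientDeriv ψ (z, 0) (unitU d)) := by
  have hd := ambientDeriv_of_eq_zeroSlice hψ (Filter.Eventually.of_forall h0)
  set V := ambientDeriv ψ (z, 0) (unitU d) with hV
  -- The differential is the identity on the slice and sends `∂_ρ` to `V`. So the pullback involves,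
  -- besides `𝐠₀`, only the products of `V` with the slice and with itself.
  have hdecomp : ∀ v : AmbientSpace d, ambientDeriv ψ (z, 0) v = (v.1, (0 : ℝ)) + v.2 • V := by
    intro v
    have : v = (v.1, (0 : ℝ)) + v.2 • unitU d := by
      refine Prod.ext ?_ ?_
      · change v.1 = v.1 + v.2 • (0 : EuclideanSpace ℝ (Fin (d + 1)))
        simp
      · change v.2 = 0 + v.2 * 1
        ring
    conv_lhs => rw [this]
    rw [map_add, map_smul, hd]
  have hpb : ∀ v w : AmbientSpace d,
      ambientForm (pullbackForm (ambientModel d) (ambientModel d) ψ g) (z, 0) v w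
        = tautologicalTensor ι z v.1 w.1 + v.2 * ambientForm g (z, 0) V (w.1, 0)
          + w.2 * ambientForm g (z, 0) V (v.1, 0) + v.2 * w.2 * ambientForm g (z, 0) V V := by
    intro v w
    rw [ambientForm_pullbackForm, h0, hdecomp, hdecomp]
    simp only [map_add, map_smul, add_apply, smul_apply, smul_eq_mul]
    rw [hS.ambientForm_symm (hS.zero_mem z) (v.1, 0) V, hS.ambientForm_zeroSlice]
    ring
  constructor
  · intro h
    refine ⟨fun w ↦ ?_, ?_⟩
    · have h1 := (hpb (unitU d) (w, 0)).symm.trans (h (unitU d) (w, 0))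
      simp only [unitU] at h1
      linarith
    · have h1 := (hpb (unitU d) (unitU d)).symm.trans (h (unitU d) (unitU d))
      simp only [unitU] at h1
      have h2 : ambientForm g (z, 0) V ((0 : EuclideanSpace ℝ (Fin (d + 1))), (0 : ℝ)) = 0 :=
        map_zero _
      rw [map_zero (connForm W t a z), h2] at h1
      linarith
  · intro h v w
    rw [hpb, h.1, h.1, h.2]
    ring

end

end InitialVelocity

/-! ### Existence of the initial velocity and its smooth dependence on the point. -/

section ChartInitialVelocity

set_option synthInstance.maxHeartbeats 200000
set_option linter.unusedSectionVars false

variable {d p q : ℕ}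
  {M : Type*} [TopologicalSpace M] [ChartedSpace (EuclideanSpace ℝ (Fin d)) M]
  [IsManifold (𝓡 d) ∞ M]
  {P : Type*} [TopologicalSpace P] [ChartedSpace (EuclideanSpace ℝ (Fin (d + 1))) P]
  [IsManifold (𝓡 (d + 1)) ∞ P] {W : WeylStructure d M P}
  {c : WeylClass d p q M} {ι : MetricBundleIso W c} {r : WeylPair d p q M} {t : P → ℝ}
  {S : Set (P × ℝ)} {g : BilinField (ambientModel d) (P × ℝ)}

/-- The chart at `x₀`, followed backwards to `P`. -/
def chartBase (x₀ : P × ℝ) (e : AmbientSpace d) : P := ((extChartAt (ambientModel d) x₀).symm e).1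

theorem contMDiffOn_chartBase (x₀ : P × ℝ) :
    ContMDiffOn 𝓘(ℝ, AmbientSpace d) (𝓡 (d + 1)) ∞ (chartBase x₀)
      (extChartAt (ambientModel d) x₀).target :=
  contMDiff_fst.comp_contMDiffOn (contMDiffOn_extChartAt_symm x₀)

/-- The covector `t² n` in the chart at `x₀`. -/
def chartCovector (W : WeylStructure d M P) (t : P → ℝ) (a : CovectorField (𝓡 d) M) (x₀ : P × ℝ)
    (e : AmbientSpace d) : AmbientSpace d →L[ℝ] ℝ :=
  (t (chartBase x₀ e)) ^ 2 • (connForm W t a (chartBase x₀ e) ∘L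
    (mfderiv 𝓘(ℝ, AmbientSpace d) (𝓡 (d + 1)) (chartBase x₀) e :
      AmbientSpace d →L[ℝ] EuclideanSpace ℝ (Fin (d + 1))))

theorem contDiffOn_chartCovector (ht : IsFibreCoordinate W ι.form r.g t) (x₀ : P × ℝ) :
    ContDiffOn ℝ ∞ (chartCovector W t r.a x₀) (extChartAt (ambientModel d) x₀).target := by
  have hO := isOpen_extChartAt_target (I := ambientModel d) x₀
  have hb := contMDiffOn_chartBase (d := d) x₀
  have hf : ContDiffOn ℝ ∞ (t ∘ chartBase x₀) (extChartAt (ambientModel d) x₀).target :=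
    contMDiffOn_iff_contDiffOn.1 (ht.smooth.comp_contMDiffOn hb)
  have hk : ContMDiffOn 𝓘(ℝ, AmbientSpace d) (𝓡 d) ∞ (W.proj ∘ chartBase x₀)
      (extChartAt (ambientModel d) x₀).target := W.proj_smooth.comp_contMDiffOn hb
  rw [contDiffOn_clm_apply]
  intro w e he
  -- In `t² n = t dt + t² π^* a` the two terms are treated separately; this is the first, where `t²
  -- t⁻¹` has been simplified to `t`.
  have h1 : ContDiffAt ℝ ∞ (fun e ↦ (t ∘ chartBase x₀) e * fderiv ℝ (t ∘ chartBase x₀) e w) e :=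
    ((hf.contDiffAt (hO.mem_nhds he)).mul
      (((hf.fderiv_of_isOpen hO (m := ∞) (by simp)).contDiffAt (hO.mem_nhds he)).clm_apply
        contDiffAt_const))
  have h2 : ContMDiffAt 𝓘(ℝ, AmbientSpace d) ((𝓡 d).prod 𝓘(ℝ, EuclideanSpace ℝ (Fin d) →L[ℝ] ℝ)) ∞
      (fun e ↦ TotalSpace.mk' (EuclideanSpace ℝ (Fin d) →L[ℝ] ℝ)
        (E := fun x : M ↦ TangentSpace (𝓡 d) x →L[ℝ] ℝ)
        ((W.proj ∘ chartBase x₀) e) (r.a ((W.proj ∘ chartBase x₀) e))) e :=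
    (r.smooth_a _).comp e (hk.contMDiffAt (hO.mem_nhds he))
  have h3 := ContMDiffAt.clm_bundle_apply (F₁ := EuclideanSpace ℝ (Fin d)) (F₂ := ℝ)
    (E₂ := Bundle.Trivial M ℝ) h2 (hk.mfderiv_apply hO he (contMDiffAt_constField w e))
  rw [contMDiffAt_totalSpace] at h3
  have h4 := h1.add (((hf.contDiffAt (hO.mem_nhds he)).pow 2).mul (contMDiffAt_iff_contDiffAt.1 h3.2))
  refine (h4.congr_of_eventuallyEq ?_).contDiffWithinAt
  filter_upwards [hO.mem_nhds he] with e' he'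
  have hbd := (hb.contMDiffAt (hO.mem_nhds he')).mdifferentiableAt (by simp : (∞ : WithTop ℕ∞) ≠ 0)
  set w' : EuclideanSpace ℝ (Fin (d + 1)) :=
    mfderiv 𝓘(ℝ, AmbientSpace d) (𝓡 (d + 1)) (chartBase x₀) e' w with hw'
  have e1 : mvfderiv (𝓡 (d + 1)) t (chartBase x₀ e') w' = fderiv ℝ (t ∘ chartBase x₀) e' w := by
    have h5 := ((ht.smooth (chartBase x₀ e')).mdifferentiableAt (by simp)).hasMFDerivAt.comp e'
      hbd.hasMFDerivAt
    let A : EuclideanSpace ℝ (Fin (d + 1)) →L[ℝ] ℝ := mvfderiv (𝓡 (d + 1)) t (chartBase x₀ e')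
    let B : AmbientSpace d →L[ℝ] EuclideanSpace ℝ (Fin (d + 1)) :=
      mfderiv 𝓘(ℝ, AmbientSpace d) (𝓡 (d + 1)) (chartBase x₀) e'
    have h6 : HasFDerivAt (t ∘ chartBase x₀) (A ∘L B) e' := h5.hasFDerivAt
    exact congrArg (fun f : AmbientSpace d →L[ℝ] ℝ ↦ f w) h6.fderiv.symm
  have e2 : (mfderiv (𝓡 (d + 1)) (𝓡 d) W.proj (chartBase x₀ e') w' : EuclideanSpace ℝ (Fin d))
      = mfderiv 𝓘(ℝ, AmbientSpace d) (𝓡 d) (W.proj ∘ chartBase x₀) e' w :=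
    congrArg (fun f : AmbientSpace d →L[ℝ] EuclideanSpace ℝ (Fin d) ↦ f w)
      (mfderiv_comp e' ((W.proj_smooth _).mdifferentiableAt (by simp)) hbd).symm
  have e3 : chartCovector W t r.a x₀ e' w
      = t (chartBase x₀ e') ^ 2 * connForm W t r.a (chartBase x₀ e') w' := rfl
  have e4 := connForm_apply (W := W) (t := t) r.a (chartBase x₀ e') w'
  have e5 := congrArg (fun b : EuclideanSpace ℝ (Fin d) ↦ r.a (W.proj (chartBase x₀ e')) b) e2
  have e6 : connForm W t r.a (chartBase x₀ e') w' = (t (chartBase x₀ e'))⁻¹ *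
      fderiv ℝ (t ∘ chartBase x₀) e' w + r.a (W.proj (chartBase x₀ e'))
        (mfderiv 𝓘(ℝ, AmbientSpace d) (𝓡 d) (W.proj ∘ chartBase x₀) e' w) :=
    e4.trans (congrArg₂ (fun b b' : ℝ ↦ (t (chartBase x₀ e'))⁻¹ * b + b') e1 e5)
  have ht0 := (ht.pos (chartBase x₀ e')).ne'
  rw [e3, e6, mul_add]
  refine congrArg₂ (· + ·) ?_ rfl
  change _ = t (chartBase x₀ e') * _
  field_simp

/-- The generator of the dilatations in the chart at `x₀`. -/
def chartGenerator (W : WeylStructure d M P) (x₀ : P × ℝ) (e : AmbientSpace d) : AmbientSpace d :=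
  -- A law that ignores the velocity, so the second argument is arbitrary.
  chartLaw (I := ambientModel d) (fun y _ ↦ ambientT W y) x₀ (e, 0)

theorem contDiffOn_chartGenerator (hS : IsOpen S) (x₀ : P × ℝ) :
    ContDiffOn ℝ ∞ (chartGenerator W x₀) (chartDomain (ambientModel d) x₀ S) := by
  have h1 : ContMDiffOn (ambientModel d).tangent (ambientModel d).tangent ∞
      (fun v : TangentBundle (ambientModel d) (P × ℝ) ↦
        (⟨v.proj, ambientT W v.proj⟩ : TangentBundle (ambientModel d) (P × ℝ))) {v | v.proj ∈ S} :=
    fun v _ ↦ ((contMDiffAt_ambientT (W := W) v.proj).comp v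
      (contMDiffAt_proj (TangentSpace (ambientModel d)))).contMDiffWithinAt
  exact (contDiffOn_chartLaw hS h1 x₀).comp (contDiffOn_id.prodMk contDiffOn_const)
    fun e he ↦ ⟨he, mem_univ _⟩

/-- The initial velocity for the Weyl-normal form, in the chart at `x₀`. -/
def chartInitialVelocity (W : WeylStructure d M P) (t : P → ℝ) (a : CovectorField (𝓡 d) M)
    (g : BilinField (ambientModel d) (P × ℝ)) (x₀ : P × ℝ) (e : AmbientSpace d) : AmbientSpace d :=
  -- The vector dual to `t² n` has the right products with the slice. Along `P × {0}`, subtracting a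
  -- multiple of `𝒯` keeps them, and since `g(v, 𝒯) = t²` and `g(𝒯, 𝒯) = 0` the multiple `g(v, v) /
  -- (2 t²)` makes the result null. Away from the slice the formula is merely a smooth extension.
  let v := (chartMetric g x₀ e).inverse (chartCovector W t a x₀ e)
  v - (chartMetric g x₀ e v v / (2 * t (chartBase x₀ e) ^ 2)) • chartGenerator W x₀ e

theorem contDiffOn_chartInitialVelocity (ht : IsFibreCoordinate W ι.form r.g t)
    (hS : IsWeylPreAmbient ι S g) (x₀ : P × ℝ) :
    ContDiffOn ℝ ∞ (chartInitialVelocity W t r.a g x₀) (chartDomain (ambientModel d) x₀ S) := by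
  have hG := contDiffOn_chartMetric hS.isOpen hS.metric x₀
  have hf : ContDiffOn ℝ ∞ (t ∘ chartBase x₀) (chartDomain (ambientModel d) x₀ S) :=
    (contMDiffOn_iff_contDiffOn.1 (ht.smooth.comp_contMDiffOn (contMDiffOn_chartBase x₀))).mono
      inter_subset_left
  have hinv : ContDiffOn ℝ ∞ (fun e ↦ (chartMetric g x₀ e).inverse)
      (chartDomain (ambientModel d) x₀ S) := by
    intro e he
    obtain ⟨L, hL⟩ := chartMetric_isInvertible hS.metric he
    change ContDiffWithinAt ℝ ∞ (ContinuousLinearMap.inverse ∘ chartMetric g x₀) _ e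
    refine ContDiffAt.comp_contDiffWithinAt e ?_ (hG e he)
    rw [← hL]
    exact contDiffAt_map_inverse L
  have hv := hinv.clm_apply ((contDiffOn_chartCovector ht x₀).mono inter_subset_left)
  refine hv.sub ?_
  change ContDiffOn ℝ ∞ ((fun e ↦ chartMetric g x₀ e
    ((chartMetric g x₀ e).inverse (chartCovector W t r.a x₀ e))
    ((chartMetric g x₀ e).inverse (chartCovector W t r.a x₀ e)) / (2 * t (chartBase x₀ e) ^ 2)) •
      chartGenerator W x₀) _
  refine ContDiffOn.smul ?_ (contDiffOn_chartGenerator hS.isOpen x₀)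
  refine ((hG.clm_apply hv).clm_apply hv).div (contDiffOn_const.mul (hf.pow 2)) fun e _ ↦ ?_
  exact mul_ne_zero two_ne_zero (pow_ne_zero 2 (ht.pos _).ne')

theorem isInitialVelocity_chartInitialVelocity (ht : IsFibreCoordinate W ι.form r.g t)
    (hS : IsWeylPreAmbient ι S g) {x₀ : P × ℝ} {z : P}
    (hz : (z, (0 : ℝ)) ∈ (extChartAt (ambientModel d) x₀).source) :
    IsInitialVelocity W t r.a g z
      (mfderiv 𝓘(ℝ, AmbientSpace d) (ambientModel d) (extChartAt (ambientModel d) x₀).symm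
        (extChartAt (ambientModel d) x₀ (z, 0))
        (chartInitialVelocity W t r.a g x₀ (extChartAt (ambientModel d) x₀ (z, 0)))) := by
  set e := extChartAt (ambientModel d) x₀ (z, 0) with he
  have hez : (extChartAt (ambientModel d) x₀).symm e = (z, 0) := (extChartAt _ x₀).left_inv hz
  have hbz : chartBase x₀ e = z := congrArg Prod.fst hez
  have hed : e ∈ chartDomain (ambientModel d) x₀ S := mem_chartDomain hz (hS.zero_mem z)
  let K : AmbientSpace d →L[ℝ] AmbientSpace d :=
    mvfderiv (ambientModel d) (extChartAt (ambientModel d) x₀) (z, 0)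
  let K' : AmbientSpace d →L[ℝ] AmbientSpace d :=
    mfderiv 𝓘(ℝ, AmbientSpace d) (ambientModel d) (extChartAt (ambientModel d) x₀).symm e
  have hK : ∀ v, K' (K v) = v := fun v ↦ mfderiv_extChartAt_symm_mvfderiv hz v
  have hG : ∀ v w, chartMetric g x₀ e v w = ambientForm g (z, 0) (K' v) (K' w) := by
    have key : ∀ x, x = (z, (0 : ℝ)) → ∀ v w, ambientForm g x (K' v) (K' w)
      = ambientForm g (z, 0) (K' v) (K' w) := by rintro _ rfl v w; rfl
    exact fun v w ↦ key _ hez v w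
  have hgen : K' (chartGenerator W x₀ e) = (dilatationGenerator W z, 0) := by
    have key : ∀ x, x = (z, (0 : ℝ)) →
        (mvfderiv (ambientModel d) (extChartAt (ambientModel d) x₀) x (ambientT W x) : AmbientSpace d)
          = K (dilatationGenerator W z, 0) := by
      rintro _ rfl
      exact congrArg K (ambientT_eq (W := W) (z, 0))
    exact (congrArg K' (key _ hez)).trans (hK _)
  have hcov : ∀ w, chartCovector W t r.a x₀ e (K w) = t z ^ 2 * connForm W t r.a z w.1 := by
    intro w
    have h1 : (mfderiv 𝓘(ℝ, AmbientSpace d) (𝓡 (d + 1)) (chartBase x₀) e (K w) :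
        EuclideanSpace ℝ (Fin (d + 1))) = w.1 := by
      have hb := ((contMDiffOn_chartBase (d := d) x₀).contMDiffAt
        ((isOpen_extChartAt_target x₀).mem_nhds hed.1)).mdifferentiableAt
          (by simp : (∞ : WithTop ℕ∞) ≠ 0)
      have h2 := hb.hasMFDerivAt.comp (z, (0 : ℝ))
        ((isLocalDiffeomorphAt_extChartAt hz).mdifferentiableAt (by simp)).hasMFDerivAt
      have h3 : HasMFDerivAt (ambientModel d) (𝓡 (d + 1))
          (chartBase x₀ ∘ extChartAt (ambientModel d) x₀) (z, (0 : ℝ)) _ :=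
        (hasMFDerivAt_fst (I := 𝓡 (d + 1)) (I' := 𝓘(ℝ, ℝ)) (z, (0 : ℝ))).congr_of_eventuallyEq (by
          filter_upwards [(isOpen_extChartAt_source x₀).mem_nhds hz] with x hx
          exact congrArg Prod.fst ((extChartAt (ambientModel d) x₀).left_inv hx))
      exact congrArg (fun f : AmbientSpace d →L[ℝ] EuclideanSpace ℝ (Fin (d + 1)) ↦ f w)
        (hasMFDerivAt_unique h2 h3)
    have key : ∀ x, x = z → ∀ w' : EuclideanSpace ℝ (Fin (d + 1)), w' = w.1 →
      t x ^ 2 * connForm W t r.a x w' = t z ^ 2 * connForm W t r.a z w.1 := by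
      rintro _ rfl _ rfl; rfl
    exact key _ hbz _ h1
  set v₀ := (chartMetric g x₀ e).inverse (chartCovector W t r.a x₀ e) with hv₀
  have hv₀w : ∀ w : AmbientSpace d,
      ambientForm g (z, 0) (K' v₀) w = t z ^ 2 * connForm W t r.a z w.1 := by
    intro w
    have h1 : chartMetric g x₀ e v₀ = chartCovector W t r.a x₀ e :=
      (chartMetric_isInvertible hS.metric hed).self_apply_inverse _
    rw [← hcov w, ← h1, hG, hK]
  have hsymm := hS.ambientForm_symm (hS.zero_mem z)
  have hT := hS.ambientForm_dilatationGenerator z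
  set T : AmbientSpace d := (dilatationGenerator W z, 0) with hTdef
  have hv₀T : ambientForm g (z, 0) (K' v₀) T = t z ^ 2 := by
    rw [hv₀w, hTdef, connForm_dilatationGenerator ht, mul_one]
  have ht0 := (ht.pos z).ne'
  have hv : K' (chartInitialVelocity W t r.a g x₀ e)
      = K' v₀ - (ambientForm g (z, 0) (K' v₀) (K' v₀) / (2 * t z ^ 2)) • T := by
    have h1 : chartInitialVelocity W t r.a g x₀ e
      = v₀ - (chartMetric g x₀ e v₀ v₀ / (2 * t (chartBase x₀ e) ^ 2)) • chartGenerator W x₀ e := rfl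
    rw [h1, map_sub, map_smul, hgen, hG, hbz]
  change IsInitialVelocity W t r.a g z (K' (chartInitialVelocity W t r.a g x₀ e))
  rw [hv]
  refine ⟨fun w ↦ ?_, ?_⟩
  · rw [map_sub, map_smul, sub_apply, smul_apply, hT, hv₀w]
    simp
  · have hTT : ambientForm g (z, 0) T T = 0 := hT _
    simp only [map_sub, map_smul, sub_apply, smul_apply, smul_eq_mul, hTT, hsymm T (K' v₀), hv₀T]
    field_simp
    ring

end ChartInitialVelocity

/-! ### The inverse function theorem for smooth maps. -/

section InverseFunction

set_option synthInstance.maxHeartbeats 200000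
set_option linter.unusedSectionVars false

theorem ContDiffOn.isLocalDiffeomorphAt {E : Type*} [NormedAddCommGroup E] [NormedSpace ℝ E]
    [CompleteSpace E] {f : E → E} {O : Set E} (hf : ContDiffOn ℝ ∞ f O) (hO : IsOpen O) {x : E}
    (hx : x ∈ O) (hinv : (fderiv ℝ f x).IsInvertible) :
    IsLocalDiffeomorphAt 𝓘(ℝ, E) 𝓘(ℝ, E) ∞ f x := by
  obtain ⟨L, hL⟩ := hinv
  have hfx := hf.contDiffAt (hO.mem_nhds hx)
  have hd : HasFDerivAt f (L : E →L[ℝ] E) x := by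
    rw [hL]; exact (hfx.differentiableAt (by simp)).hasFDerivAt
  let e := hfx.toOpenPartialHomeomorph f hd (by simp)
  have hcont : ContinuousOn (fderiv ℝ f) O := hf.continuousOn_fderiv_of_isOpen hO (by simp)
  -- A partial diffeomorphism must have an inverse that is smooth on its whole domain, so the source
  -- is cut down to points with invertible derivative.
  have hopen : IsOpen (O ∩ fderiv ℝ f ⁻¹' range ((↑) : (E ≃L[ℝ] E) → E →L[ℝ] E)) :=
    hcont.isOpen_inter_preimage hO ContinuousLinearEquiv.isOpen
  set O' := O ∩ fderiv ℝ f ⁻¹' range ((↑) : (E ≃L[ℝ] E) → E →L[ℝ] E) with hO'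
  let e' := e.restrOpen O' hopen
  have hee : ∀ a, e' a = f a := fun a ↦ rfl
  have hsrc : e'.source = e.source ∩ O' := e.restrOpen_source O' hopen
  refine ⟨⟨e'.toPartialEquiv, e'.open_source, e'.open_target, ?_, ?_⟩, ?_, ?_⟩
  · refine contMDiffOn_iff_contDiffOn.2 (hf.mono ?_)
    intro a ha
    have ha' : a ∈ e'.source := ha
    rw [hsrc] at ha'
    exact ha'.2.1
  · refine contMDiffOn_iff_contDiffOn.2 fun b hb ↦ ?_
    have hb' : b ∈ e'.target := hb
    have h1 := e'.map_target hb'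
    rw [hsrc] at h1
    obtain ⟨L', hL'⟩ := h1.2.2
    have h2 := hf.contDiffAt (hO.mem_nhds h1.2.1)
    refine (e'.contDiffAt_symm (f₀' := L') hb' ?_ h2).contDiffWithinAt
    rw [hL']
    exact (h2.differentiableAt (by simp)).hasFDerivAt
  · change x ∈ e'.source
    rw [hsrc]
    exact ⟨hfx.mem_toOpenPartialHomeomorph_source hd (by simp), hx, ⟨L, hL⟩⟩
  · intro a _
    exact (hee a).symm

variable {F : Type*} [NormedAddCommGroup F] [NormedSpace ℝ F] [FiniteDimensional ℝ F]
  {H : Type*} [TopologicalSpace H] {I : ModelWithCorners ℝ F H} [I.Boundaryless]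
  {X : Type*} [TopologicalSpace X] [ChartedSpace H X] [IsManifold I ∞ X]

/-- The inverse function theorem on manifolds. -/
theorem ContMDiffOn.isLocalDiffeomorphAt {f : X → X} {O : Set X} (hf : ContMDiffOn I I ∞ f O)
    (hO : IsOpen O) {x : X} (hx : x ∈ O) (hinj : Function.Injective (mfderiv I I f x)) :
    IsLocalDiffeomorphAt I I ∞ f x := by
  have : CompleteSpace F := FiniteDimensional.complete ℝ F
  let κ := extChartAt I x
  let κ' := extChartAt I (f x)
  have hxs : x ∈ κ.source := mem_extChartAt_source x
  have hfxs : f x ∈ κ'.source := mem_extChartAt_source (f x)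
  have hO' : IsOpen (O ∩ f ⁻¹' κ'.source) :=
    hf.continuousOn.isOpen_inter_preimage hO (isOpen_extChartAt_source (f x))
  set O' := O ∩ f ⁻¹' κ'.source with hO'def
  have hB : IsOpen (κ.target ∩ κ.symm ⁻¹' O') := isOpen_chartDomain x hO'
  set B := κ.target ∩ κ.symm ⁻¹' O' with hBdef
  let f' : F → F := κ' ∘ (f ∘ κ.symm)
  have hf' : ContDiffOn ℝ ∞ f' B := by
    refine contMDiffOn_iff_contDiffOn.1 ?_
    exact (extChartDiffeo I (f x)).contMDiffOn_toFun.comp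
      (hf.comp ((contMDiffOn_extChartAt_symm x).mono inter_subset_left) fun e he ↦ he.2.1)
      fun e he ↦ he.2.2
  have hxB : κ x ∈ B := mem_chartDomain (S := O') hxs ⟨hx, hfxs⟩
  have hsx : κ.symm (κ x) = x := κ.left_inv hxs
  have hfd : MDifferentiableAt I I f x := (hf.contMDiffAt (hO.mem_nhds hx)).mdifferentiableAt (by simp)
  have hd : ∀ v : F, fderiv ℝ f' (κ x) v = mvfderiv I κ' (f x)
      (mfderiv I I f x (mfderiv 𝓘(ℝ, F) I κ.symm (κ x) v)) := by
    intro v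
    have h1 := (isLocalDiffeomorphAt_extChartAt_symm (I := I) (κ.map_source hxs)).mdifferentiableAt
      (by simp)
    have h2 := mfderiv_comp_of_eq (x := κ x) hfd h1 hsx
    have h3 := (isLocalDiffeomorphAt_extChartAt hfxs).mdifferentiableAt (by simp)
    have h4 : MDifferentiableAt 𝓘(ℝ, F) I (f ∘ κ.symm) (κ x) := hfd.comp_of_eq (κ x) h1 hsx
    have hfsx : (f ∘ κ.symm) (κ x) = f x := congrArg f hsx
    have h5 := mfderiv_comp_of_eq (x := κ x) h3 h4 hfsx
    have h6 : (mfderiv 𝓘(ℝ, F) 𝓘(ℝ, F) f' (κ x) : F →L[ℝ] F) = fderiv ℝ f' (κ x) :=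
      mfderiv_eq_fderiv
    rw [← h6]
    have e1 := congrArg (fun f : F →L[ℝ] F ↦ f v) h5
    have e2 := congrArg (fun f : F →L[ℝ] F ↦ f v) h2
    have k1 : ∀ x', x' = x → ∀ a : F, (mfderiv I I f x' a : F) = mfderiv I I f x a := by
      rintro _ rfl a; rfl
    have k2 : ∀ x', x' = f x → ∀ a : F, (mvfderiv I κ' x' a : F) = mvfderiv I κ' (f x) a := by
      rintro _ rfl a; rfl
    refine (Eq.trans e1 (k2 _ hfsx _)).trans ?_
    exact congrArg (fun b : F ↦ (mvfderiv I κ' (f x) b : F)) (Eq.trans e2 (k1 _ hsx _))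
  have hinv : (fderiv ℝ f' (κ x)).IsInvertible := by
    have hi : Function.Injective (fderiv ℝ f' (κ x)) := by
      rw [injective_iff_map_eq_zero]
      intro v hv
      rw [hd] at hv
      have h1 := (isLocalDiffeomorphAt_extChartAt hfxs).mfderiv_injective (hv.trans (map_zero _).symm)
      have h2 := hinj (h1.trans (map_zero _).symm)
      exact (isLocalDiffeomorphAt_extChartAt_symm (I := I) (κ.map_source hxs)).mfderiv_injective
        (Eq.trans h2 (map_zero _).symm)
    exact ⟨(LinearEquiv.ofInjectiveEndo (fderiv ℝ f' (κ x) : F →ₗ[ℝ] F) hi).toContinuousLinearEquiv,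
      rfl⟩
  have h1 := hf'.isLocalDiffeomorphAt hB hxB hinv
  have h2 : IsLocalDiffeomorphAt 𝓘(ℝ, F) I ∞ κ'.symm ((f' ∘ κ) x) := by
    refine isLocalDiffeomorphAt_extChartAt_symm ?_
    change κ' (f (κ.symm (κ x))) ∈ _
    rw [hsx]
    exact κ'.map_source hfxs
  have h3 : IsLocalDiffeomorphAt I I ∞ (κ'.symm ∘ (f' ∘ κ)) x :=
    IsLocalDiffeomorphAt.comp (hf := IsLocalDiffeomorphAt.comp
      (hf := isLocalDiffeomorphAt_extChartAt hxs) (hg := h1)) (hg := h2)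
  refine h3.congr ?_
  filter_upwards [(isOpen_extChartAt_source (I := I) x).mem_nhds hxs, hO'.mem_nhds ⟨hx, hfxs⟩]
    with x' hx' hx'O
  change f x' = κ'.symm (κ' (f (κ.symm (κ x'))))
  rw [κ.left_inv hx', κ'.left_inv hx'O.2]

end InverseFunction

/-! ### Existence of the normalizing map near a point of `P × {0}`. -/

section LocalExistence

set_option synthInstance.maxHeartbeats 200000
set_option linter.unusedSectionVars false

variable {d p q : ℕ}
  {M : Type*} [TopologicalSpace M] [ChartedSpace (EuclideanSpace ℝ (Fin d)) M]
  [IsManifold (𝓡 d) ∞ M]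
  {P : Type*} [TopologicalSpace P] [ChartedSpace (EuclideanSpace ℝ (Fin (d + 1))) P]
  [IsManifold (𝓡 (d + 1)) ∞ P] {W : WeylStructure d M P}
  {c : WeylClass d p q M} {ι : MetricBundleIso W c} {r : WeylPair d p q M} {t : P → ℝ}
  {S : Set (P × ℝ)} {g : BilinField (ambientModel d) (P × ℝ)}
  {𝒜 : ∀ y : P × ℝ, TangentSpace (ambientModel d) y → TangentSpace (ambientModel d) y}

/-- On the open set `O`, the map `ψ` is a local diffeomorphism into `S`, the curves `ρ ↦ ψ (z, ρ)`
have the prescribed acceleration, and along `P × {0}` the pullback of `g` is in Weyl-normal form. -/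
structure IsNormalizing (W : WeylStructure d M P) (t : P → ℝ) (a : CovectorField (𝓡 d) M)
    (S : Set (P × ℝ)) (g : BilinField (ambientModel d) (P × ℝ))
    (𝒜 : ∀ y : P × ℝ, TangentSpace (ambientModel d) y → TangentSpace (ambientModel d) y)
    (ψ : P × ℝ → P × ℝ) (O : Set (P × ℝ)) : Prop where
  isOpen : IsOpen O
  localDiffeo : IsLocalDiffeomorphOn (ambientModel d) (ambientModel d) ∞ ψ O
  mapsTo : MapsTo ψ O S
  id_zero : ∀ z, (z, (0 : ℝ)) ∈ O → ψ (z, 0) = (z, 0)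
  initial : ∀ z, (z, (0 : ℝ)) ∈ O → IsInitialVelocity W t a g z (ambientDeriv ψ (z, 0) (unitU d))
  solves : ∀ y ∈ O, ∀ x₀, ψ y ∈ (extChartAt (ambientModel d) x₀).source →
    SolvesAt g 𝒜 x₀ (fun σ ↦ ψ (y.1, σ)) y.2

theorem IsNormalizing.mono {a : CovectorField (𝓡 d) M} {ψ : P × ℝ → P × ℝ} {O O' : Set (P × ℝ)}
    (h : IsNormalizing W t a S g 𝒜 ψ O) (hO' : IsOpen O') (hsub : O' ⊆ O) :
    IsNormalizing W t a S g 𝒜 ψ O' where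
  isOpen := hO'
  localDiffeo := fun x ↦ h.localDiffeo ⟨x, hsub x.2⟩
  mapsTo := fun _ hx ↦ h.mapsTo (hsub hx)
  id_zero := fun z hz ↦ h.id_zero z (hsub hz)
  initial := fun z hz ↦ h.initial z (hsub hz)
  solves := fun y hy ↦ h.solves y (hsub hy)

theorem ambientDeriv_unitU_comp {f : AmbientSpace d → P × ℝ} {c : P × ℝ → AmbientSpace d}
    {z : P} {ρ : ℝ} (hf : MDifferentiableAt 𝓘(ℝ, AmbientSpace d) (ambientModel d) f (c (z, ρ)))
    (hc : MDifferentiableAt (ambientModel d) 𝓘(ℝ, AmbientSpace d) c (z, ρ)) :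
    ambientDeriv (f ∘ c) (z, ρ) (unitU d) = mfderiv 𝓘(ℝ, AmbientSpace d) (ambientModel d) f (c (z, ρ))
      (deriv (fun σ ↦ c (z, σ)) ρ) := by
  have h1 := congrArg (fun f : AmbientSpace d →L[ℝ] AmbientSpace d ↦ f (unitU d))
    (mfderiv_comp (z, ρ) hf hc)
  refine Eq.trans h1 ?_
  have h2 : (mvfderiv (ambientModel d) c (z, ρ) (unitU d) : AmbientSpace d)
      = deriv (fun σ ↦ c (z, σ)) ρ := by
    rw [(hasDerivAt_slice hc).deriv]
    exact congrArg (fun v : AmbientSpace d ↦ (mvfderiv (ambientModel d) c (z, ρ) v : AmbientSpace d))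
      (ambientU_eq (z, ρ)).symm
  exact congrArg (fun v : AmbientSpace d ↦
    (mfderiv 𝓘(ℝ, AmbientSpace d) (ambientModel d) f (c (z, ρ)) v : AmbientSpace d)) h2

theorem injective_of_apply_unitU (L : AmbientSpace d →L[ℝ] AmbientSpace d)
    (h1 : ∀ w : EuclideanSpace ℝ (Fin (d + 1)), L (w, 0) = (w, 0)) (h2 : (L (unitU d)).2 ≠ 0) :
    Function.Injective L := by
  rw [injective_iff_map_eq_zero]
  rintro ⟨w, ρ⟩ hv
  have h3 : ((w, ρ) : AmbientSpace d) = (w, 0) + ρ • unitU d := by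
    refine Prod.ext ?_ ?_
    · change w = w + ρ • (0 : EuclideanSpace ℝ (Fin (d + 1)))
      simp
    · change ρ = 0 + ρ * 1
      ring
  rw [h3, map_add, map_smul, h1] at hv
  have h4 : (0 : ℝ) + ρ * (L (unitU d)).2 = 0 := congrArg Prod.snd hv
  have h5 : ρ = 0 := by simpa [h2] using h4
  subst h5
  have h6 : w + (0 : ℝ) • (L (unitU d)).1 = 0 := congrArg Prod.fst hv
  have h7 : w = 0 := by simpa using h6
  rw [h7]
  rfl

/-- The curves are obtained by flowing, in the chart at `(z₀, 0)`, from the slice with the initial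
velocity found above. Smooth dependence makes the family a smooth map, and transversality makes it a
local diffeomorphism at `(z₀, 0)`. -/
theorem exists_isNormalizing_nhds (ht : IsFibreCoordinate W ι.form r.g t)
    (hS : IsWeylPreAmbient ι S g) (h𝒜 : IsAccelerationLaw W S g 𝒜) (z₀ : P) :
    ∃ ψ O, IsNormalizing W t r.a S g 𝒜 ψ O ∧ (z₀, (0 : ℝ)) ∈ O := by
  set x₀ : P × ℝ := (z₀, 0) with hx₀
  set κ := extChartAt (ambientModel d) x₀ with hκ
  set Ω := chartDomain (ambientModel d) x₀ S with hΩ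
  have hΩo : IsOpen Ω := isOpen_chartDomain x₀ hS.isOpen
  set V := chartInitialVelocity W t r.a g x₀ with hV
  have hVs : ContDiffOn ℝ ∞ V Ω := contDiffOn_chartInitialVelocity ht hS x₀
  -- The equation as a first order system for position and velocity.
  let f : AmbientSpace d × AmbientSpace d → AmbientSpace d × AmbientSpace d :=
    fun y ↦ (y.2, chartAcceleration g 𝒜 x₀ y)
  have hf : ContDiffOn ℝ ∞ f (Ω ×ˢ univ) :=
    contDiffOn_snd.prodMk (contDiffOn_chartAcceleration hS.isOpen hS.metric h𝒜.smooth x₀)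
  -- The initial data over `z`.
  let j : P → AmbientSpace d × AmbientSpace d := fun z ↦ (κ (z, 0), V (κ (z, 0)))
  have hx₀s : x₀ ∈ κ.source := mem_extChartAt_source x₀
  have hmem : ∀ z, (z, (0 : ℝ)) ∈ κ.source → κ (z, 0) ∈ Ω := fun z hz ↦
    mem_chartDomain hz (hS.zero_mem z)
  obtain ⟨ε, hε, Φ, hΦ, hΦ0, hΦρ⟩ := exists_smooth_local_flow (hΩo.prod isOpen_univ) hf
    (x₀ := j z₀) ⟨hmem z₀ hx₀s, mem_univ _⟩
  set Z₀ : Set P := {z | (z, (0 : ℝ)) ∈ κ.source} with hZ₀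
  have hZ₀o : IsOpen Z₀ := (isOpen_extChartAt_source x₀).preimage (Continuous.prodMk_left (0 : ℝ))
  have hκs : ContMDiffOn (𝓡 (d + 1)) 𝓘(ℝ, AmbientSpace d) ∞ (fun z : P ↦ κ (z, 0)) Z₀ :=
    (extChartDiffeo (ambientModel d) x₀).contMDiffOn_toFun.comp
      (contMDiff_id.prodMk contMDiff_const).contMDiffOn fun z hz ↦ hz
  have hj : ContMDiffOn (𝓡 (d + 1)) 𝓘(ℝ, AmbientSpace d × AmbientSpace d) ∞ j Z₀ :=
    hκs.prodMk_space ((contMDiffOn_iff_contDiffOn.2 hVs).comp hκs fun z hz ↦ hmem z hz)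
  have hZ₁o : IsOpen (Z₀ ∩ j ⁻¹' Metric.ball (j z₀) ε) :=
    hj.continuousOn.isOpen_inter_preimage hZ₀o Metric.isOpen_ball
  set Z₁ := Z₀ ∩ j ⁻¹' Metric.ball (j z₀) ε with hZ₁
  set N : Set (P × ℝ) := Z₁ ×ˢ Metric.ball (0 : ℝ) ε with hN
  have hNo : IsOpen N := hZ₁o.prod Metric.isOpen_ball
  let cv : P × ℝ → AmbientSpace d := fun y ↦ (Φ (j y.1, y.2)).1
  have hcv : ContMDiffOn (ambientModel d) 𝓘(ℝ, AmbientSpace d) ∞ cv N := by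
    have h1 : ContMDiffOn (ambientModel d) 𝓘(ℝ, (AmbientSpace d × AmbientSpace d) × ℝ) ∞
        (fun y : P × ℝ ↦ (j y.1, y.2)) N :=
      (hj.comp contMDiffOn_fst fun y hy ↦ hy.1.1).prodMk_space contMDiffOn_snd
    have h2 : ContDiffOn ℝ ∞ (fun y ↦ (Φ y).1) (Metric.ball (j z₀) ε ×ˢ Metric.ball (0 : ℝ) ε) :=
      contDiff_fst.comp_contDiffOn hΦ
    exact (contMDiffOn_iff_contDiffOn.2 h2).comp h1 fun y hy ↦ ⟨hy.1.2, hy.2⟩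
  have hcvΩ : ∀ y ∈ N, cv y ∈ Ω := fun y hy ↦ (hΦρ _ hy.1.2 _ hy.2).1.1
  have hcv1 : ∀ z ∈ Z₁, ∀ ρ ∈ Metric.ball (0 : ℝ) ε,
      HasDerivAt (fun σ ↦ cv (z, σ)) (Φ (j z, ρ)).2 ρ := fun z hz ρ hρ ↦
    (ContinuousLinearMap.fst ℝ (AmbientSpace d) (AmbientSpace d)).hasFDerivAt.comp_hasDerivAt ρ
      (hΦρ _ hz.2 ρ hρ).2
  have hcv2 : ∀ z ∈ Z₁, ∀ ρ ∈ Metric.ball (0 : ℝ) ε,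
      HasDerivAt (fun σ ↦ (Φ (j z, σ)).2) (chartAcceleration g 𝒜 x₀ (Φ (j z, ρ))) ρ :=
    fun z hz ρ hρ ↦
    (ContinuousLinearMap.snd ℝ (AmbientSpace d) (AmbientSpace d)).hasFDerivAt.comp_hasDerivAt ρ
      (hΦρ _ hz.2 ρ hρ).2
  let ψ : P × ℝ → P × ℝ := κ.symm ∘ cv
  have hψ : ContMDiffOn (ambientModel d) (ambientModel d) ∞ ψ N :=
    (contMDiffOn_extChartAt_symm x₀).comp hcv fun y hy ↦ (hcvΩ y hy).1
  have hψS : MapsTo ψ N S := fun y hy ↦ (hcvΩ y hy).2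
  have hκψ : ∀ y ∈ N, κ (ψ y) = cv y := fun y hy ↦ κ.right_inv (hcvΩ y hy).1
  have hψsrc : ∀ y ∈ N, ψ y ∈ κ.source := fun y hy ↦ κ.map_target (hcvΩ y hy).1
  have h0ε : (0 : ℝ) ∈ Metric.ball (0 : ℝ) ε := Metric.mem_ball_self hε
  have hcv0 : ∀ z ∈ Z₁, cv (z, 0) = κ (z, 0) := fun z hz ↦ congrArg Prod.fst (hΦ0 _ hz.2)
  have hψ0 : ∀ z ∈ Z₁, ψ (z, 0) = (z, 0) := fun z hz ↦
    (congrArg κ.symm (hcv0 z hz)).trans (κ.left_inv hz.1)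
  have hinit : ∀ z ∈ Z₁, IsInitialVelocity W t r.a g z (ambientDeriv ψ (z, 0) (unitU d)) := by
    intro z hz
    have hzN : (z, (0 : ℝ)) ∈ N := ⟨hz, h0ε⟩
    have h1 := ambientDeriv_unitU_comp (f := κ.symm) (c := cv) (z := z) (ρ := 0)
      ((isLocalDiffeomorphAt_extChartAt_symm (hcvΩ _ hzN).1).mdifferentiableAt (by simp))
      ((hcv.contMDiffAt (hNo.mem_nhds hzN)).mdifferentiableAt (by simp))
    have h4 : deriv (fun σ ↦ cv (z, σ)) 0 = V (κ (z, 0)) := by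
      rw [(hcv1 z hz 0 h0ε).deriv, hΦ0 _ hz.2]
    have h5 : ∀ e, e = κ (z, 0) → ∀ v, v = V (κ (z, 0)) →
        (mfderiv 𝓘(ℝ, AmbientSpace d) (ambientModel d) κ.symm e v : AmbientSpace d)
          = mfderiv 𝓘(ℝ, AmbientSpace d) (ambientModel d) κ.symm (κ (z, 0)) (V (κ (z, 0))) := by
      rintro _ rfl _ rfl; rfl
    have h2 := isInitialVelocity_chartInitialVelocity ht hS (x₀ := x₀) hz.1
    have h3 : ambientDeriv ψ (z, 0) (unitU d) = _ := h1.trans (h5 _ (hcv0 z hz) _ h4)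
    rw [h3]
    exact h2
  have hz₀ : z₀ ∈ Z₁ := ⟨hx₀s, Metric.mem_ball_self hε⟩
  have hx₀N : x₀ ∈ N := ⟨hz₀, h0ε⟩
  have hld : IsLocalDiffeomorphAt (ambientModel d) (ambientModel d) ∞ ψ x₀ := by
    refine hψ.isLocalDiffeomorphAt hNo hx₀N ?_
    -- The differential is the identity on the slice and maps `∂_ρ` to a vector transverse to it.
    refine injective_of_apply_unitU (ambientDeriv ψ x₀) (fun w ↦ ?_) ((hinit z₀ hz₀).snd_ne_zero ht hS)
    refine ambientDeriv_of_eq_zeroSlice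
      ((hψ.contMDiffAt (hNo.mem_nhds hx₀N)).mdifferentiableAt (by simp)) ?_ w
    filter_upwards [hZ₁o.mem_nhds hz₀] with z hz
    exact hψ0 z hz
  obtain ⟨O, hO, hOo, hxO⟩ := eventually_nhds_iff.1 (hld.eventually.and (hNo.mem_nhds hx₀N))
  refine ⟨ψ, O, ⟨hOo, fun x ↦ (hO x x.2).1, fun x hx ↦ hψS (hO x hx).2,
    fun z hz ↦ hψ0 z (hO _ hz).2.1, fun z hz ↦ hinit z (hO _ hz).2.1, fun y hy x₁ hx₁ ↦ ?_⟩, hxO⟩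
  have hyN : y ∈ N := (hO y hy).2
  -- The equation is known in the chart of the construction only; the other charts follow by
  -- invariance.
  refine SolvesAt.change_chart hS.isOpen hS.metric (hO y hy).1 (hψsrc y hyN) hx₁ (hψS hyN) ?_
  have h1 : (κ ∘ fun σ ↦ ψ (y.1, σ)) =ᶠ[𝓝 y.2] fun σ ↦ cv (y.1, σ) := by
    filter_upwards [Metric.isOpen_ball.mem_nhds hyN.2] with σ hσ
    exact hκψ (y.1, σ) ⟨hyN.1, hσ⟩
  have h2 : deriv (κ ∘ fun σ ↦ ψ (y.1, σ)) =ᶠ[𝓝 y.2] fun σ ↦ (Φ (j y.1, σ)).2 := by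
    filter_upwards [h1.deriv, Metric.isOpen_ball.mem_nhds hyN.2] with σ hσ hσ'
    rw [hσ, (hcv1 y.1 hyN.1 σ hσ').deriv]
  unfold SolvesAt
  rw [h2.deriv_eq, h2.self_of_nhds, (hcv2 y.1 hyN.1 y.2 hyN.2).deriv]
  have h3 : κ (ψ (y.1, y.2)) = (Φ (j y.1, y.2)).1 := hκψ y hyN
  change _ = chartAcceleration g 𝒜 x₀ (κ (ψ (y.1, y.2)), _)
  rw [h3]

end LocalExistence

/-! ### Uniqueness of the normalizing map along segments. -/

section Uniqueness

set_option synthInstance.maxHeartbeats 200000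
set_option linter.unusedSectionVars false

variable {d p q : ℕ}
  {M : Type*} [TopologicalSpace M] [ChartedSpace (EuclideanSpace ℝ (Fin d)) M]
  [IsManifold (𝓡 d) ∞ M]
  {P : Type*} [TopologicalSpace P] [ChartedSpace (EuclideanSpace ℝ (Fin (d + 1))) P]
  [IsManifold (𝓡 (d + 1)) ∞ P] {W : WeylStructure d M P}
  {c : WeylClass d p q M} {ι : MetricBundleIso W c} {r : WeylPair d p q M} {t : P → ℝ}
  {S : Set (P × ℝ)} {g : BilinField (ambientModel d) (P × ℝ)}
  {𝒜 : ∀ y : P × ℝ, TangentSpace (ambientModel d) y → TangentSpace (ambientModel d) y}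
  {a : CovectorField (𝓡 d) M} {ψ ψ' : P × ℝ → P × ℝ} {O O' : Set (P × ℝ)}

theorem IsNormalizing.continuousAt (h : IsNormalizing W t a S g 𝒜 ψ O) {y : P × ℝ} (hy : y ∈ O) :
    ContinuousAt ψ y := IsLocalDiffeomorphAt.continuousAt (h.localDiffeo ⟨y, hy⟩)

theorem IsNormalizing.continuousAt_slice (h : IsNormalizing W t a S g 𝒜 ψ O) {z : P} {ρ : ℝ}
    (hy : (z, ρ) ∈ O) : ContinuousAt (fun σ ↦ ψ (z, σ)) ρ :=
  ContinuousAt.comp (g := ψ) (f := fun σ ↦ (z, σ)) (h.continuousAt hy)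
    (Continuous.prodMk_right z).continuousAt

theorem IsNormalizing.isLocalDiffeomorphAt_chart (h : IsNormalizing W t a S g 𝒜 ψ O)
    {y x₀ : P × ℝ} (hy : y ∈ O) (hx₀ : ψ y ∈ (extChartAt (ambientModel d) x₀).source) :
    IsLocalDiffeomorphAt (ambientModel d) 𝓘(ℝ, AmbientSpace d) ∞
      (extChartAt (ambientModel d) x₀ ∘ ψ) y :=
  IsLocalDiffeomorphAt.comp (hf := h.localDiffeo ⟨y, hy⟩) (hg := isLocalDiffeomorphAt_extChartAt hx₀)

theorem IsNormalizing.hasDerivAt (h : IsNormalizing W t a S g 𝒜 ψ O) {z : P} {ρ : ℝ}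
    (hy : (z, ρ) ∈ O) {x₀ : P × ℝ} (hx₀ : ψ (z, ρ) ∈ (extChartAt (ambientModel d) x₀).source) :
    HasDerivAt (fun σ ↦ (extChartAt (ambientModel d) x₀ (ψ (z, σ)),
        deriv (fun σ ↦ extChartAt (ambientModel d) x₀ (ψ (z, σ))) σ))
      (deriv (fun σ ↦ extChartAt (ambientModel d) x₀ (ψ (z, σ))) ρ,
        chartAcceleration g 𝒜 x₀ (extChartAt (ambientModel d) x₀ (ψ (z, ρ)),
          deriv (fun σ ↦ extChartAt (ambientModel d) x₀ (ψ (z, σ))) ρ)) ρ := by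
  have hχ := h.isLocalDiffeomorphAt_chart hy hx₀
  refine (hasDerivAt_slice (hχ.mdifferentiableAt (by simp))).differentiableAt.hasDerivAt.prodMk ?_
  have h1 := ((hasDerivAt_slice (hχ.mdifferentiableAt_components
    (mdifferentiableAt_ambientU (z, ρ)))).congr_of_eventuallyEq (deriv_slice hχ))
  have h2 := h1.differentiableAt.hasDerivAt
  rw [show deriv (deriv fun σ ↦ (extChartAt (ambientModel d) x₀ ∘ ψ) (z, σ)) ρ = _ from
    h.solves (z, ρ) hy x₀ hx₀] at h2
  exact h2

theorem IsNormalizing.deriv_chart (h : IsNormalizing W t a S g 𝒜 ψ O) {z : P} {ρ : ℝ}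
    (hy : (z, ρ) ∈ O) {x₀ : P × ℝ} (hx₀ : ψ (z, ρ) ∈ (extChartAt (ambientModel d) x₀).source) :
    deriv (fun σ ↦ extChartAt (ambientModel d) x₀ (ψ (z, σ))) ρ
      = mvfderiv (ambientModel d) (extChartAt (ambientModel d) x₀) (ψ (z, ρ))
        (ambientDeriv ψ (z, ρ) (unitU d)) := by
  have hχ := h.isLocalDiffeomorphAt_chart hy hx₀
  refine (hasDerivAt_slice (hχ.mdifferentiableAt (by simp))).deriv.trans ?_
  refine (mvfderiv_extChartAt_comp
    (IsLocalDiffeomorphAt.mdifferentiableAt (h.localDiffeo ⟨_, hy⟩) (by simp)) hx₀ _).trans ?_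
  have h1 := congrArg (ambientDeriv ψ (z, ρ)) (ambientU_eq (d := d) (z, ρ))
  exact congrArg (fun v : AmbientSpace d ↦ (mvfderiv (ambientModel d)
    (extChartAt (ambientModel d) x₀) (ψ (z, ρ)) v : AmbientSpace d)) h1

/-- Position and velocity of both curves solve the same first order system with equal values at `ρ`,
and the system is smooth, hence Lipschitz near these values. -/
theorem IsNormalizing.eventuallyEq_of_deriv_eq (hS : IsWeylPreAmbient ι S g)
    (h𝒜 : IsAccelerationLaw W S g 𝒜)
    (h : IsNormalizing W t a S g 𝒜 ψ O) (h' : IsNormalizing W t a S g 𝒜 ψ' O') {z : P} {ρ : ℝ}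
    (hy : (z, ρ) ∈ O) (hy' : (z, ρ) ∈ O') (he : ψ (z, ρ) = ψ' (z, ρ)) {x₀ : P × ℝ}
    (hx₀ : ψ (z, ρ) ∈ (extChartAt (ambientModel d) x₀).source)
    (hd : deriv (fun σ ↦ extChartAt (ambientModel d) x₀ (ψ (z, σ))) ρ
      = deriv (fun σ ↦ extChartAt (ambientModel d) x₀ (ψ' (z, σ))) ρ) :
    (fun σ ↦ ψ (z, σ)) =ᶠ[𝓝 ρ] fun σ ↦ ψ' (z, σ) := by
  set κ := extChartAt (ambientModel d) x₀ with hκ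
  let f : AmbientSpace d × AmbientSpace d → AmbientSpace d × AmbientSpace d :=
    fun y ↦ (y.2, chartAcceleration g 𝒜 x₀ y)
  have hf : ContDiffOn ℝ ∞ f (chartDomain (ambientModel d) x₀ S ×ˢ univ) :=
    contDiffOn_snd.prodMk (contDiffOn_chartAcceleration hS.isOpen hS.metric h𝒜.smooth x₀)
  set y₀ : AmbientSpace d × AmbientSpace d := (κ (ψ (z, ρ)), deriv (fun σ ↦ κ (ψ (z, σ))) ρ) with hy₀
  have hfy : ContDiffAt ℝ 1 f y₀ := (hf.contDiffAt (((isOpen_chartDomain x₀ hS.isOpen).prod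
    isOpen_univ).mem_nhds ⟨mem_chartDomain hx₀ (h.mapsTo hy), mem_univ _⟩)).of_le (by simp)
  obtain ⟨K, s, hs, hK⟩ := hfy.exists_lipschitzOnWith
  have hev : ∀ {ψ₁ : P × ℝ → P × ℝ} {O₁ : Set (P × ℝ)}, IsNormalizing W t a S g 𝒜 ψ₁ O₁ →
      (z, ρ) ∈ O₁ → ψ₁ (z, ρ) ∈ κ.source →
      (κ (ψ₁ (z, ρ)), deriv (fun σ ↦ κ (ψ₁ (z, σ))) ρ) = y₀ →
      (∀ᶠ σ in 𝓝 ρ, ψ₁ (z, σ) ∈ κ.source) ∧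
      ∀ᶠ σ in 𝓝 ρ, HasDerivAt (fun σ ↦ (κ (ψ₁ (z, σ)), deriv (fun σ ↦ κ (ψ₁ (z, σ))) σ))
        (f (κ (ψ₁ (z, σ)), deriv (fun σ ↦ κ (ψ₁ (z, σ))) σ)) σ ∧
        (κ (ψ₁ (z, σ)), deriv (fun σ ↦ κ (ψ₁ (z, σ))) σ) ∈ s := by
    intro ψ₁ O₁ h₁ hz₁ hs₁ hy₁
    have e1 : ∀ᶠ σ in 𝓝 ρ, ψ₁ (z, σ) ∈ κ.source :=
      (h₁.continuousAt_slice hz₁).preimage_mem_nhds ((isOpen_extChartAt_source x₀).mem_nhds hs₁)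
    have e2 : ∀ᶠ σ in 𝓝 ρ, (z, σ) ∈ O₁ :=
      (Continuous.prodMk_right z).continuousAt.preimage_mem_nhds (h₁.isOpen.mem_nhds hz₁)
    have e3 : ∀ᶠ σ in 𝓝 ρ, (κ (ψ₁ (z, σ)), deriv (fun σ ↦ κ (ψ₁ (z, σ))) σ) ∈ s := by
      refine (h₁.hasDerivAt hz₁ hs₁).continuousAt.preimage_mem_nhds ?_
      rw [hy₁]
      exact hs
    refine ⟨e1, ?_⟩
    filter_upwards [e1, e2, e3] with σ hσ1 hσ2 hσ3
    exact ⟨h₁.hasDerivAt hσ2 hσ1, hσ3⟩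
  have hy₀' : (κ (ψ' (z, ρ)), deriv (fun σ ↦ κ (ψ' (z, σ))) ρ) = y₀ := by rw [hy₀, ← he, ← hd]
  obtain ⟨hs1, hd1⟩ := hev h hy hx₀ rfl
  obtain ⟨hs2, hd2⟩ := hev h' hy' (he ▸ hx₀) hy₀'
  have huniq := ODE_solution_unique_of_eventually (v := fun _ ↦ f) (s := fun _ ↦ s) (K := K)
    (Filter.Eventually.of_forall fun _ ↦ hK) hd1 hd2 hy₀'.symm
  filter_upwards [huniq, hs1, hs2] with σ h1 h2 h3
  exact κ.injOn h2 h3 (congrArg Prod.fst h1)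

/-- The normalizing map is unique on segments that start on `P × {0}`. -/
theorem IsNormalizing.eq_of_segment [T2Space P] (ht : IsFibreCoordinate W ι.form r.g t)
    (hS : IsWeylPreAmbient ι S g) (h𝒜 : IsAccelerationLaw W S g 𝒜)
    (h : IsNormalizing W t a S g 𝒜 ψ O) (h' : IsNormalizing W t a S g 𝒜 ψ' O') {z : P} {ρ : ℝ}
    (hy : ∀ σ ∈ uIcc 0 ρ, (z, σ) ∈ O) (hy' : ∀ σ ∈ uIcc 0 ρ, (z, σ) ∈ O') :
    ψ (z, ρ) = ψ' (z, ρ) := by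
  -- Agreement near `σ`, rather than at `σ`, makes this set open and gives equality of velocities
  -- too.
  set u : Set ℝ := {σ | (fun σ ↦ ψ (z, σ)) =ᶠ[𝓝 σ] fun σ ↦ ψ' (z, σ)} with hu
  have huo : IsOpen u := isOpen_setOfPred_eventually_nhds
  have h0 : (0 : ℝ) ∈ uIcc 0 ρ := left_mem_uIcc
  have h0u : (0 : ℝ) ∈ u := by
    have e1 := h.id_zero z (hy 0 h0)
    have e2 := h'.id_zero z (hy' 0 h0)
    have e3 : ψ (z, 0) ∈ (extChartAt (ambientModel d) (z, (0 : ℝ))).source := by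
      rw [e1]; exact mem_extChartAt_source _
    have e4 : ψ' (z, 0) ∈ (extChartAt (ambientModel d) (z, (0 : ℝ))).source := by
      rw [e2]; exact mem_extChartAt_source _
    -- At `ρ = 0` both velocities are initial velocities at `z`, of which there is only one.
    refine h.eventuallyEq_of_deriv_eq hS h𝒜 h' (hy 0 h0) (hy' 0 h0) (e1.trans e2.symm) e3 ?_
    rw [h.deriv_chart (hy 0 h0) e3, h'.deriv_chart (hy' 0 h0) e4,
      (h.initial z (hy 0 h0)).unique ht hS (h'.initial z (hy' 0 h0)), e1, e2]
  have hsub : uIcc 0 ρ ⊆ u := by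
    -- At a limit of points of agreement, positions and velocities agree by continuity and the
    -- Hausdorff property, and local uniqueness continues the agreement past it.
    refine isPreconnected_uIcc.subset_of_closure_inter_subset huo ⟨0, h0, h0u⟩ ?_
    rintro σ ⟨hσ, hσI⟩
    have hc := h.continuousAt_slice (hy σ hσI)
    have hc' := h'.continuousAt_slice (hy' σ hσI)
    have hfreq : ∃ᶠ τ in 𝓝 σ, τ ∈ u := mem_closure_iff_frequently.1 hσ
    have e : ψ (z, σ) = ψ' (z, σ) := by
      by_contra hne
      obtain ⟨v, v', hv, hv', hm, hm', hdisj⟩ := t2_separation hne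
      obtain ⟨τ, hτ, hτ1, hτ2⟩ := (hfreq.and_eventually
        ((hc.eventually (hv.mem_nhds hm)).and (hc'.eventually (hv'.mem_nhds hm')))).exists
      exact Set.disjoint_left.1 hdisj hτ1 ((Filter.EventuallyEq.eq_of_nhds hτ) ▸ hτ2)
    have hx₀ : ψ (z, σ) ∈ (extChartAt (ambientModel d) (ψ (z, σ))).source := mem_extChartAt_source _
    refine h.eventuallyEq_of_deriv_eq hS h𝒜 h' (hy σ hσI) (hy' σ hσI) e hx₀ ?_
    have k1 := (h.hasDerivAt (hy σ hσI) hx₀).continuousAt.snd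
    have k2 := (h'.hasDerivAt (hy' σ hσI) (x₀ := ψ (z, σ)) (by rw [← e]; exact hx₀)).continuousAt.snd
    by_contra hne
    obtain ⟨v, v', hv, hv', hm, hm', hdisj⟩ := t2_separation hne
    obtain ⟨τ, hτ, hτ1, hτ2⟩ := (hfreq.and_eventually
      ((k1.eventually (hv.mem_nhds hm)).and (k2.eventually (hv'.mem_nhds hm')))).exists
    have hτ' : (fun σ' ↦ extChartAt (ambientModel d) (ψ (z, σ)) (ψ (z, σ'))) =ᶠ[𝓝 τ]
        fun σ' ↦ extChartAt (ambientModel d) (ψ (z, σ)) (ψ' (z, σ')) := by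
      filter_upwards [hτ] with σ' hσ'
      exact congrArg _ hσ'
    refine Set.disjoint_left.1 hdisj hτ1 ?_
    have hτ3 := hτ'.deriv_eq
    change deriv (fun σ' ↦ extChartAt (ambientModel d) (ψ (z, σ)) (ψ (z, σ'))) τ ∈ v'
    rw [hτ3]
    exact hτ2
  have h1 : (fun σ ↦ ψ (z, σ)) =ᶠ[𝓝 ρ] fun σ ↦ ψ' (z, σ) := hsub right_mem_uIcc
  exact h1.eq_of_nhds

end Uniqueness

/-! ### Gluing the local normalizing maps; equivariance. -/

section Gluing

set_option synthInstance.maxHeartbeats 200000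
set_option linter.unusedSectionVars false

variable {d p q : ℕ}
  {M : Type*} [TopologicalSpace M] [ChartedSpace (EuclideanSpace ℝ (Fin d)) M]
  [IsManifold (𝓡 d) ∞ M]
  {P : Type*} [TopologicalSpace P] [ChartedSpace (EuclideanSpace ℝ (Fin (d + 1))) P]
  [IsManifold (𝓡 (d + 1)) ∞ P] {W : WeylStructure d M P}
  {c : WeylClass d p q M} {ι : MetricBundleIso W c} {r : WeylPair d p q M} {t : P → ℝ}
  {S : Set (P × ℝ)} {g : BilinField (ambientModel d) (P × ℝ)}
  {𝒜 : ∀ y : P × ℝ, TangentSpace (ambientModel d) y → TangentSpace (ambientModel d) y}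
  {a : CovectorField (𝓡 d) M} {ψ ψ' : P × ℝ → P × ℝ} {O O' : Set (P × ℝ)}

theorem ambientDeriv_ambientδ_unitU {s : ℝ} (hs : 0 < s) (y : P × ℝ) :
    ambientDeriv (ambientδ W s) y (unitU d) = unitU d := by
  have h1 : MDifferentiableAt 𝓘(ℝ, ℝ) (ambientModel d) (fun σ : ℝ ↦ (y.1, σ)) y.2 :=
    mdifferentiableAt_const.prodMk mdifferentiableAt_id
  have h2 : mfderiv 𝓘(ℝ, ℝ) (ambientModel d) (fun σ : ℝ ↦ (W.δ s y.1, σ)) y.2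
      = (mfderiv (ambientModel d) (ambientModel d) (ambientδ W s) y).comp
        (mfderiv 𝓘(ℝ, ℝ) (ambientModel d) (fun σ : ℝ ↦ (y.1, σ)) y.2) :=
    mfderiv_comp y.2 (mdifferentiableAt_ambientδ hs y) h1
  have h3 := congrArg (fun f : ℝ →L[ℝ] AmbientSpace d ↦ f 1) h2
  have h4 := congrArg (ambientDeriv (ambientδ W s) y) (ambientU_eq (d := d) y)
  exact (h4.symm.trans h3.symm).trans (ambientU_eq (d := d) (ambientδ W s y))

/-- The dilatation is a homothety of `g` with factor `s²` that preserves `𝒜`, so it preserves the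
equation, and initial velocities are mapped to initial velocities. Together with uniqueness this
makes the glued map equivariant. -/
theorem IsNormalizing.dilate (ht : IsFibreCoordinate W ι.form r.g t)
    (hS : IsWeylPreAmbient ι S g) (h𝒜 : IsAccelerationLaw W S g 𝒜)
    (h : IsNormalizing W t a S g 𝒜 ψ O) {s : ℝ} (hs : 0 < s) :
    IsNormalizing W t a S g 𝒜 (fun y ↦ ambientδ W s (ψ (ambientδ W s⁻¹ y)))
      (ambientδ W s⁻¹ ⁻¹' O) where
  isOpen := h.isOpen.preimage (contMDiff_ambientδ (inv_pos.2 hs)).continuous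
  localDiffeo := fun x ↦ IsLocalDiffeomorphAt.comp
    (hf := IsLocalDiffeomorphAt.comp (hf := isLocalDiffeomorph_ambientδ (inv_pos.2 hs) x.1)
      (hg := h.localDiffeo ⟨_, x.2⟩)) (hg := isLocalDiffeomorph_ambientδ hs _)
  mapsTo := fun y hy ↦ hS.invariant s hs _ (h.mapsTo hy)
  id_zero := by
    intro z hz
    have h1 : ψ (ambientδ W s⁻¹ (z, 0)) = ambientδ W s⁻¹ (z, 0) := h.id_zero _ hz
    rw [h1, ambientδ_ambientδ_inv hs]
  initial := by
    intro z hz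
    have h1 := (h.initial _ hz).dilate ht hS hs
    have hψd : MDifferentiableAt (ambientModel d) (ambientModel d) ψ (ambientδ W s⁻¹ (z, 0)) :=
      IsLocalDiffeomorphAt.mdifferentiableAt (h.localDiffeo ⟨_, hz⟩) (by simp)
    have hδ := mdifferentiableAt_ambientδ (W := W) (inv_pos.2 hs) (z, (0 : ℝ))
    have e1 : ambientDeriv (fun y ↦ ambientδ W s (ψ (ambientδ W s⁻¹ y))) (z, 0) (unitU d)
        = ambientDeriv (ambientδ W s) (ψ (ambientδ W s⁻¹ (z, 0)))
          (ambientDeriv ψ (ambientδ W s⁻¹ (z, 0)) (unitU d)) := by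
      refine (ambientDeriv_comp (f := ambientδ W s) (h := ψ ∘ ambientδ W s⁻¹)
        (mdifferentiableAt_ambientδ hs _) (hψd.comp _ hδ) _).trans ?_
      refine congrArg _ ((ambientDeriv_comp hψd hδ _).trans ?_)
      rw [ambientDeriv_ambientδ_unitU (inv_pos.2 hs)]
    have e2 : ψ (ambientδ W s⁻¹ (z, 0)) = (W.δ s⁻¹ z, 0) := h.id_zero _ hz
    rw [e1, e2]
    have key : ∀ z', z' = z → ∀ v, IsInitialVelocity W t a g z' v → IsInitialVelocity W t a g z v := by
      rintro _ rfl v hv; exact hv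
    exact key _ (W.δ_δ_inv hs z) _ h1
  solves := by
    intro y hy x₁ hx₁
    exact SolvesAt.comp_homothety (y := ambientδ W s⁻¹ y) hS.isOpen hS.metric (h.localDiffeo ⟨_, hy⟩)
      (fun x ↦ isLocalDiffeomorph_ambientδ hs x.1) (fun x hx ↦ hS.invariant s hs x hx)
      (pow_pos hs 2).ne' (hS.homogeneous s hs) (h𝒜.invariant s hs)
      (mem_extChartAt_source _) hx₁ (h.mapsTo hy)
      (h.solves _ hy _ (mem_extChartAt_source _))

theorem SolvesAt.congr {x₀ : P × ℝ} {γ γ' : ℝ → P × ℝ} {ρ : ℝ} (h : SolvesAt g 𝒜 x₀ γ ρ)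
    (he : γ =ᶠ[𝓝 ρ] γ') : SolvesAt g 𝒜 x₀ γ' ρ := by
  have h1 : (extChartAt (ambientModel d) x₀ ∘ γ) =ᶠ[𝓝 ρ] extChartAt (ambientModel d) x₀ ∘ γ' := by
    filter_upwards [he] with σ hσ
    exact congrArg _ hσ
  unfold SolvesAt at h ⊢
  rw [← h1.deriv.deriv_eq, ← h1.deriv_eq, ← he.eq_of_nhds]
  exact h

/-- The points `(z, ρ)` such that the segment from `(z, 0)` to `(z, ρ)` is contained in `O`. -/
def starCore (O : Set (P × ℝ)) : Set (P × ℝ) := {y | ∀ σ ∈ uIcc 0 y.2, (y.1, σ) ∈ O}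

theorem starCore_subset (O : Set (P × ℝ)) : starCore O ⊆ O := fun y hy ↦ hy y.2 right_mem_uIcc

theorem mem_starCore_of_mem_uIcc {O : Set (P × ℝ)} {z : P} {ρ σ : ℝ} (h : (z, ρ) ∈ starCore O)
    (hσ : σ ∈ uIcc 0 ρ) : (z, σ) ∈ starCore O := fun τ hτ ↦
  h τ (uIcc_subset_uIcc left_mem_uIcc hσ hτ)

theorem isOpen_starCore {O : Set (P × ℝ)} (hO : IsOpen O) : IsOpen (starCore O) := by
  rw [isOpen_iff_mem_nhds]
  rintro ⟨z, ρ⟩ hy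
  have hsub : ({z} : Set P) ×ˢ uIcc 0 ρ ⊆ O := by
    rintro ⟨z', σ⟩ ⟨hz', hσ⟩
    obtain rfl : z' = z := hz'
    exact hy σ hσ
  obtain ⟨u, v, hu, hv, hzu, hIv, huv⟩ := generalized_tube_lemma isCompact_singleton
    isCompact_uIcc hO hsub
  obtain ⟨ε, hε, hball⟩ := Metric.isOpen_iff.1 hv ρ (hIv right_mem_uIcc)
  refine Filter.mem_of_superset (prod_mem_nhds (hu.mem_nhds (hzu rfl)) (Metric.ball_mem_nhds ρ hε)) ?_
  rintro ⟨z', ρ'⟩ ⟨hz', hρ'⟩ σ hσ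
  refine huv ⟨hz', ?_⟩
  -- A segment ending near `ρ` lies in the segment ending at `ρ`, covered by the tube, together with
  -- a short piece near `ρ`.
  rcases uIcc_subset_uIcc_union_uIcc (b := ρ) hσ with h | h
  · exact hIv h
  · refine hball ?_
    exact (convex_ball ρ ε).ordConnected.uIcc_subset (Metric.mem_ball_self hε) hρ' h

theorem ordConnected_starCore (O : Set (P × ℝ)) (z : P) :
    OrdConnected {ρ : ℝ | (z, ρ) ∈ starCore O} := by
  refine ⟨fun x hx y hy σ hσ ↦ ?_⟩
  rcases le_total 0 σ with h | h
  · exact mem_starCore_of_mem_uIcc hy (by rw [uIcc_of_le (h.trans hσ.2)]; exact ⟨h, hσ.2⟩)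
  · exact mem_starCore_of_mem_uIcc hx (by rw [uIcc_of_ge (hσ.1.trans h)]; exact ⟨hσ.1, h⟩)

/-- The normalizing maps fit together: there is one on a domain which meets every line `{z} × ℝ` in
an interval around `0`. -/
theorem exists_isNormalizing [T2Space P] (ht : IsFibreCoordinate W ι.form r.g t)
    (hS : IsWeylPreAmbient ι S g) (h𝒜 : IsAccelerationLaw W S g 𝒜) :
    ∃ φ D, IsNormalizing W t r.a S g 𝒜 φ D ∧ (∀ z, (z, (0 : ℝ)) ∈ D) ∧
      DilatationInvariant W D ∧
      ∀ s : ℝ, 0 < s → ∀ y ∈ D, φ (ambientδ W s y) = ambientδ W s (φ y) := by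
  classical
  -- Only star cores are used, because two normalizing maps are known to agree just at points joined
  -- to the slice by a segment in both domains.
  let D : Set (P × ℝ) := {y | ∃ ψ O, IsNormalizing W t r.a S g 𝒜 ψ O ∧ y ∈ starCore O}
  let φ : P × ℝ → P × ℝ := fun y ↦ if h : y ∈ D then h.choose y else y
  have hφ : ∀ {ψ O}, IsNormalizing W t r.a S g 𝒜 ψ O → ∀ y ∈ starCore O, φ y = ψ y := by
    intro ψ O h y hy
    have hD : y ∈ D := ⟨ψ, O, h, hy⟩
    have h1 : φ y = hD.choose y := dif_pos hD
    obtain ⟨O', h', hy'⟩ := hD.choose_spec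
    rw [h1]
    exact h'.eq_of_segment ht hS h𝒜 h hy' hy
  have hφe : ∀ {ψ O}, IsNormalizing W t r.a S g 𝒜 ψ O → ∀ y ∈ starCore O, φ =ᶠ[𝓝 y] ψ := by
    intro ψ O h y hy
    filter_upwards [(isOpen_starCore h.isOpen).mem_nhds hy] with y' hy'
    exact hφ h y' hy'
  have hDδ : ∀ s : ℝ, 0 < s → ∀ {ψ O}, IsNormalizing W t r.a S g 𝒜 ψ O → ∀ y ∈ starCore O,
      ambientδ W s y ∈ starCore (ambientδ W s⁻¹ ⁻¹' O) := by
    intro s hs ψ O h y hy σ hσ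
    change (W.δ s⁻¹ (W.δ s y.1), σ) ∈ O
    rw [W.δ_inv_δ hs]
    exact hy σ hσ
  refine ⟨φ, D, ⟨?_, ?_, ?_, ?_, ?_, ?_⟩, ?_, ?_, ?_⟩
  · rw [isOpen_iff_mem_nhds]
    rintro y ⟨ψ, O, h, hy⟩
    exact Filter.mem_of_superset ((isOpen_starCore h.isOpen).mem_nhds hy) fun y' hy' ↦ ⟨ψ, O, h, hy'⟩
  · rintro ⟨y, ψ, O, h, hy⟩
    exact IsLocalDiffeomorphAt.congr (h.localDiffeo ⟨y, starCore_subset O hy⟩) (hφe h y hy)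
  · rintro y ⟨ψ, O, h, hy⟩
    rw [hφ h y hy]
    exact h.mapsTo (starCore_subset O hy)
  · rintro z ⟨ψ, O, h, hy⟩
    rw [hφ h _ hy]
    exact h.id_zero z (starCore_subset O hy)
  · rintro z ⟨ψ, O, h, hy⟩
    rw [ambientDeriv_congr (hφe h _ hy)]
    exact h.initial z (starCore_subset O hy)
  · rintro y ⟨ψ, O, h, hy⟩ x₀ hx₀
    rw [hφ h y hy] at hx₀
    refine (h.solves y (starCore_subset O hy) x₀ hx₀).congr ?_
    exact ((Continuous.prodMk_right y.1).continuousAt (x := y.2)).eventually (hφe h y hy).symm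
  · intro z
    obtain ⟨ψ, O, h, hz⟩ := exists_isNormalizing_nhds ht hS h𝒜 z
    refine ⟨ψ, O, h, fun σ hσ ↦ ?_⟩
    have : σ = 0 := by simpa using hσ
    rw [this]
    exact hz
  · rintro s hs y ⟨ψ, O, h, hy⟩
    exact ⟨_, _, h.dilate ht hS h𝒜 hs, hDδ s hs h y hy⟩
  · rintro s hs y ⟨ψ, O, h, hy⟩
    -- At the dilated point the value is computed with the conjugated local map, which is legitimate
    -- since any local map may be used.
    rw [hφ (h.dilate ht hS h𝒜 hs) _ (hDδ s hs h y hy), hφ h y hy, ambientδ_inv_ambientδ hs]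

end Gluing

/-! ### Injectivity on a dilatation-invariant neighbourhood of `P × {0}`. -/

section Injectivity

/-- A map which is injective near every fibre of `pr` over `{ρ = 0}`, and which preserves these
fibres, is injective on a neighbourhood of `{ρ = 0}` which is described by `pr`, `pr ∘ φ` and `ρ`. -/
theorem exists_isOpen_injOn {Y B : Type*} [TopologicalSpace Y] [TopologicalSpace B]
    [TopologicalSpace.MetrizableSpace B] {pr : Y → B} (hpr : Continuous pr) {ρ : Y → ℝ}
    (hρ : Continuous ρ) {D : Set Y} (hD : IsOpen D) {φ : Y → Y} (hφ : ContinuousOn φ D)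
    (hinj : ∀ x, ∃ N ∈ 𝓝 x, ∃ ε > 0, InjOn φ {y ∈ D | pr y ∈ N ∧ |ρ y| < ε}) :
    ∃ T ⊆ D, IsOpen T ∧ InjOn φ T ∧ (∀ y ∈ D, ρ y = 0 → pr (φ y) = pr y → y ∈ T) ∧
      ∀ y ∈ T, ∀ y' ∈ D, pr y' = pr y → ρ y' = ρ y → pr (φ y') = pr (φ y) → y' ∈ T := by
  let _ := TopologicalSpace.metrizableSpaceMetric B
  let region : B → ℝ → Set Y := fun x R ↦ {y ∈ D | pr y ∈ Metric.ball x R ∧ |ρ y| < R}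
  -- The supremum of these radii measures injectivity over `x`. The bound `1` keeps it finite, and
  -- `0` is admissible since its region is empty.
  let adm : B → Set ℝ := fun x ↦ {R | 0 ≤ R ∧ R ≤ 1 ∧ InjOn φ (region x R)}
  let r : B → ℝ := fun x ↦ sSup (adm x)
  have hbdd : ∀ x, BddAbove (adm x) := fun x ↦ ⟨1, fun R hR ↦ hR.2.1⟩
  have hzero : ∀ x, (0 : ℝ) ∈ adm x := fun x ↦ ⟨le_rfl, zero_le_one, by
    rintro y ⟨-, hy, -⟩
    simp at hy⟩
  have hr0 : ∀ x, 0 ≤ r x := fun x ↦ le_csSup (hbdd x) (hzero x)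
  have hrpos : ∀ x, 0 < r x := by
    intro x
    obtain ⟨N, hN, ε, hε, hi⟩ := hinj x
    obtain ⟨δ, hδ, hball⟩ := Metric.mem_nhds_iff.1 hN
    have hR : min (min δ ε) 1 ∈ adm x := by
      refine ⟨by positivity, min_le_right _ _, hi.mono ?_⟩
      rintro y ⟨hyD, hy1, hy2⟩
      refine ⟨hyD, hball (Metric.ball_subset_ball ?_ hy1), hy2.trans_le ?_⟩
      · exact (min_le_left _ _).trans (min_le_left _ _)
      · exact (min_le_left _ _).trans (min_le_right _ _)
    exact (by positivity : (0 : ℝ) < min (min δ ε) 1).trans_le (le_csSup (hbdd x) hR)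
  -- By the triangle inequality the region of radius `R - dist x x'` over `x'` lies in that of
  -- radius `R` over `x`; hence `r` is 1-Lipschitz.
  have hrle : ∀ x x', r x ≤ r x' + dist x x' := by
    intro x x'
    refine csSup_le ⟨0, hzero x⟩ fun R hR ↦ ?_
    by_cases h : R - dist x x' ≤ 0
    · linarith [hr0 x']
    · have h1 : R - dist x x' ∈ adm x' := by
        refine ⟨(not_le.1 h).le, by linarith [hR.2.1, dist_nonneg (x := x) (y := x')], hR.2.2.mono ?_⟩
        rintro y ⟨hyD, hy1, hy2⟩
        refine ⟨hyD, ?_, by linarith [dist_nonneg (x := x) (y := x')]⟩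
        rw [Metric.mem_ball] at hy1 ⊢
        linarith [dist_triangle (pr y) x' x, dist_comm x x']
      linarith [le_csSup (hbdd x') h1]
  have hrcont : Continuous r := by
    refine continuous_iff_continuousAt.2 fun x ↦ Metric.continuousAt_iff.2 fun ε hε ↦ ⟨ε, hε, ?_⟩
    intro x' hx'
    rw [Real.dist_eq, abs_lt]
    constructor <;> linarith [hrle x x', hrle x' x, dist_comm x x']
  -- If `φ y = φ y'` in `T`, and `y` has the larger radius `r`, then `pr y` and `pr y'` are at
  -- distance less than `r / 4 + r / 4` and both heights are below `r / 2`. So both points lie in a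
  -- region over `pr y` whose admissible radius exceeds `r / 2`.
  let T : Set Y := D ∩ {y | dist (pr (φ y)) (pr y) < r (pr y) / 4 ∧ |ρ y| < r (pr y) / 2}
  refine ⟨T, inter_subset_left, ?_, ?_, ?_, ?_⟩
  · have h1 : ContinuousOn (fun y ↦ (dist (pr (φ y)) (pr y), |ρ y|, r (pr y))) D :=
      (continuous_dist.comp_continuousOn
        ((hpr.comp_continuousOn hφ).prodMk hpr.continuousOn)).prodMk
        ((continuous_abs.comp hρ).continuousOn.prodMk (hrcont.comp hpr).continuousOn)
    have h2 : IsOpen {w : ℝ × ℝ × ℝ | w.1 < w.2.2 / 4 ∧ w.2.1 < w.2.2 / 2} :=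
      (isOpen_lt (f := fun w : ℝ × ℝ × ℝ ↦ w.1) (g := fun w ↦ w.2.2 / 4) (by fun_prop)
        (by fun_prop)).inter
        (isOpen_lt (f := fun w : ℝ × ℝ × ℝ ↦ w.2.1) (g := fun w ↦ w.2.2 / 2) (by fun_prop)
          (by fun_prop))
    exact h1.isOpen_inter_preimage hD h2
  · have key : ∀ y ∈ T, ∀ y' ∈ T, φ y = φ y' → r (pr y') ≤ r (pr y) → y = y' := by
      rintro y ⟨hyD, hy1, hy2⟩ y' ⟨hyD', hy1', hy2'⟩ he hle
      obtain ⟨R, hR, hlt⟩ := exists_lt_of_lt_csSup ⟨0, hzero (pr y)⟩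
        (show r (pr y) / 2 < sSup (adm (pr y)) by linarith [hrpos (pr y), show sSup (adm (pr y)) = r (pr y) from rfl])
      have hpos := hrpos (pr y)
      refine hR.2.2 ⟨hyD, ?_, by linarith⟩ ⟨hyD', ?_, by linarith⟩ he
      · rw [Metric.mem_ball, dist_self]
        linarith
      · rw [Metric.mem_ball]
        rw [← he] at hy1'
        have := dist_triangle (pr y') (pr (φ y)) (pr y)
        rw [dist_comm (pr y') (pr (φ y))] at this
        linarith
    intro y hy y' hy' he
    rcases le_total (r (pr y')) (r (pr y)) with h | h
    · exact key y hy y' hy' he h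
    · exact (key y' hy' y hy he.symm h).symm
  · intro y hy h1 h2
    refine ⟨hy, ?_, ?_⟩
    · rw [h2, dist_self]
      linarith [hrpos (pr y)]
    · rw [h1, abs_zero]
      linarith [hrpos (pr y)]
  · rintro y ⟨-, hy1, hy2⟩ y' hy' h1 h2 h3
    refine ⟨hy', ?_, ?_⟩
    · rwa [h1, h3]
    · rwa [h1, h2]

set_option synthInstance.maxHeartbeats 200000
set_option linter.unusedSectionVars false

variable {d p q : ℕ}
  {M : Type*} [TopologicalSpace M] [ChartedSpace (EuclideanSpace ℝ (Fin d)) M]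
  [IsManifold (𝓡 d) ∞ M]
  {P : Type*} [TopologicalSpace P] [ChartedSpace (EuclideanSpace ℝ (Fin (d + 1))) P]
  [IsManifold (𝓡 (d + 1)) ∞ P] {W : WeylStructure d M P}
  {c : WeylClass d p q M} {ι : MetricBundleIso W c} {r : WeylPair d p q M} {t : P → ℝ}

theorem WeylStructure.exists_δ_eq (W : WeylStructure d M P) {z z' : P} (h : W.proj z = W.proj z') :
    ∃ s : ℝ, 0 < s ∧ W.δ s z = z' := by
  obtain ⟨U, -, hU, τ, ⟨-, hbij, -⟩, hτ⟩ := W.local_trivialization (W.proj z)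
  have hz : z ∈ W.proj ⁻¹' U := hU
  have hz' : z' ∈ W.proj ⁻¹' U := by
    change W.proj z' ∈ U
    rw [← h]
    exact hU
  have h1 : 0 < τ z := (hbij.mapsTo hz).2
  have h2 : 0 < τ z' := (hbij.mapsTo hz').2
  have hs : 0 < τ z' / τ z := div_pos h2 h1
  have hsz : W.δ (τ z' / τ z) z ∈ W.proj ⁻¹' U := by
    change W.proj _ ∈ U
    rw [W.proj_δ _ hs]
    exact hU
  refine ⟨_, hs, hbij.injOn hsz hz' (Prod.ext ?_ ?_)⟩
  · exact (W.proj_δ _ hs z).trans h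
  · exact (hτ z hz _ hs).trans (mul_div_cancel₀ _ h1.ne')

/-- The projection and a fibre coordinate determine the neighbourhoods of a point. -/
theorem IsFibreCoordinate.eventually_mem (ht : IsFibreCoordinate W ι.form r.g t) {z₀ : P}
    {A : Set P} (hA : A ∈ 𝓝 z₀) :
    ∀ᶠ w in 𝓝 (W.proj z₀, t z₀), ∀ z, W.proj z = w.1 → t z = w.2 → z ∈ A := by
  obtain ⟨U, hUo, hU, τ, ⟨-, hbij, hld⟩, hτ⟩ := W.local_trivialization (W.proj z₀)
  have hloc := hld ⟨z₀, hU⟩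
  set i := hloc.localInverse with hi
  have hi0 : i (W.proj z₀, τ z₀) = z₀ := hloc.localInverse_left_inv hloc.localInverse_mem_target
  have hic : ContinuousAt i (W.proj z₀, τ z₀) := hloc.localInverse_contMDiffAt.continuousAt
  -- A local section of the bundle through `z₀`; rescaling it to a prescribed value of `t` gives the
  -- continuous inverse `k` of `(proj, t)`.
  let ξ : M → P := fun x ↦ i (x, τ z₀)
  have hξ0 : ξ (W.proj z₀) = z₀ := hi0
  have hξ : ContinuousAt ξ (W.proj z₀) :=
    ContinuousAt.comp (g := i) (f := fun x ↦ (x, τ z₀)) hic (Continuous.prodMk_left _).continuousAt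
  have hξp : ∀ᶠ x in 𝓝 (W.proj z₀), W.proj (ξ x) = x := by
    have h1 : ∀ᶠ w in 𝓝 (W.proj z₀, τ z₀), (W.proj (i w), τ (i w)) = w :=
      hloc.localInverse_eventuallyEq_right
    have h2 : Filter.Tendsto (fun x ↦ (x, τ z₀)) (𝓝 (W.proj z₀)) (𝓝 (W.proj z₀, τ z₀)) :=
      (Continuous.prodMk_left (τ z₀)).continuousAt
    filter_upwards [h2.eventually h1] with x hx
    exact congrArg Prod.fst hx
  let k : M × ℝ → P := fun w ↦ W.δ (w.2 / t (ξ w.1)) (ξ w.1)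
  have htc : Continuous t := ht.smooth.continuous
  have hξ' : ContinuousAt (fun w : M × ℝ ↦ ξ w.1) (W.proj z₀, t z₀) :=
    ContinuousAt.comp (g := ξ) (f := Prod.fst) hξ continuousAt_fst
  have hpair : ContinuousAt (fun w : M × ℝ ↦ (w.2 / t (ξ w.1), ξ w.1)) (W.proj z₀, t z₀) :=
    (continuousAt_snd.div (htc.continuousAt.comp hξ') (ht.pos _).ne').prodMk hξ'
  have h1 : t z₀ / t (ξ (W.proj z₀)) = 1 := by
    rw [hξ0]
    exact div_self (ht.pos z₀).ne'
  have hk : ContinuousAt k (W.proj z₀, t z₀) := by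
    refine ContinuousAt.comp (g := fun w : ℝ × P ↦ W.δ w.1 w.2) ?_ hpair
    refine W.δ_smooth.continuousOn.continuousAt ((isOpen_Ioi.prod isOpen_univ).mem_nhds ⟨?_, mem_univ _⟩)
    change 0 < t z₀ / t (ξ (W.proj z₀))
    rw [h1]
    exact one_pos
  have hk0 : k (W.proj z₀, t z₀) = z₀ := by
    change W.δ (t z₀ / t (ξ (W.proj z₀))) (ξ (W.proj z₀)) = z₀
    rw [h1, W.δ_one, hξ0]
  have hev := hk.preimage_mem_nhds (t := A) (by rw [hk0]; exact hA)
  filter_upwards [hev, continuousAt_fst.eventually hξp] with w hw hw' z hz1 hz2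
  obtain ⟨s, hs, hsz⟩ := W.exists_δ_eq (show W.proj (ξ w.1) = W.proj z from hw'.trans hz1.symm)
  have h2 : t z = t (ξ w.1) * s := by rw [← hsz, ht.dilate s hs]
  have h3 : w.2 / t (ξ w.1) = s := by
    rw [← hz2, h2, mul_div_cancel_left₀ _ (ht.pos _).ne']
  have h4 : k w = z := by
    change W.δ (w.2 / t (ξ w.1)) (ξ w.1) = z
    rw [h3, hsz]
  rw [← h4]
  exact hw

/-- An equivariant map which is injective near a point of `P × {0}` is injective near its fibre. -/
theorem exists_injOn_fibre (ht : IsFibreCoordinate W ι.form r.g t) {φ : P × ℝ → P × ℝ}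
    {D : Set (P × ℝ)}
    (hφδ : ∀ s : ℝ, 0 < s → ∀ y ∈ D, φ (ambientδ W s y) = ambientδ W s (φ y)) {z₀ : P}
    (hφ0 : φ (z₀, 0) = (z₀, 0)) (hφc : ContinuousAt φ (z₀, 0)) {N : Set (P × ℝ)}
    (hN : N ∈ 𝓝 (z₀, (0 : ℝ))) (hinj : InjOn φ N) :
    ∃ V ∈ 𝓝 (W.proj z₀), ∃ ε > 0, InjOn φ {y ∈ D | W.proj y.1 ∈ V ∧ |y.2| < ε} := by
  have htc : Continuous t := ht.smooth.continuous
  have ht0 := ht.pos z₀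
  -- The factor by which `φ` changes the fibre coordinate. It is dilatation-invariant on `D` and
  -- equals `1` at `(z₀, 0)`, so it is close to `1` near the whole fibre.
  let f : P × ℝ → ℝ := fun y ↦ t (φ y).1 / t y.1
  have hf0 : f (z₀, 0) = 1 := by
    change t (φ (z₀, 0)).1 / t z₀ = 1
    rw [hφ0]
    exact div_self ht0.ne'
  have hfc : ContinuousAt f (z₀, 0) :=
    ContinuousAt.div (htc.continuousAt.comp (continuousAt_fst.comp hφc))
      (htc.continuousAt.comp continuousAt_fst) (ht.pos _).ne'
  have hprod : ∀ {N : Set (P × ℝ)}, N ∈ 𝓝 (z₀, (0 : ℝ)) → ∃ A ∈ 𝓝 z₀, ∃ ε > 0,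
      ∀ z ∈ A, ∀ ρ : ℝ, |ρ| < ε → (z, ρ) ∈ N := by
    intro N hN
    obtain ⟨A, hA, B, hB, hAB⟩ := mem_nhds_prod_iff.1 hN
    obtain ⟨ε, hε, hball⟩ := Metric.mem_nhds_iff.1 hB
    exact ⟨A, hA, ε, hε, fun z hz ρ hρ ↦ hAB ⟨hz, hball (by simpa using hρ)⟩⟩
  have hsep : ∀ {A : Set P}, A ∈ 𝓝 z₀ → ∃ V ∈ 𝓝 (W.proj z₀), ∃ η > 0,
      ∀ z, W.proj z ∈ V → |t z - t z₀| < η → z ∈ A := by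
    intro A hA
    obtain ⟨V, hV, B, hB, hVB⟩ := mem_nhds_prod_iff.1 (ht.eventually_mem hA)
    obtain ⟨η, hη, hball⟩ := Metric.mem_nhds_iff.1 hB
    exact ⟨V, hV, η, hη, fun z hz hz' ↦
      hVB (⟨hz, hball (by simpa [Real.dist_eq] using hz')⟩ : (W.proj z, t z) ∈ V ×ˢ B) z rfl rfl⟩
  obtain ⟨A, hA, ε, hε, hAN⟩ := hprod hN
  obtain ⟨V, hV, η, hη, hVA⟩ := hsep hA
  -- If `f y₁` and `f y₂` are within `θ` of `1`, then `t z₀ |f y₁ - f y₂| / f y₂ < t z₀ · 2θ / (1/2)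
  -- ≤ η`, the estimate needed for the second point below.
  set θ : ℝ := min (1 / 2) (η / (4 * t z₀)) with hθ
  have hθpos : 0 < θ := by positivity
  have hN' : {y | |f y - 1| < θ} ∈ 𝓝 (z₀, (0 : ℝ)) := by
    have h1 : ContinuousAt (fun y ↦ |f y - 1|) (z₀, 0) :=
      continuous_abs.continuousAt.comp (hfc.sub continuousAt_const)
    refine h1.preimage_mem_nhds (isOpen_Iio.mem_nhds ?_)
    change |f (z₀, 0) - 1| < θ
    rw [hf0, sub_self, abs_zero]
    exact hθpos
  obtain ⟨A', hA', ε', hε', hAN'⟩ := hprod hN'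
  obtain ⟨V', hV', η', hη', hVA'⟩ := hsep hA'
  refine ⟨V ∩ V', Filter.inter_mem hV hV', min ε ε', lt_min hε hε', ?_⟩
  have hfδ : ∀ y ∈ D, ∀ s : ℝ, 0 < s → f (ambientδ W s y) = f y := by
    intro y hy s hs
    change t (φ (ambientδ W s y)).1 / t (W.δ s y.1) = t (φ y).1 / t y.1
    rw [hφδ s hs y hy, ht.dilate s hs]
    change t (W.δ s (φ y).1) / _ = _
    rw [ht.dilate s hs, mul_div_mul_right _ _ hs.ne']
  have hfy : ∀ y ∈ D, W.proj y.1 ∈ V' → |y.2| < ε' → |f y - 1| < θ := by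
    intro y hy hyV hyε
    have hs : 0 < t z₀ / t y.1 := div_pos ht0 (ht.pos _)
    rw [← hfδ y hy _ hs]
    refine hAN' _ (hVA' _ ?_ ?_) _ hyε
    · rw [W.proj_δ _ hs]
      exact hyV
    · rw [ht.dilate _ hs, mul_div_cancel₀ _ (ht.pos _).ne', sub_self, abs_zero]
      exact hη'
  rintro y₁ ⟨hD₁, ⟨hV₁, hV₁'⟩, hε₁⟩ y₂ ⟨hD₂, ⟨hV₂, hV₂'⟩, hε₂⟩ he
  have hf₁ := hfy y₁ hD₁ hV₁' (hε₁.trans_le (min_le_right _ _))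
  have hf₂ := hfy y₂ hD₂ hV₂' (hε₂.trans_le (min_le_right _ _))
  have hp₁ := ht.pos y₁.1
  have hp₂ := ht.pos y₂.1
  -- This dilatation brings `y₁` to the level `t = t z₀`. As `φ y₁ = φ y₂` forces `t y₁ f y₁ = t y₂
  -- f y₂`, it brings `y₂` within `η` of that level, so both land where `φ` is injective.
  set s : ℝ := t z₀ / t y₁.1 with hs_def
  have hs : 0 < s := div_pos ht0 hp₁
  have hmem₁ : ambientδ W s y₁ ∈ N := by
    refine hAN _ (hVA _ ?_ ?_) _ (hε₁.trans_le (min_le_left _ _))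
    · rw [W.proj_δ _ hs]
      exact hV₁
    · rw [ht.dilate _ hs, hs_def, mul_div_cancel₀ _ hp₁.ne', sub_self, abs_zero]
      exact hη
  have hmem₂ : ambientδ W s y₂ ∈ N := by
    refine hAN _ (hVA _ ?_ ?_) _ (hε₂.trans_le (min_le_left _ _))
    · rw [W.proj_δ _ hs]
      exact hV₂
    · rw [ht.dilate _ hs]
      have hθ1 : θ ≤ 1 / 2 := min_le_left _ _
      have hθ2 : θ ≤ η / (4 * t z₀) := min_le_right _ _
      rw [le_div_iff₀ (by positivity)] at hθ2
      rw [abs_lt] at hf₁ hf₂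
      have hf₂pos : 0 < f y₂ := by linarith
      have e1 : t y₁.1 * f y₁ = t y₂.1 * f y₂ := by
        change t y₁.1 * (t (φ y₁).1 / t y₁.1) = t y₂.1 * (t (φ y₂).1 / t y₂.1)
        rw [mul_div_cancel₀ _ hp₁.ne', mul_div_cancel₀ _ hp₂.ne', he]
      have e2 : t y₂.1 * s - t z₀ = t z₀ * (f y₁ - f y₂) / f y₂ := by
        rw [hs_def]
        field_simp
        linear_combination (-1 : ℝ) * e1
      rw [e2, abs_lt, lt_div_iff₀ hf₂pos, div_lt_iff₀ hf₂pos]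
      constructor
      · nlinarith
      · nlinarith
  have h1 : φ (ambientδ W s y₁) = φ (ambientδ W s y₂) := by
    rw [hφδ s hs y₁ hD₁, hφδ s hs y₂ hD₂, he]
  have h2 := congrArg (ambientδ W s⁻¹) (hinj hmem₁ hmem₂ h1)
  rwa [ambientδ_inv_ambientδ hs, ambientδ_inv_ambientδ hs] at h2

end Injectivity

/-! ### From normalizing maps to the Weyl-normal form and back. -/

section NormalForm

set_option synthInstance.maxHeartbeats 200000
set_option linter.unusedSectionVars false

variable {d p q : ℕ}
  {M : Type*} [TopologicalSpace M] [ChartedSpace (EuclideanSpace ℝ (Fin d)) M]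
  [IsManifold (𝓡 d) ∞ M]
  {P : Type*} [TopologicalSpace P] [ChartedSpace (EuclideanSpace ℝ (Fin (d + 1))) P]
  [IsManifold (𝓡 (d + 1)) ∞ P] {W : WeylStructure d M P}
  {c : WeylClass d p q M} {ι : MetricBundleIso W c} {r : WeylPair d p q M} {t : P → ℝ}
  {S : Set (P × ℝ)} {g : BilinField (ambientModel d) (P × ℝ)}
  {𝒜 : ∀ y : P × ℝ, TangentSpace (ambientModel d) y → TangentSpace (ambientModel d) y}
  {S' : Set (P × ℝ)} {φ : P × ℝ → P × ℝ}

theorem WeylStructure.exists_proj_eq (W : WeylStructure d M P) (x : M) : ∃ z, W.proj z = x := by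
  obtain ⟨U, -, hU, τ, ⟨-, hbij, -⟩, -⟩ := W.local_trivialization x
  obtain ⟨z, -, hz⟩ := hbij.surjOn (show (x, (1 : ℝ)) ∈ U ×ˢ Ioi 0 from ⟨hU, one_pos (α := ℝ)⟩)
  exact ⟨z, congrArg Prod.fst hz⟩

theorem exists_isNormalizing_injOn [T2Space P] [TopologicalSpace.MetrizableSpace M]
    (ht : IsFibreCoordinate W ι.form r.g t)
    (hS : IsWeylPreAmbient ι S g) (h𝒜 : IsAccelerationLaw W S g 𝒜) :
    ∃ φ S', IsNormalizing W t r.a S g 𝒜 φ S' ∧ InjOn φ S' ∧ (∀ z, (z, (0 : ℝ)) ∈ S') ∧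
      DilatationInvariant W S' ∧
      (∀ s : ℝ, 0 < s → ∀ y ∈ S', φ (ambientδ W s y) = ambientδ W s (φ y)) ∧
      (∀ z, ∀ ρ : ℝ, (z, ρ) ∈ S' → ∀ σ ∈ uIcc 0 ρ, (z, σ) ∈ S') ∧
      ∀ z, OrdConnected {ρ : ℝ | (z, ρ) ∈ S'} := by
  obtain ⟨φ, D, hφ, hD0, hDδ, hφδ⟩ := exists_isNormalizing ht hS h𝒜
  have hloc : ∀ x : M, ∃ N ∈ 𝓝 x, ∃ ε > 0,
      InjOn φ {y ∈ D | W.proj y.1 ∈ N ∧ |y.2| < ε} := by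
    intro x
    obtain ⟨z, rfl⟩ := W.exists_proj_eq x
    obtain ⟨Φ, hz, hΦ⟩ := hφ.localDiffeo ⟨(z, 0), hD0 z⟩
    exact exists_injOn_fibre ht hφδ (hφ.id_zero z (hD0 z)) (hφ.continuousAt (hD0 z))
      (Φ.open_source.mem_nhds hz) (Φ.injOn.congr hΦ.symm)
  obtain ⟨T, hTD, hTo, hTi, hT0, hTδ⟩ := exists_isOpen_injOn (pr := fun y : P × ℝ ↦ W.proj y.1)
    (W.proj_smooth.continuous.comp continuous_fst) continuous_snd hφ.isOpen
    (fun y hy ↦ (hφ.continuousAt hy).continuousWithinAt) hloc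
  have hT0' : ∀ z, (z, (0 : ℝ)) ∈ T := fun z ↦
    hT0 _ (hD0 z) rfl (congrArg (fun y : P × ℝ ↦ W.proj y.1) (hφ.id_zero z (hD0 z)))
  -- Membership in `T` depends, within `D`, only on `proj y`, `proj (φ y)` and `ρ`, none of which a
  -- dilatation changes.
  have hTinv : DilatationInvariant W T := fun s hs y hy ↦
    hTδ y hy _ (hDδ s hs y (hTD hy)) (W.proj_δ s hs y.1) rfl
      ((congrArg (fun y : P × ℝ ↦ W.proj y.1) (hφδ s hs y (hTD hy))).trans (W.proj_δ s hs _))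
  -- Cutting down to `T` may have destroyed the intervals over the points of `P`. The star core
  -- restores them and remains dilatation-invariant, as dilatations move segments `{z} × [0, ρ]` to
  -- such segments.
  refine ⟨φ, starCore T, hφ.mono (isOpen_starCore hTo) ((starCore_subset T).trans hTD),
    hTi.mono (starCore_subset T), fun z σ hσ ↦ ?_, fun s hs y hy σ hσ ↦ hTinv s hs _ (hy σ hσ),
    fun s hs y hy ↦ hφδ s hs y (hTD (starCore_subset T hy)),
    fun z ρ hy σ hσ ↦ mem_starCore_of_mem_uIcc hy hσ, ordConnected_starCore T⟩
  obtain rfl : σ = 0 := by simpa using hσ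
  exact hT0' z

/-- The condition on the metric along `P × {0}` in terms of the components of tangent vectors. -/
theorem initial_components_iff (a : CovectorField (𝓡 d) M)
    (B : BilinField (ambientModel d) (P × ℝ)) (z : P) :
    (∀ v w : TangentSpace (ambientModel d) (z, (0 : ℝ)),
      let dz := mfderiv (ambientModel d) (𝓡 (d + 1)) (Prod.fst : P × ℝ → P) (z, 0)
      let dρ := mvfderiv (ambientModel d) (Prod.snd : P × ℝ → ℝ) (z, 0)
      let n := connectionForm W t a z
      B (z, 0) v w = tautologicalTensor ι z (dz v) (dz w)
        + t z ^ 2 * (n (dz v) * dρ w + n (dz w) * dρ v)) ↔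
    ∀ v w : AmbientSpace d, ambientForm B (z, 0) v w = tautologicalTensor ι z v.1 w.1
      + t z ^ 2 * (connForm W t a z v.1 * w.2 + connForm W t a z w.1 * v.2) := by
  have h1 : ∀ v : AmbientSpace d, (mfderiv (ambientModel d) (𝓡 (d + 1)) (Prod.fst : P × ℝ → P)
      (z, 0) v : EuclideanSpace ℝ (Fin (d + 1))) = v.1 := fun v ↦
    congrArg (fun f : AmbientSpace d →L[ℝ] EuclideanSpace ℝ (Fin (d + 1)) ↦ f v) mfderiv_fst
  have h2 : ∀ v : AmbientSpace d, (mvfderiv (ambientModel d) (Prod.snd : P × ℝ → ℝ) (z, 0) v : ℝ)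
      = v.2 := fun v ↦ congrArg (fun f : AmbientSpace d →L[ℝ] ℝ ↦ f v) mfderiv_snd
  let F : EuclideanSpace ℝ (Fin (d + 1)) → EuclideanSpace ℝ (Fin (d + 1)) → ℝ → ℝ → ℝ :=
    fun x x' σ σ' ↦ tautologicalTensor ι z x x'
      + t z ^ 2 * (connForm W t a z x * σ' + connForm W t a z x' * σ)
  have key : ∀ v w : AmbientSpace d, ∀ x x' σ σ', x = v.1 → x' = w.1 → σ = v.2 → σ' = w.2 →
      F x x' σ σ' = F v.1 w.1 v.2 w.2 := by
    rintro v w _ _ _ _ rfl rfl rfl rfl; rfl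
  refine forall_congr' fun v ↦ forall_congr' fun w ↦ ?_
  have h3 := key v w _ _ _ _ (h1 v) (h1 w) (h2 v) (h2 w)
  exact ⟨fun h ↦ Eq.trans h h3, fun h ↦ Eq.trans h h3.symm⟩

/-- Differentiate the equivariance relation in `s` at `s = 1`. This carries the orthogonality of `𝒯`
and `𝒜` back to the pulled back metric. -/
theorem ambientDeriv_ambientT_of_commutes (hφ : MDifferentiableAt (ambientModel d) (ambientModel d) φ y)
    (h : ∀ s : ℝ, 0 < s → φ (ambientδ W s y) = ambientδ W s (φ y)) :
    ambientDeriv φ y (ambientT W y) = ambientT W (φ y) := by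
  have e1 : MDifferentiableAt 𝓘(ℝ, ℝ) (ambientModel d) (fun s : ℝ ↦ ambientδ W s y) 1 :=
    (mdifferentiableAt_δ_apply y.1).prodMk mdifferentiableAt_const
  have e2 : (fun s : ℝ ↦ ambientδ W s (φ y)) =ᶠ[𝓝 1] φ ∘ fun s ↦ ambientδ W s y := by
    filter_upwards [Ioi_mem_nhds (zero_lt_one (α := ℝ))] with s hs
    exact (h s hs).symm
  have e3 : MDifferentiableAt (ambientModel d) (ambientModel d) φ (ambientδ W 1 y) := by
    rwa [ambientδ_one]
  have e4 := congrArg (fun f : ℝ →L[ℝ] AmbientSpace d ↦ f 1) (mfderiv_comp 1 e3 e1)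
  have e5 := congrArg (fun f : ℝ →L[ℝ] AmbientSpace d ↦ f 1)
    (e2.mfderiv_eq (I := 𝓘(ℝ, ℝ)) (I' := ambientModel d))
  have e6 : ∀ y', y' = y → ∀ v : AmbientSpace d, ambientDeriv φ y' v = ambientDeriv φ y v := by
    rintro _ rfl v; rfl
  exact (e6 _ (ambientδ_one y) _).symm.trans (e4.symm.trans e5.symm)

theorem IsNormalizing.isWeylPreAmbient (hS : IsWeylPreAmbient ι S g)
    (h : IsNormalizing W t r.a S g 𝒜 φ S') (h0 : ∀ z, (z, (0 : ℝ)) ∈ S')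
    (hinv : DilatationInvariant W S')
    (hδ : ∀ s : ℝ, 0 < s → ∀ y ∈ S', φ (ambientδ W s y) = ambientδ W s (φ y)) :
    IsWeylPreAmbient ι S' (pullbackForm (ambientModel d) (ambientModel d) φ g) where
  isOpen := h.isOpen
  invariant := hinv
  zero_mem := h0
  tautological := by
    funext z
    refine ContinuousLinearMap.ext fun w ↦ ContinuousLinearMap.ext fun w' ↦ ?_
    have e1 : MDifferentiableAt (ambientModel d) (ambientModel d) φ (z, 0) :=
      IsLocalDiffeomorphAt.mdifferentiableAt (h.localDiffeo ⟨_, h0 z⟩) (by simp)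
    have e2 := ambientDeriv_of_eq_zeroSlice e1 (.of_forall fun z ↦ h.id_zero z (h0 z))
    have e3 : ∀ x, x = (z, (0 : ℝ)) → ∀ v v', v = ((w, 0) : AmbientSpace d) →
        v' = ((w', 0) : AmbientSpace d) →
        ambientForm g x v v' = ambientForm g (z, 0) (w, 0) (w', 0) := by
      rintro _ rfl _ _ rfl rfl; rfl
    have e4 := e3 _ (h.id_zero z (h0 z)) _ _
      ((congrArg (ambientDeriv φ (z, 0)) (mfderiv_zeroSlice z w)).trans (e2 w))
      ((congrArg (ambientDeriv φ (z, 0)) (mfderiv_zeroSlice z w')).trans (e2 w'))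
    exact e4.trans (hS.ambientForm_zeroSlice z w w')
  metric := hS.metric.pullbackForm hS.isOpen h.isOpen h.localDiffeo h.mapsTo
  homogeneous := by
    intro s hs y hy
    refine ContinuousLinearMap.ext fun v ↦ ContinuousLinearMap.ext fun w ↦ ?_
    have e1 : ∀ y ∈ S', MDifferentiableAt (ambientModel d) (ambientModel d) φ y := fun y hy ↦
      IsLocalDiffeomorphAt.mdifferentiableAt (h.localDiffeo ⟨y, hy⟩) (by simp)
    have e2 : φ ∘ ambientδ W s =ᶠ[𝓝 y] ambientδ W s ∘ φ := by
      filter_upwards [h.isOpen.mem_nhds hy] with y' hy'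
      exact hδ s hs y' hy'
    have e3 : ∀ v : AmbientSpace d, ambientDeriv φ (ambientδ W s y) (ambientDeriv (ambientδ W s) y v)
        = ambientDeriv (ambientδ W s) (φ y) (ambientDeriv φ y v) := by
      intro v
      rw [← ambientDeriv_comp (e1 _ (hinv s hs y hy)) (mdifferentiableAt_ambientδ hs y),
        ambientDeriv_congr e2, ambientDeriv_comp (mdifferentiableAt_ambientδ hs _) (e1 y hy)]
    have e4 : ∀ x, x = ambientδ W s (φ y) → ∀ u u' v v' : AmbientSpace d, u = v → u' = v' →
        ambientForm g x u u' = ambientForm g (ambientδ W s (φ y)) v v' := by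
      rintro _ rfl _ _ _ _ rfl rfl; rfl
    have e5 := e4 _ (hδ s hs y hy) _ _ _ _ (e3 v) (e3 w)
    exact e5.trans (hS.ambientForm_ambientδ hs (h.mapsTo hy) _ _)

theorem IsNormalizing.bringsToWeylNormalForm (hS : IsWeylPreAmbient ι S g)
    (h𝒜 : IsAccelerationLaw W S g 𝒜)
    (h : IsNormalizing W t r.a S g 𝒜 φ S') (hinj : InjOn φ S') (h0 : ∀ z, (z, (0 : ℝ)) ∈ S')
    (hinv : DilatationInvariant W S')
    (hδ : ∀ s : ℝ, 0 < s → ∀ y ∈ S', φ (ambientδ W s y) = ambientδ W s (φ y))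
    (hconn : ∀ z, OrdConnected {ρ : ℝ | (z, ρ) ∈ S'})
    {A : ∀ y : P × ℝ, TangentSpace (ambientModel d) y}
    (hA : ∀ y ∈ S', mfderiv (ambientModel d) (ambientModel d) φ y (A y)
      = 𝒜 (φ y) (mfderiv (ambientModel d) (ambientModel d) φ y (ambientU y))) :
    BringsToWeylNormalForm ι r t S g 𝒜 S' φ A where
  diffeo := ⟨h.isOpen, hinj.bijOn_image, h.localDiffeo⟩
  mapsTo := h.mapsTo
  commutes := hδ
  id_zero := fun z ↦ h.id_zero z (h0 z)
  acceleration := hA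
  normalForm :=
    { preAmbient := h.isWeylPreAmbient hS h0 hinv hδ
      interval := fun z ↦ ⟨h.isOpen.preimage (Continuous.prodMk_right z), hconn z, h0 z⟩
      acceleration := by
        obtain ⟨nabla, hn⟩ := exists_isLeviCivitaOn_pullbackForm hS.isOpen hS.metric h.isOpen
          h.localDiffeo h.mapsTo
        refine ⟨nabla, hn, fun y hy ↦ ?_⟩
        have e1 := (hn.acceleration_iff_solvesAt (𝒜 := 𝒜) hS.isOpen hS.metric hy (h.localDiffeo ⟨y, hy⟩)
          (mem_extChartAt_source (φ y)) (h.mapsTo hy)).2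
          (h.solves y hy _ (mem_extChartAt_source (φ y)))
        -- Both `∇_𝒰 𝒰` and `A` are mapped by the injective differential of `φ` to the prescribed
        -- acceleration.
        exact IsLocalDiffeomorphAt.mfderiv_injective (h.localDiffeo ⟨y, hy⟩) (e1.trans (hA y hy).symm)
      acceleration_orth := by
        intro y hy
        have e1 := ambientDeriv_ambientT_of_commutes (W := W)
          (IsLocalDiffeomorphAt.mdifferentiableAt (h.localDiffeo ⟨y, hy⟩) (by simp))
          fun s hs ↦ hδ s hs y hy
        have e2 : ∀ u u' v v' : AmbientSpace d, u = v → u' = v' →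
            ambientForm g (φ y) u u' = ambientForm g (φ y) v v' := by
          rintro _ _ _ _ rfl rfl; rfl
        exact (e2 _ _ _ _ e1 (hA y hy)).trans (h𝒜.orth _ (h.mapsTo hy) _)
      initial := fun z ↦ (initial_components_iff _ _ z).2
        ((initial_iff_isInitialVelocity hS
          (IsLocalDiffeomorphAt.mdifferentiableAt (h.localDiffeo ⟨_, h0 z⟩) (by simp))
          fun z ↦ h.id_zero z (h0 z)).2 (h.initial z (h0 z))) }

/-- This direction makes uniqueness along segments available for every competing map, whatever
Levi-Civita connection witnesses its acceleration. -/
theorem BringsToWeylNormalForm.isNormalizing (hS : IsWeylPreAmbient ι S g)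
    {A : ∀ y : P × ℝ, TangentSpace (ambientModel d) y}
    (h : BringsToWeylNormalForm ι r t S g 𝒜 S' φ A) :
    IsNormalizing W t r.a S g 𝒜 φ S' where
  isOpen := h.diffeo.1
  localDiffeo := h.diffeo.2.2
  mapsTo := h.mapsTo
  id_zero := fun z _ ↦ h.id_zero z
  initial := fun z hz ↦ (initial_iff_isInitialVelocity hS
    (IsLocalDiffeomorphAt.mdifferentiableAt (h.diffeo.2.2 ⟨_, hz⟩) (by simp)) h.id_zero).1
    ((initial_components_iff _ _ z).1 (h.normalForm.initial z))
  solves := by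
    intro y hy x₀ hx₀
    obtain ⟨nabla, hn, hU⟩ := h.normalForm.acceleration
    refine (hn.acceleration_iff_solvesAt hS.isOpen hS.metric hy (h.diffeo.2.2 ⟨y, hy⟩) hx₀
      (h.mapsTo hy)).1 ?_
    rw [hU y hy]
    exact h.acceleration y hy

end NormalForm

end

theorem mainTheorem3 {d p q : ℕ}
    {M : Type*} [TopologicalSpace M] [T2Space M] [SecondCountableTopology M]
    [ChartedSpace (EuclideanSpace ℝ (Fin d)) M] [IsManifold (𝓡 d) ∞ M]
    {P : Type*} [TopologicalSpace P] [T2Space P] [SecondCountableTopology P]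
    [ChartedSpace (EuclideanSpace ℝ (Fin (d + 1))) P] [IsManifold (𝓡 (d + 1)) ∞ P]
    -- the Weyl class `[g, a]`, and a Weyl structure over `(M, [g, a])`
    (c : WeylClass d p q M) (W : WeylStructure d M P) (ι : MetricBundleIso W c)
    -- a representative `(g, a)` and the fibre coordinate induced by `g`
    (r : WeylPair d p q M) (hr : r.toClass = c)
    (t : P → ℝ) (ht : IsFibreCoordinate W ι.form r.g t)
    -- a Weyl pre-ambient space
    (S : Set (P × ℝ)) (g : BilinField (ambientModel d) (P × ℝ)) (hS : IsWeylPreAmbient ι S g)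
    -- a law of acceleration
    (𝒜 : ∀ y : P × ℝ, TangentSpace (ambientModel d) y → TangentSpace (ambientModel d) y)
    (h𝒜 : IsAccelerationLaw W S g 𝒜) :
    ∃ S' : Set (P × ℝ),
      IsOpen S' ∧ DilatationInvariant W S' ∧ (∀ z : P, (z, (0 : ℝ)) ∈ S') ∧
      ∃ (φ : P × ℝ → P × ℝ) (A' : ∀ y : P × ℝ, TangentSpace (ambientModel d) y),
        BringsToWeylNormalForm ι r t S g 𝒜 S' φ A' ∧
        ((∀ y ∈ S, ∀ v, g y (𝒜 y v) v = 0) →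
          ∀ y ∈ S', pullbackForm (ambientModel d) (ambientModel d) φ g y (A' y) (ambientU y) = 0) ∧
        ∀ (ψ : P × ℝ → P × ℝ) (B' : ∀ y : P × ℝ, TangentSpace (ambientModel d) y),
          BringsToWeylNormalForm ι r t S g 𝒜 S' ψ B' → EqOn ψ φ S' := by
  -- Local compactness enters the metrizability of `M`, and a metric on `M` is what the radius
  -- function for injectivity is built from.
  have := ChartedSpace.locallyCompactSpace (EuclideanSpace ℝ (Fin d)) M
  have : TopologicalSpace.MetrizableSpace M := Manifold.metrizableSpace (𝓡 d) M
  obtain ⟨φ, S', h, hinj, h0, hinv, hδ, hstar, hconn⟩ := exists_isNormalizing_injOn ht hS h𝒜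
  -- The acceleration `A'` is forced on `S'`, where the differential of `φ` is invertible, and
  -- arbitrary elsewhere.
  have hex : ∀ y, ∃ v : TangentSpace (ambientModel d) y, y ∈ S' →
      mfderiv (ambientModel d) (ambientModel d) φ y v
        = 𝒜 (φ y) (mfderiv (ambientModel d) (ambientModel d) φ y (ambientU y)) := by
    intro y
    by_cases hy : y ∈ S'
    · obtain ⟨v, hv⟩ := (IsLocalDiffeomorphAt.mfderivToContinuousLinearEquiv
        (h.localDiffeo ⟨y, hy⟩) (by simp)).surjective
          (𝒜 (φ y) (mfderiv (ambientModel d) (ambientModel d) φ y (ambientU y)))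
      exact ⟨v, fun _ ↦ hv⟩
    · exact ⟨ambientU y, fun h ↦ absurd h hy⟩
  choose A hA using hex
  refine ⟨S', h.isOpen, hinv, h0, φ, A,
    h.bringsToWeylNormalForm hS h𝒜 hinj h0 hinv hδ hconn hA, fun horth y hy ↦ ?_, ?_⟩
  -- By definition of the pullback, the product of `A'` and `𝒰` is that of `𝒜(φ_* 𝒰)` and `φ_* 𝒰`.
  · have e1 : ∀ u v w : AmbientSpace d, u = v → ambientForm g (φ y) u w = ambientForm g (φ y) v w := by
      rintro _ _ _ rfl; rfl
    exact (e1 _ _ _ (hA y hy)).trans (horth _ (h.mapsTo hy) _)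
  · rintro ψ B' hψ ⟨z, ρ⟩ hy
    -- The common domain contains the segment from `(z, 0)` to each of its points `(z, ρ)`, so
    -- uniqueness along segments covers all of it.
    exact (hψ.isNormalizing hS).eq_of_segment ht hS h𝒜 h (hstar z ρ hy) (hstar z ρ hy)
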